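/- **Conventions.** A strategy $\mathcal S$ consists of finite-dimensional Hilbert spaces $H_A,H_B$, a measurement for every question of Alice (on $H_A$) and of Bob (on $H_B$), and a unit vector $|\psi\rangle\in H_A\otimes H_B$. In parts 1 and 2 the measurements of the given and of the constructed strategies are projective (orthogonal projections $E^i_a$, resp. $F^j_b$, with $\sum_aE^i_a=\mathbb 1$, $\sum_bF^j_b=\mathbb 1$); in part 3 they are given by self-adjoint unitaries $Y_i$, $X_j$. For a game $\mathcal G$ with question distribution $\eta$ and $0/1$ predicate $V$, let $$\omega(\mathcal G;\mathcal S)=\sum_{i,j}\eta(i,j)\sum_{a,b}V(a,b|i,j)\langle\psi|E^i_a\otimes F^j_b|\psi\rangle,$$ and let $\omega^*(\mathcal G)$ be the supremum of $\omega(\mathcal G;\cdot)$ over all finite-dimensional (POVM) strategies. $\mathcal S$ is $\epsilon$-optimal if $\omega(\mathcal G;\mathcal S)\ge\omega^*(\mathcal G)-\epsilon$, and $\epsilon$-perfect if $\omega(\mathcal G;\mathcal S)\ge1-\epsilon$. A unit vector of $\mathbb C^r\otimes\mathbb C^r$ is maximally entangled if both of its reduced density matrices are $\mathbb 1/r$.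 A strategy $\tilde{\mathcal S}$ on $\mathbb C^r\otimes\mathbb C^r$ is *$\delta$-close to $\mathcal S$ on the support of its maximally entangled state* if there are isometries $V_A:\mathbb C^r\to H_A$, $V_B:\mathbb C^r\to H_B$ such that every measurement operator $M$ of Alice (resp. Bob) in $\mathcal S$ and the corresponding operator $\tilde M$ in $\tilde{\mathcal S}$ satisfy $\|MV-V\tilde M\|_f\le\delta$ with $V=V_A$ (resp. $V=V_B$), where $\|T\|_f=(\operatorname{tr}(T^*T)/r)^{1/2}$. **Corollary 1.3.** 1. (Synchronous games.) Let $\mathcal G$ be a nonlocal game with the same finite question set $I$ and the same finite answer set $A$ for both players, with $V(a,b|i,i)=0$ whenever $a\ne b$, and with $\eta(i,i)>0$ for all $i\in I$. There is a constant $C>0$ depending only on $\mathcal G$ such that for every $\epsilon\ge0$ and every $\epsilon$-perfect synchronous strategy $\mathcal S$ (that is, $H_A=H_B=\mathbb C^d$, all measurements are projective, and $E^i_a=\overline{F^i_a}$ entrywise for all $i,a$), there is a $C\epsilon^{1/4}$-optimal strategy $\tilde{\mathcal S}$ using a maximally entangled state that is $C\epsilon^{1/8}$-close to $\mathcal S$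 on the support of that state. 2. (BCS games.) Let $x_1,\dots,x_n$ be $\{\pm1\}$-valued variables and let $f_i:\{\pm1\}^{K_i}\to\{\pm1\}$, $1\le i\le m$, be constraints with scopes $K_i$, where $f_i=-1$ means "satisfied". In the BCS game Alice receives $i$ and answers with an assignment of $K_i$ that satisfies the $i$-th constraint, Bob receives $j$ and answers with a value for $x_j$, and they win if $x_j\notin K_i$ or if their values for $x_j$ agree. Assume that every variable lies in some $K_i$ and that $\eta(i,j)>0$ whenever $x_j\in K_i$. There is a constant $C>0$ depending only on the game such that for every $\epsilon\ge0$ and every $\epsilon$-perfect strategy $\mathcal S$ there is a $C\epsilon^{1/2}$-optimal strategy $\tilde{\mathcal S}$ using a maximally entangled state that is $C\epsilon^{1/4}$-close to $\mathcal S$ on the support of that state. 3. (XOR games.) Let $T=(t_{ij})$ be an $m\times n$ matrix of bits and $\pi$ a probability distribution on $[m]\times[n]$ such that every row and every column of $\pi$ has a positive entry. The bias of $\mathcal S$ is $\beta(\mathcal S)=\sum_{i,j}(-1)^{t_{ij}}\pi(i,j)\langle\psi|Y_i\otimes X_j|\psi\rangle$, $\beta^*$ is its supremum over all finite-dimensional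 strategies, and $\mathcal S$ is $\epsilon$-optimal if $|\beta(\mathcal S)-\beta^*|\le\epsilon$. There is a constant $C>0$ depending only on the game such that for every $\epsilon\ge0$ and every $\epsilon$-optimal strategy $\mathcal S$ there is a $C\epsilon^{1/8}$-optimal strategy $\tilde{\mathcal S}$ using a maximally entangled state that is $C\epsilon^{1/8}$-close to $\mathcal S$ on the support of that state. -/

import Mathlib

open scoped Matrix Kronecker ComplexOrder

universe u v w x

noncomputable section

/-! ## Norm, states, maximal entanglement -/

/-- The little Frobenius norm `‖T‖_f = (tr(T* T) / r)^{1/2}`, where `r` is the dimension of the space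
on which `T` acts.  For a square matrix it is the normalized Hilbert-Schmidt norm.  For
`T : ℂ^r → ℂ^d` of the form `T = X V`, with `V` an isometry of `ℂ^r` onto a subspace of `ℂ^d`, it is
the little Frobenius norm of `X` on that subspace, `‖X P‖_F / (tr P)^{1/2}` with `P = V V*`. -/
def littleFrobenius {d r : ℕ} (T : Matrix (Fin d) (Fin r) ℂ) : ℝ :=
  Real.sqrt ((Tᴴ * T).trace.re / r)

/-- `⟨ψ| E ⊗ F |ψ⟩` for a vector `ψ` of `ℂ^dA ⊗ ℂ^dB`, given by its coordinates in the product basis.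
(For Hermitian `E` and `F` this number is real; its real part is taken to get a value in `ℝ`.) -/
def expectation {dA dB : ℕ} (E : Matrix (Fin dA) (Fin dA) ℂ) (F : Matrix (Fin dB) (Fin dB) ℂ)
    (ψ : Fin dA × Fin dB → ℂ) : ℝ :=
  (star ψ ⬝ᵥ ((E ⊗ₖ F) *ᵥ ψ)).re

/-- The reduced density matrix of `|ψ⟩⟨ψ|` on `ℂ^dA` (partial trace over `ℂ^dB`). -/
def reducedDensityA {dA dB : ℕ} (ψ : Fin dA × Fin dB → ℂ) : Matrix (Fin dA) (Fin dA) ℂ :=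
  Matrix.of fun s s' => ∑ t, ψ (s, t) * star (ψ (s', t))

/-- The reduced density matrix of `|ψ⟩⟨ψ|` on `ℂ^dB` (partial trace over `ℂ^dA`). -/
def reducedDensityB {dA dB : ℕ} (ψ : Fin dA × Fin dB → ℂ) : Matrix (Fin dB) (Fin dB) ℂ :=
  Matrix.of fun t t' => ∑ s, ψ (s, t) * star (ψ (s, t'))

/-- `ψ ∈ ℂ^r ⊗ ℂ^r` is maximally entangled: both reduced density matrices are `1 / r`. -/
def IsMaximallyEntangled {r : ℕ} (ψ : Fin r × Fin r → ℂ) : Prop :=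
  reducedDensityA ψ = (1 / (r : ℂ)) • (1 : Matrix (Fin r) (Fin r) ℂ) ∧
    reducedDensityB ψ = (1 / (r : ℂ)) • (1 : Matrix (Fin r) (Fin r) ℂ)

/-! ## Nonlocal games and finite-dimensional strategies -/

/-- A two-player nonlocal game: questions `i : I`, `j : J`, answers `a : A i`, `b : B j`, a probability
distribution `η` on the question pairs, and the rule predicate `V`.  (The answer sets may depend on
the question, as they do in constraint system games.) -/
structure NonlocalGame {I : Type u} {J : Type v} [Fintype I] [Fintype J]
    (A : I → Type w) (B : J → Type x) where
  η : I → J → ℝ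
  η_nonneg : ∀ i j, 0 ≤ η i j
  η_sum : ∑ i, ∑ j, η i j = 1
  V : ∀ i j, A i → B j → Bool

/-- A finite-dimensional quantum strategy on `ℂ^dA ⊗ ℂ^dB`: a measurement (POVM) for each question of
each player and a shared unit vector. -/
structure QStrategy {I : Type u} {J : Type v} (A : I → Type w) (B : J → Type x)
    [∀ i, Fintype (A i)] [∀ j, Fintype (B j)] (dA dB : ℕ) where
  E : ∀ i, A i → Matrix (Fin dA) (Fin dA) ℂ
  F : ∀ j, B j → Matrix (Fin dB) (Fin dB) ℂ
  E_pos : ∀ i a, (E i a).PosSemidef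
  F_pos : ∀ j b, (F j b).PosSemidef
  E_sum : ∀ i, ∑ a, E i a = 1
  F_sum : ∀ j, ∑ b, F j b = 1
  ψ : Fin dA × Fin dB → ℂ
  ψ_unit : star ψ ⬝ᵥ ψ = 1

/-- The strategy is projective (a PVM strategy): all measurement operators are orthogonal
projections. -/
def QStrategy.IsProjective {I : Type u} {J : Type v} {A : I → Type w} {B : J → Type x}
    [∀ i, Fintype (A i)] [∀ j, Fintype (B j)] {dA dB : ℕ} (S : QStrategy A B dA dB) : Prop :=
  (∀ i a, IsStarProjection (S.E i a)) ∧ (∀ j b, IsStarProjection (S.F j b))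

/-- The winning probability `ω(G; S)`. -/
def NonlocalGame.value {I : Type u} {J : Type v} [Fintype I] [Fintype J]
    {A : I → Type w} {B : J → Type x} [∀ i, Fintype (A i)] [∀ j, Fintype (B j)]
    (G : NonlocalGame A B) {dA dB : ℕ} (S : QStrategy A B dA dB) : ℝ :=
  ∑ i, ∑ j, G.η i j *
    ∑ a, ∑ b, (if G.V i j a b = true then 1 else 0) * expectation (S.E i a) (S.F j b) S.ψ

/-- The quantum value `ω*(G)`: the supremum of the winning probabilities of all finite-dimensional
(POVM) strategies. -/
def NonlocalGame.quantumValue {I : Type u} {J : Type v} [Fintype I] [Fintype J]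
    {A : I → Type w} {B : J → Type x} [∀ i, Fintype (A i)] [∀ j, Fintype (B j)]
    (G : NonlocalGame A B) : ℝ :=
  sSup {p : ℝ | ∃ (dA dB : ℕ) (S : QStrategy A B dA dB), G.value S = p}

/-- `S` is `ε`-optimal for `G`. -/
def NonlocalGame.IsOptimalUpTo {I : Type u} {J : Type v} [Fintype I] [Fintype J]
    {A : I → Type w} {B : J → Type x} [∀ i, Fintype (A i)] [∀ j, Fintype (B j)]
    (G : NonlocalGame A B) (ε : ℝ) {dA dB : ℕ} (S : QStrategy A B dA dB) : Prop :=
  G.quantumValue - ε ≤ G.value S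

/-- `S` is `ε`-perfect for `G`. -/
def NonlocalGame.IsPerfectUpTo {I : Type u} {J : Type v} [Fintype I] [Fintype J]
    {A : I → Type w} {B : J → Type x} [∀ i, Fintype (A i)] [∀ j, Fintype (B j)]
    (G : NonlocalGame A B) (ε : ℝ) {dA dB : ℕ} (S : QStrategy A B dA dB) : Prop :=
  1 - ε ≤ G.value S

/-- Every measurement operator of `S'` (a strategy on `ℂ^r ⊗ ℂ^r`) is within `δ` of the corresponding
operator of `S` in the little Frobenius norm on the support of the state of `S'`.  Here
`ℂ^r ⊗ ℂ^r`, which is the support of the state of `S'` when that state is maximally entangled, is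
placed inside `ℂ^dA ⊗ ℂ^dB` by local isometries `VA`, `VB`. -/
def QStrategy.IsCloseOnSupport {I : Type u} {J : Type v} {A : I → Type w} {B : J → Type x}
    [∀ i, Fintype (A i)] [∀ j, Fintype (B j)] {dA dB r : ℕ}
    (S : QStrategy A B dA dB) (S' : QStrategy A B r r) (δ : ℝ) : Prop :=
  ∃ (VA : Matrix (Fin dA) (Fin r) ℂ) (VB : Matrix (Fin dB) (Fin r) ℂ),
    VAᴴ * VA = 1 ∧ VBᴴ * VB = 1 ∧
    (∀ i a, littleFrobenius (S.E i a * VA - VA * S'.E i a) ≤ δ) ∧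
    (∀ j b, littleFrobenius (S.F j b * VB - VB * S'.F j b) ≤ δ)

/-! ## Synchronous games -/

/-- The synchronous condition: different answers to the same question lose. -/
def NonlocalGame.IsSynchronous {I : Type u} [Fintype I] {A : Type w}
    (G : NonlocalGame (fun _ : I => A) (fun _ : I => A)) : Prop :=
  ∀ (i : I) (a b : A), a ≠ b → G.V i i a b = false

/-- A synchronous strategy: it is projective, and Alice's projections are the entrywise complex
conjugates of Bob's. -/
def QStrategy.IsSynchronous {I : Type u} {A : Type w} [Fintype A] {d : ℕ}
    (S : QStrategy (fun _ : I => A) (fun _ : I => A) d d) : Prop :=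
  S.IsProjective ∧ ∀ i a, S.E i a = (S.F i a).map star

/-! ## Binary constraint system games -/

/-- A binary constraint system with `m` constraints on `n` variables with values in `{±1}`; the `i`-th
constraint is a function `f i : {±1}^{K i} → {±1}` of the variables in its scope `K i`, and it is
satisfied where `f i = -1`. -/
structure BinaryConstraintSystem (m n : ℕ) where
  K : Fin m → Finset (Fin n)
  f : ∀ i, (K i → ℤˣ) → ℤˣ

/-- The satisfying assignments of the `i`-th constraint: Alice's possible answers to question `i`. -/
abbrev BinaryConstraintSystem.Answer {m n : ℕ} (C : BinaryConstraintSystem m n) (i : Fin m) : Type :=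
  {φ : C.K i → ℤˣ // C.f i φ = -1}

/-- The BCS game with question distribution `η`: Alice answers constraint `i` by a satisfying
assignment, Bob answers variable `j` by a value in `{±1}`; they lose exactly if `j` is in the scope
of `i` and their values for it differ. -/
def BinaryConstraintSystem.game {m n : ℕ} (C : BinaryConstraintSystem m n)
    (η : Fin m → Fin n → ℝ) (η_nonneg : ∀ i j, 0 ≤ η i j) (η_sum : ∑ i, ∑ j, η i j = 1) :
    NonlocalGame C.Answer (fun _ : Fin n => ℤˣ) where
  η := η
  η_nonneg := η_nonneg
  η_sum := η_sum
  V := fun i j φ b => decide (∀ h : j ∈ C.K i, φ.1 ⟨j, h⟩ = b)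

/-! ## XOR games -/

/-- An XOR game: an `m × n` matrix of bits and a probability distribution on the question pairs. -/
structure XORGame (m n : ℕ) where
  T : Matrix (Fin m) (Fin n) (Fin 2)
  prob : Fin m → Fin n → ℝ
  prob_nonneg : ∀ i j, 0 ≤ prob i j
  prob_sum : ∑ i, ∑ j, prob i j = 1

/-- The cost matrix. -/
def XORGame.cost {m n : ℕ} (G : XORGame m n) (i : Fin m) (j : Fin n) : ℝ :=
  (-1) ^ (G.T i j : ℕ) * G.prob i j

/-- A finite-dimensional strategy for an `m × n` XOR game: `±1`-valued observables (self-adjoint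
unitaries) `Y i` for Alice and `X j` for Bob, and a shared unit vector. -/
structure XORStrategy (m n dA dB : ℕ) where
  Y : Fin m → Matrix (Fin dA) (Fin dA) ℂ
  X : Fin n → Matrix (Fin dB) (Fin dB) ℂ
  Y_selfAdjoint : ∀ i, (Y i).IsHermitian
  X_selfAdjoint : ∀ j, (X j).IsHermitian
  Y_sq : ∀ i, Y i * Y i = 1
  X_sq : ∀ j, X j * X j = 1
  ψ : Fin dA × Fin dB → ℂ
  ψ_unit : star ψ ⬝ᵥ ψ = 1

/-- The bias `β(G; S)`. -/
def XORGame.bias {m n : ℕ} (G : XORGame m n) {dA dB : ℕ} (S : XORStrategy m n dA dB) : ℝ :=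
  ∑ i, ∑ j, G.cost i j * expectation (S.Y i) (S.X j) S.ψ

/-- The optimal bias `β*(G)`. -/
def XORGame.optimalBias {m n : ℕ} (G : XORGame m n) : ℝ :=
  sSup {β : ℝ | ∃ (dA dB : ℕ) (S : XORStrategy m n dA dB), G.bias S = β}

/-- `S` is `ε`-optimal for the XOR game `G`. -/
def XORGame.IsOptimalUpTo {m n : ℕ} (G : XORGame m n) (ε : ℝ) {dA dB : ℕ}
    (S : XORStrategy m n dA dB) : Prop :=
  |G.bias S - G.optimalBias| ≤ ε

/-- Every observable of `S'` is within `δ` of the corresponding observable of `S` in the little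
Frobenius norm on the support of the state of `S'`; see `QStrategy.IsCloseOnSupport`. -/
def XORStrategy.IsCloseOnSupport {m n dA dB r : ℕ}
    (S : XORStrategy m n dA dB) (S' : XORStrategy m n r r) (δ : ℝ) : Prop :=
  ∃ (VA : Matrix (Fin dA) (Fin r) ℂ) (VB : Matrix (Fin dB) (Fin r) ℂ),
    VAᴴ * VA = 1 ∧ VBᴴ * VB = 1 ∧
    (∀ i, littleFrobenius (S.Y i * VA - VA * S'.Y i) ≤ δ) ∧
    (∀ j, littleFrobenius (S.X j * VB - VB * S'.X j) ≤ δ)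

end

/-! Write the state as a matrix `K`, so that `⟨ψ|E ⊗ F|ψ⟩ = tr(K* E K Fᵀ)`. Near-optimality forces
every operator `E` of Alice to satisfy `E K ≈ K G` in Frobenius norm for some Hermitian `G` on Bob's
side, and conversely. For such pairs `E` almost commutes with `|K*|` and `G` with `|K|`
(`Schmidt.fro_commutator_abs_le`).

Take a Schmidt decomposition with coefficients `d`. The layer-cake formula writes `d²` as a
nonnegative combination of indicators of a chain of sets `S` of Schmidt indices, so `KK*` and `K*K`
become averages, with the same weights, of projections onto spans of left and right Schmidt vectors.
Each `S` carries a maximally entangled vector on these two spans. Since `min (d s²) (d t²)` is close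
to `d s²`, `d t²` and `d s * d t` wherever an almost commuting operator has large entries, the
averages over `S` of the invariance defects and of the game functional are controlled linearly by
the commutators. As all these defects are nonnegative, one nonempty `S` is good for all of them at
once (`Schmidt.exists_good_cut`).

Compressing the measurements to the two spans gives approximate measurements, which spectral
rounding turns into exact ones with constants independent of the dimension (`exists_pvm_near`,
`exists_observable_near`).

The games differ only in how `E K ≈ K G` is obtained. In a synchronous game `G` is Bob's projection
for the same question and answer, since disagreement loses. In a BCS game Alice's marginal
projection for one variable is matched with Bob's, and an assignment projection is a product of
marginals. In an XOR game Tsirelson's theorem turns optimality into a statement on unit vectors: in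
a near-optimal configuration each vector of Alice is close to a real combination of Bob's vectors
(`BoundsVectors.exists_combination`), so `G` is a real combination of Bob's observables. -/

noncomputable section

open scoped Matrix.Norms.L2Operator

/-! ### Frobenius norm, operator norm, isometries and projections -/

section Frobenius

variable {l m n p : Type*} [Fintype l] [Fintype m] [Fintype n] [Fintype p]

/-- The (unnormalized) Frobenius norm of a complex matrix. -/
def fro (A : Matrix m n ℂ) : ℝ := ‖WithLp.toLp 2 (fun q : m × n => A q.1 q.2)‖

theorem fro_nonneg (A : Matrix m n ℂ) : 0 ≤ fro A := norm_nonneg _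

theorem fro_sq (A : Matrix m n ℂ) : fro A ^ 2 = ∑ i, ∑ j, ‖A i j‖ ^ 2 := by
  rw [fro, EuclideanSpace.norm_sq_eq, Fintype.sum_prod_type]

theorem fro_add_le (A B : Matrix m n ℂ) : fro (A + B) ≤ fro A + fro B := by
  exact norm_add_le (WithLp.toLp 2 (fun q : m × n => A q.1 q.2))
    (WithLp.toLp 2 (fun q : m × n => B q.1 q.2))

theorem fro_neg (A : Matrix m n ℂ) : fro (-A) = fro A := by
  exact norm_neg (WithLp.toLp 2 (fun q : m × n => A q.1 q.2))

theorem fro_sub_comm (A B : Matrix m n ℂ) : fro (A - B) = fro (B - A) := by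
  rw [← fro_neg, neg_sub]

theorem fro_sub_le (A B : Matrix m n ℂ) : fro (A - B) ≤ fro A + fro B := by
  rw [sub_eq_add_neg, ← fro_neg B]; exact fro_add_le _ _

theorem fro_zero : fro (0 : Matrix m n ℂ) = 0 := by
  have := fro_sq (0 : Matrix m n ℂ)
  simpa using this

theorem fro_smul (c : ℂ) (A : Matrix m n ℂ) : fro (c • A) = ‖c‖ * fro A := by
  exact norm_smul c (WithLp.toLp 2 (fun q : m × n => A q.1 q.2))

theorem fro_sum_le {ι : Type*} (s : Finset ι) (A : ι → Matrix m n ℂ) :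
    fro (∑ i ∈ s, A i) ≤ ∑ i ∈ s, fro (A i) := by
  classical
  induction s using Finset.induction_on with
  | empty => simp [fro_zero]
  | insert a s ha ih =>
    rw [Finset.sum_insert ha, Finset.sum_insert ha]
    exact (fro_add_le _ _).trans (by gcongr)

theorem fro_eq_zero {A : Matrix m n ℂ} (h : fro A = 0) : A = 0 := by
  unfold fro at h
  rw [norm_eq_zero] at h
  ext i j
  simpa using congrFun (congrArg WithLp.ofLp h) (i, j)

theorem fro_conjTranspose (A : Matrix m n ℂ) : fro Aᴴ = fro A := by
  rw [← sq_eq_sq₀ (fro_nonneg _) (fro_nonneg _), fro_sq, fro_sq, Finset.sum_comm]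
  simp

theorem fro_transpose (A : Matrix m n ℂ) : fro Aᵀ = fro A := by
  rw [← sq_eq_sq₀ (fro_nonneg _) (fro_nonneg _), fro_sq, fro_sq, Finset.sum_comm]
  simp

theorem fro_reindex (e : m ≃ p) (f : n ≃ l) (A : Matrix m n ℂ) :
    fro (A.submatrix e.symm f.symm) = fro A := by
  rw [← sq_eq_sq₀ (fro_nonneg _) (fro_nonneg _), fro_sq, fro_sq]
  simp only [Matrix.submatrix_apply]
  rw [Equiv.sum_comp e.symm (fun i => ∑ j, ‖A i (f.symm j)‖ ^ 2)]
  exact Finset.sum_congr rfl fun i _ => Equiv.sum_comp f.symm (fun j => ‖A i j‖ ^ 2)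

theorem trace_mul_re (A : Matrix m n ℂ) (B : Matrix n m ℂ) :
    (A * B).trace.re = ∑ i, ∑ j, (A i j * B j i).re := by
  simp [Matrix.trace, Matrix.mul_apply, Complex.re_sum]

theorem fro_sq_eq_trace (A : Matrix m n ℂ) : fro A ^ 2 = (Aᴴ * A).trace.re := by
  rw [fro_sq, trace_mul_re, Finset.sum_comm]
  refine Finset.sum_congr rfl fun i _ => Finset.sum_congr rfl fun j _ => ?_
  rw [Matrix.conjTranspose_apply, Complex.star_def, mul_comm, Complex.mul_conj, Complex.normSq_eq_norm_sq]
  norm_cast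

theorem fro_sq_eq_trace' (A : Matrix m n ℂ) : fro A ^ 2 = (A * Aᴴ).trace.re := by
  rw [Matrix.trace_mul_comm, fro_sq_eq_trace]

/-- Cauchy–Schwarz for nonnegative double sums, in terms of Frobenius norms. -/
theorem sum_norm_mul_norm_le (A B : Matrix m n ℂ) :
    ∑ i, ∑ j, ‖A i j‖ * ‖B i j‖ ≤ fro A * fro B := by
  apply le_of_sq_le_sq ?_ (mul_nonneg (fro_nonneg _) (fro_nonneg _))
  rw [mul_pow, fro_sq, fro_sq, ← Fintype.sum_prod_type', ← Fintype.sum_prod_type',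
    ← Fintype.sum_prod_type']
  exact Finset.sum_mul_sq_le_sq_mul_sq _ _ _

theorem abs_trace_mul_le (A : Matrix m n ℂ) (B : Matrix n m ℂ) :
    |(A * B).trace.re| ≤ fro A * fro B := by
  rw [trace_mul_re, ← fro_transpose B]
  refine le_trans ?_ (sum_norm_mul_norm_le _ _)
  refine (Finset.abs_sum_le_sum_abs _ _).trans (Finset.sum_le_sum fun i _ => ?_)
  refine (Finset.abs_sum_le_sum_abs _ _).trans (Finset.sum_le_sum fun j _ => ?_)
  exact (Complex.abs_re_le_norm _).trans (by simp)

theorem fro_mul_le_left [DecidableEq n] (A : Matrix m n ℂ) (X : Matrix n p ℂ) :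
    fro (A * X) ≤ ‖A‖ * fro X := by
  apply le_of_sq_le_sq ?_ (mul_nonneg (norm_nonneg _) (fro_nonneg _))
  rw [mul_pow, fro_sq, fro_sq, Finset.sum_comm, Finset.sum_comm (f := fun i j => ‖X i j‖ ^ 2),
    Finset.mul_sum]
  refine Finset.sum_le_sum fun j _ => ?_
  have h := Matrix.l2_opNorm_mulVec A (WithLp.toLp 2 (fun i => X i j))
  have h2 := pow_le_pow_left₀ (norm_nonneg _) h 2
  rw [mul_pow, EuclideanSpace.norm_sq_eq, EuclideanSpace.norm_sq_eq] at h2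
  simpa [Matrix.mul_apply, Matrix.mulVec, dotProduct] using h2

theorem fro_mul_le_right [DecidableEq m] [DecidableEq n] (X : Matrix l m ℂ) (A : Matrix m n ℂ) :
    fro (X * A) ≤ fro X * ‖A‖ := by
  rw [← fro_conjTranspose, Matrix.conjTranspose_mul, ← fro_conjTranspose X, mul_comm,
    ← Matrix.l2_opNorm_conjTranspose]
  exact fro_mul_le_left _ _

theorem fro_mul_le_of_norm_le_one [DecidableEq n] {A : Matrix m n ℂ} (hA : ‖A‖ ≤ 1)
    (X : Matrix n p ℂ) : fro (A * X) ≤ fro X :=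
  (fro_mul_le_left A X).trans (mul_le_of_le_one_left (fro_nonneg _) hA)

theorem fro_mul_le_of_norm_le_one' [DecidableEq m] [DecidableEq n] (X : Matrix l m ℂ)
    {A : Matrix m n ℂ} (hA : ‖A‖ ≤ 1) : fro (X * A) ≤ fro X :=
  (fro_mul_le_right X A).trans (mul_le_of_le_one_right (fro_nonneg _) hA)

theorem norm_le_one_of_conjTranspose_mul_self [DecidableEq n] {A : Matrix m n ℂ}
    (h : Aᴴ * A = 1) : ‖A‖ ≤ 1 := by
  have h1 := Matrix.l2_opNorm_conjTranspose_mul_self A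
  rw [h] at h1
  rcases isEmpty_or_nonempty n with hn | hn
  · have : A = 0 := by ext i j; exact isEmptyElim j
    simp [this]
  · rw [norm_one] at h1
    nlinarith [norm_nonneg A]

theorem norm_le_one_of_sq_eq_one [DecidableEq n] {A : Matrix n n ℂ} (hA : A.IsHermitian)
    (h : A * A = 1) : ‖A‖ ≤ 1 :=
  norm_le_one_of_conjTranspose_mul_self (by rw [hA.eq, h])

theorem IsStarProjection.matrix_norm_le_one [DecidableEq n] {A : Matrix n n ℂ}
    (hA : IsStarProjection A) : ‖A‖ ≤ 1 := by
  have h1 := Matrix.l2_opNorm_conjTranspose_mul_self A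
  have h2 : Aᴴ = A := hA.isSelfAdjoint
  rw [h2, hA.isIdempotentElem.eq] at h1
  nlinarith [norm_nonneg A]

theorem IsStarProjection.isHermitian {A : Matrix n n ℂ}
    (hA : IsStarProjection A) : A.IsHermitian := hA.isSelfAdjoint

theorem isStarProjection_mul_conjTranspose [DecidableEq n] {V : Matrix m n ℂ} (h : Vᴴ * V = 1) :
    IsStarProjection (V * Vᴴ) where
  isIdempotentElem := by
    rw [IsIdempotentElem, Matrix.mul_assoc, ← Matrix.mul_assoc Vᴴ, h, Matrix.one_mul]
  isSelfAdjoint := Matrix.isHermitian_mul_conjTranspose_self V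

theorem isStarProjection_one_sub_mul_conjTranspose [DecidableEq m] [DecidableEq n]
    {V : Matrix m n ℂ} (h : Vᴴ * V = 1) : IsStarProjection (1 - V * Vᴴ) :=
  (isStarProjection_mul_conjTranspose h).one_sub

/-- Pythagoras for an isometry. -/
theorem fro_one_sub_mul_sq [DecidableEq m] [DecidableEq n] {V : Matrix m n ℂ} (h : Vᴴ * V = 1)
    (X : Matrix m p ℂ) :
    fro ((1 - V * Vᴴ) * X) ^ 2 = fro X ^ 2 - fro (Vᴴ * X) ^ 2 := by
  have hp := isStarProjection_one_sub_mul_conjTranspose h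
  have e : (1 - V * Vᴴ)ᴴ = 1 - V * Vᴴ := hp.isSelfAdjoint
  rw [fro_sq_eq_trace, fro_sq_eq_trace, fro_sq_eq_trace, Matrix.conjTranspose_mul, e,
    Matrix.mul_assoc, ← Matrix.mul_assoc (1 - V * Vᴴ), hp.isIdempotentElem.eq, Matrix.sub_mul,
    Matrix.mul_sub, Matrix.trace_sub, Complex.sub_re, Matrix.conjTranspose_mul,
    Matrix.conjTranspose_conjTranspose]
  simp only [Matrix.one_mul, Matrix.mul_assoc]

theorem fro_sq_of_isStarProjection {P : Matrix n n ℂ} (hP : IsStarProjection P)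
    (X : Matrix n m ℂ) : fro (P * X) ^ 2 = (Xᴴ * P * X).trace.re := by
  rw [fro_sq_eq_trace, Matrix.conjTranspose_mul, hP.isHermitian.eq, Matrix.mul_assoc,
    ← Matrix.mul_assoc P, hP.isIdempotentElem.eq, Matrix.mul_assoc]

theorem fro_one_sq [DecidableEq n] : fro (1 : Matrix n n ℂ) ^ 2 = Fintype.card n := by
  rw [fro_sq_eq_trace]; simp

theorem fro_le_sqrt_card [DecidableEq m] [DecidableEq n] {A : Matrix m n ℂ} (h : ‖A‖ ≤ 1) :
    fro A ≤ Real.sqrt (Fintype.card n) := by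
  rw [← fro_one_sq, Real.sqrt_sq (fro_nonneg _)]
  simpa using fro_mul_le_of_norm_le_one h (1 : Matrix n n ℂ)

theorem norm_mul_le_one [DecidableEq m] [DecidableEq n] [DecidableEq l] {A : Matrix l m ℂ} {B : Matrix m n ℂ} (hA : ‖A‖ ≤ 1)
    (hB : ‖B‖ ≤ 1) : ‖A * B‖ ≤ 1 :=
  (Matrix.l2_opNorm_mul A B).trans (mul_le_one₀ hA (norm_nonneg _) hB)

theorem norm_conjTranspose_le_one [DecidableEq m] [DecidableEq n] {A : Matrix m n ℂ}
    (hA : ‖A‖ ≤ 1) : ‖Aᴴ‖ ≤ 1 := by rwa [Matrix.l2_opNorm_conjTranspose]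

theorem littleFrobenius_eq {d r : ℕ} (T : Matrix (Fin d) (Fin r) ℂ) :
    littleFrobenius T = fro T / Real.sqrt r := by
  rw [littleFrobenius, ← fro_sq_eq_trace, Real.sqrt_div (sq_nonneg _), Real.sqrt_sq (fro_nonneg _)]

end Frobenius

/-! ### Schmidt decomposition and almost commutation with the absolute value -/

section Schmidt

variable {a b T : Type*} [Fintype a] [Fintype b] [Fintype T] [DecidableEq T]

/-- A Schmidt decomposition `K = U diag(d) Vᴴ` with isometries `U`, `V` and `d ≥ 0`. -/
structure Schmidt (K : Matrix a b ℂ) (T : Type*) [Fintype T] [DecidableEq T] where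
  U : Matrix a T ℂ
  V : Matrix b T ℂ
  d : T → ℝ
  U_isometry : Uᴴ * U = 1
  V_isometry : Vᴴ * V = 1
  d_nonneg : ∀ t, 0 ≤ d t
  eq : K = U * Matrix.diagonal (fun t => (d t : ℂ)) * Vᴴ

namespace Schmidt

variable {K : Matrix a b ℂ} (σ : Schmidt K T)

/-- The diagonal matrix of Schmidt coefficients. -/
def D : Matrix T T ℂ := Matrix.diagonal (fun t => (σ.d t : ℂ))

theorem D_conjTranspose : σ.Dᴴ = σ.D := by
  rw [D, Matrix.diagonal_conjTranspose]; congr 1; ext t; simp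

/-- The Schmidt decomposition of the adjoint. -/
def symm : Schmidt Kᴴ T where
  U := σ.V
  V := σ.U
  d := σ.d
  U_isometry := σ.V_isometry
  V_isometry := σ.U_isometry
  d_nonneg := σ.d_nonneg
  eq := by
    have h := σ.eq
    have h2 := σ.D_conjTranspose
    unfold D at h2
    conv_lhs => rw [h]
    simp [Matrix.conjTranspose_mul, Matrix.mul_assoc, h2]

/-- The absolute value `(K Kᴴ)^{1/2}`. -/
def abs : Matrix a a ℂ := σ.U * σ.D * σ.Uᴴ

theorem eq' : K = σ.U * σ.D * σ.Vᴴ := σ.eq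

theorem norm_U_le [DecidableEq a] : ‖σ.U‖ ≤ 1 := norm_le_one_of_conjTranspose_mul_self σ.U_isometry

theorem norm_V_le [DecidableEq b] : ‖σ.V‖ ≤ 1 := norm_le_one_of_conjTranspose_mul_self σ.V_isometry

theorem mul_V : K * σ.V = σ.U * σ.D := by
  refine (congrArg (· * σ.V) σ.eq').trans ?_
  simp only [Matrix.mul_assoc, σ.V_isometry, Matrix.mul_one]

theorem U_mul : σ.Uᴴ * K = σ.D * σ.Vᴴ := by
  refine (congrArg (σ.Uᴴ * ·) σ.eq').trans ?_
  simp only [← Matrix.mul_assoc, σ.U_isometry, Matrix.one_mul]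

theorem abs_mul_U : σ.abs * σ.U = σ.U * σ.D := by
  rw [abs, Matrix.mul_assoc, σ.U_isometry, Matrix.mul_one]

theorem U_mul_abs : σ.Uᴴ * σ.abs = σ.D * σ.Uᴴ := by
  rw [abs, ← Matrix.mul_assoc, ← Matrix.mul_assoc, σ.U_isometry, Matrix.one_mul]

theorem one_sub_mul_abs [DecidableEq a] : (1 - σ.U * σ.Uᴴ) * σ.abs = 0 := by
  rw [Matrix.sub_mul, Matrix.mul_assoc, σ.U_mul_abs, abs, Matrix.one_mul, Matrix.mul_assoc, sub_self]

theorem one_sub_mul_K [DecidableEq a] : (1 - σ.U * σ.Uᴴ) * K = 0 := by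
  rw [Matrix.sub_mul, Matrix.mul_assoc, σ.U_mul, ← Matrix.mul_assoc, ← σ.eq', Matrix.one_mul, sub_self]

theorem sum_d_sq : ∑ t, σ.d t ^ 2 = fro K ^ 2 := by
  have h : fro K ^ 2 = (σ.D * σ.D).trace.re := by
    refine (congrArg (fun X => fro X ^ 2) σ.eq').trans ?_
    simp only [fro_sq_eq_trace]
    simp only [Matrix.conjTranspose_mul, Matrix.conjTranspose_conjTranspose, σ.D_conjTranspose]
    rw [show σ.V * (σ.D * σ.Uᴴ) * (σ.U * σ.D * σ.Vᴴ) = σ.V * (σ.D * (σ.Uᴴ * σ.U) * σ.D) * σ.Vᴴ by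
      simp only [Matrix.mul_assoc], σ.U_isometry, Matrix.trace_mul_comm, ← Matrix.mul_assoc,
      σ.V_isometry, Matrix.one_mul, Matrix.mul_one]
  rw [h, D, Matrix.diagonal_mul_diagonal, Matrix.trace_diagonal, Complex.re_sum]
  refine Finset.sum_congr rfl fun t _ => ?_
  norm_cast
  ring

end Schmidt

/-- Diagonalise `K* K`, keep the eigenvectors with nonzero eigenvalue as `V`, and put `d = √e` and
`U = K V d⁻¹`. Restricting to nonzero eigenvalues is what makes `U` an isometry. -/
theorem exists_schmidt {dA dB : ℕ} (K : Matrix (Fin dA) (Fin dB) ℂ) :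
    ∃ T : Finset (Fin dB), Nonempty (Schmidt K T) := by
  have hM : (Kᴴ * K).PosSemidef := Matrix.posSemidef_conjTranspose_mul_self K
  have h : (Kᴴ * K).IsHermitian := hM.isHermitian
  set e := h.eigenvalues with he
  set W : Matrix (Fin dB) (Fin dB) ℂ := (↑h.eigenvectorUnitary : Matrix (Fin dB) (Fin dB) ℂ) with hW
  have hWW : Wᴴ * W = 1 := Unitary.coe_star_mul_self h.eigenvectorUnitary
  have hWW' : W * Wᴴ = 1 := Unitary.coe_mul_star_self h.eigenvectorUnitary
  have hspec : Kᴴ * K = W * Matrix.diagonal (fun t => (e t : ℂ)) * Wᴴ := by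
    have := h.spectral_theorem
    rw [Unitary.conjStarAlgAut_apply] at this
    exact this
  have hdiag : (K * W)ᴴ * (K * W) = Matrix.diagonal (fun t => (e t : ℂ)) := by
    rw [Matrix.conjTranspose_mul, Matrix.mul_assoc, ← Matrix.mul_assoc Kᴴ, hspec]
    rw [← Matrix.mul_assoc, ← Matrix.mul_assoc, ← Matrix.mul_assoc, hWW, Matrix.one_mul,
      Matrix.mul_assoc, hWW, Matrix.mul_one]
  have hpos : ∀ t, 0 ≤ e t := fun t => hM.eigenvalues_nonneg t
  -- Eigenvectors of eigenvalue zero lie in the kernel of `K`, so discarding them does not change `K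
  -- V V*`.
  have hzero : ∀ i t, e t = 0 → (K * W) i t = 0 := by
    intro i t ht
    have h1 : (((K * W)ᴴ * (K * W)) t t).re = ∑ i, ‖(K * W) i t‖ ^ 2 := by
      rw [Matrix.mul_apply, Complex.re_sum]
      refine Finset.sum_congr rfl fun i _ => ?_
      rw [Matrix.conjTranspose_apply, Complex.star_def, mul_comm, Complex.mul_conj,
        Complex.normSq_eq_norm_sq]
      norm_cast
    rw [hdiag, Matrix.diagonal_apply_eq, ht] at h1
    have h2 := (Finset.sum_eq_zero_iff_of_nonneg (fun i _ => sq_nonneg ‖(K * W) i t‖)).1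
      (by simpa using h1.symm) i (Finset.mem_univ i)
    simpa using h2
  refine ⟨Finset.univ.filter (fun t => e t ≠ 0), ⟨?_⟩⟩
  set S := Finset.univ.filter (fun t => e t ≠ 0) with hS
  have hSne : ∀ t : S, e t ≠ 0 := fun t => (Finset.mem_filter.1 t.2).2
  let V : Matrix (Fin dB) S ℂ := W.submatrix id Subtype.val
  let d : S → ℝ := fun t => Real.sqrt (e t)
  have hd : ∀ t : S, d t ≠ 0 := fun t => by
    have := hSne t; have := hpos t; simp only [d]; positivity
  have hVV : Vᴴ * V = 1 := by
    have : Vᴴ * V = (Wᴴ * W).submatrix Subtype.val Subtype.val := by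
      ext s t; simp [V, Matrix.mul_apply]
    rw [this, hWW]
    exact Matrix.submatrix_one _ Subtype.val_injective
  have hKV : (K * V)ᴴ * (K * V) = Matrix.diagonal (fun t => ((d t) ^ 2 : ℂ)) := by
    have h1 : K * V = (K * W).submatrix id Subtype.val := by
      ext s t; simp [V, Matrix.mul_apply]
    have : (K * V)ᴴ * (K * V) = ((K * W)ᴴ * (K * W)).submatrix Subtype.val Subtype.val := by
      rw [h1]; ext s t; simp [Matrix.mul_apply]
    rw [this, hdiag, Matrix.submatrix_diagonal _ _ Subtype.val_injective]
    congr 1; ext t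
    simp only [Function.comp, d]
    rw [← Complex.ofReal_pow, Real.sq_sqrt (hpos t)]
  have hKVV : K * V * Vᴴ = K := by
    have : K * V * Vᴴ = (K * W) * Wᴴ := by
      ext i j
      have h1 : K * V = (K * W).submatrix id Subtype.val := by
        ext s t; simp [V, Matrix.mul_apply]
      rw [h1, Matrix.mul_apply, Matrix.mul_apply]
      simp only [V, Matrix.submatrix_apply, Matrix.conjTranspose_apply, id]
      rw [Finset.sum_coe_sort S (fun t => (K * W) i t * star (W j t))]
      refine Finset.sum_subset (Finset.subset_univ _) fun t _ ht => ?_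
      have : e t = 0 := by simpa [hS] using ht
      rw [hzero i t this, zero_mul]
    rw [this, Matrix.mul_assoc, hWW', Matrix.mul_one]
  have hinv : (Matrix.diagonal (fun t => ((d t)⁻¹ : ℂ)))ᴴ = Matrix.diagonal (fun t => ((d t)⁻¹ : ℂ)) := by
    rw [Matrix.diagonal_conjTranspose]; congr 1; ext t; simp
  exact
    { U := K * V * Matrix.diagonal (fun t => ((d t)⁻¹ : ℂ))
      V := V
      d := d
      U_isometry := by
        rw [Matrix.conjTranspose_mul, Matrix.mul_assoc, ← Matrix.mul_assoc (K * V)ᴴ, hKV, hinv,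
          Matrix.diagonal_mul_diagonal, Matrix.diagonal_mul_diagonal, ← Matrix.diagonal_one]
        congr 1; ext t
        have : (d t : ℂ) ≠ 0 := by exact_mod_cast hd t
        field_simp
      V_isometry := hVV
      d_nonneg := fun t => Real.sqrt_nonneg _
      eq := by
        rw [Matrix.mul_assoc (K * V), Matrix.diagonal_mul_diagonal]
        have : (Matrix.diagonal fun t => ((d t : ℂ)⁻¹ * (d t : ℂ))) = 1 := by
          rw [← Matrix.diagonal_one]; congr 1; ext t
          have : (d t : ℂ) ≠ 0 := by exact_mod_cast hd t
          field_simp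
        rw [this, Matrix.mul_one, hKVV] }

/-- The right side minus the left side equals `2xy|u - v|² + (y - x)²|v|²`. -/
theorem sq_sub_mul_norm_sq_le (u v : ℂ) {x y : ℝ} (hx : 0 ≤ x) (hy : 0 ≤ y) :
    (y - x) ^ 2 * ‖u‖ ^ 2 ≤ ‖u * y - x * v‖ ^ 2 + ‖u * x - y * v‖ ^ 2 := by
  simp only [← Complex.normSq_eq_norm_sq, Complex.normSq_apply, Complex.sub_re, Complex.sub_im,
    Complex.mul_re, Complex.mul_im, Complex.ofReal_re, Complex.ofReal_im]
  have h1 := mul_nonneg (mul_nonneg hx hy) (add_nonneg (sq_nonneg (u.re - v.re)) (sq_nonneg (u.im - v.im)))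
  have h2 := mul_nonneg (sq_nonneg (y - x)) (add_nonneg (sq_nonneg v.re) (sq_nonneg v.im))
  nlinarith [h1, h2]

/-- Pair the entries `(s, t)` and `(t, s)` of `E D - D G`. Since `E` and `G` are Hermitian, both
involve only `E s t` and `G s t`, with the roles of `d s` and `d t` exchanged, and the scalar
inequality eliminates `G`. This gives the factor `√2`, relaxed to `2`. -/
theorem fro_commutator_diagonal_le {d : T → ℝ} (hd : ∀ t, 0 ≤ d t) {E G : Matrix T T ℂ}
    (hE : E.IsHermitian) (hG : G.IsHermitian) :
    fro (E * Matrix.diagonal (fun t => (d t : ℂ)) - Matrix.diagonal (fun t => (d t : ℂ)) * E) ≤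
      2 * fro (E * Matrix.diagonal (fun t => (d t : ℂ)) - Matrix.diagonal (fun t => (d t : ℂ)) * G) := by
  apply le_of_sq_le_sq _ (mul_nonneg zero_le_two (fro_nonneg _))
  have key : fro (E * Matrix.diagonal (fun t => (d t : ℂ)) - Matrix.diagonal (fun t => (d t : ℂ)) * E) ^ 2
      ≤ 2 * fro (E * Matrix.diagonal (fun t => (d t : ℂ)) -
        Matrix.diagonal (fun t => (d t : ℂ)) * G) ^ 2 := by
    rw [two_mul, fro_sq, fro_sq]
    nth_rw 3 [Finset.sum_comm]
    rw [← Finset.sum_add_distrib]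
    refine Finset.sum_le_sum fun s _ => ?_
    rw [← Finset.sum_add_distrib]
    refine Finset.sum_le_sum fun t _ => ?_
    simp only [Matrix.sub_apply, Matrix.mul_diagonal, Matrix.diagonal_mul]
    have h1 : ‖E s t * d t - d s * E s t‖ ^ 2 = (d t - d s) ^ 2 * ‖E s t‖ ^ 2 := by
      rw [show E s t * d t - d s * E s t = ((d t - d s : ℝ) : ℂ) * E s t by push_cast; ring,
        norm_mul, mul_pow, Complex.norm_real, Real.norm_eq_abs, sq_abs]
    have h2 : ‖E t s * d s - d t * G t s‖ = ‖E s t * d s - d t * G s t‖ := by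
      rw [← hE.apply t s, ← hG.apply t s, ← norm_star]
      simp
    rw [h1, h2]
    exact sq_sub_mul_norm_sq_le _ _ (hd s) (hd t)
  nlinarith [sq_nonneg (fro (E * Matrix.diagonal (fun t => (d t : ℂ)) -
        Matrix.diagonal (fun t => (d t : ℂ)) * G))]

namespace Schmidt

variable {K : Matrix a b ℂ} (σ : Schmidt K T)

/-- If `E K ≈ K G` for Hermitian `E` and `G`, then `E` almost commutes with `|K*|`. -/
theorem fro_commutator_abs_le [DecidableEq a] [DecidableEq b] {E : Matrix a a ℂ} {G : Matrix b b ℂ}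
    (hE : E.IsHermitian) (hG : G.IsHermitian) :
    fro (E * σ.abs - σ.abs * E) ≤ 4 * fro (E * K - K * G) := by
  set δ := fro (E * K - K * G)
  have hp := isStarProjection_one_sub_mul_conjTranspose σ.U_isometry
  have hU := σ.norm_U_le
  have hUs := norm_conjTranspose_le_one hU
  have hV := σ.norm_V_le
  have h1 : fro ((1 - σ.U * σ.Uᴴ) * E * σ.U * σ.D) ≤ δ := by
    have : (1 - σ.U * σ.Uᴴ) * E * σ.U * σ.D = (1 - σ.U * σ.Uᴴ) * (E * K - K * G) * σ.V := by
      rw [Matrix.mul_sub, ← Matrix.mul_assoc _ K, σ.one_sub_mul_K, Matrix.zero_mul, sub_zero,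
        Matrix.mul_assoc _ σ.U, ← σ.mul_V]
      simp only [Matrix.mul_assoc]
    rw [this]
    exact (fro_mul_le_of_norm_le_one' _ hV).trans
      (fro_mul_le_of_norm_le_one hp.matrix_norm_le_one _)
  have h2 : fro (σ.Uᴴ * E * σ.U * σ.D - σ.D * (σ.Vᴴ * G * σ.V)) ≤ δ := by
    have : σ.Uᴴ * E * σ.U * σ.D - σ.D * (σ.Vᴴ * G * σ.V) = σ.Uᴴ * (E * K - K * G) * σ.V := by
      rw [Matrix.mul_sub, ← Matrix.mul_assoc _ K, σ.U_mul, Matrix.sub_mul,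
        Matrix.mul_assoc _ σ.U, ← σ.mul_V]
      simp only [Matrix.mul_assoc]
    rw [this]
    exact (fro_mul_le_of_norm_le_one' _ hV).trans (fro_mul_le_of_norm_le_one hUs _)
  have h3 : fro (σ.Uᴴ * E * σ.U * σ.D - σ.D * (σ.Uᴴ * E * σ.U)) ≤ 2 * δ :=
    (fro_commutator_diagonal_le σ.d_nonneg (Matrix.isHermitian_conjTranspose_mul_mul _ hE)
      (Matrix.isHermitian_conjTranspose_mul_mul _ hG)).trans (by gcongr; exact h2)
  -- Split along the range of `U`: a corner leaving the range, the commutator inside it, and the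
  -- adjoint corner. They contribute `1 + 2 + 1` times `δ`.
  have e : E * σ.abs - σ.abs * E = (1 - σ.U * σ.Uᴴ) * E * σ.U * σ.D * σ.Uᴴ
      + σ.U * (σ.Uᴴ * E * σ.U * σ.D - σ.D * (σ.Uᴴ * E * σ.U)) * σ.Uᴴ
      - ((1 - σ.U * σ.Uᴴ) * E * σ.U * σ.D * σ.Uᴴ)ᴴ := by
    have hp' : (1 - σ.U * σ.Uᴴ)ᴴ = 1 - σ.U * σ.Uᴴ := hp.isSelfAdjoint
    simp only [Matrix.conjTranspose_mul, Matrix.conjTranspose_conjTranspose, hp', hE.eq,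
      σ.D_conjTranspose, abs]
    simp only [Matrix.mul_sub, Matrix.sub_mul, Matrix.one_mul, Matrix.mul_one, Matrix.mul_assoc]
    abel
  have h4 : fro ((1 - σ.U * σ.Uᴴ) * E * σ.U * σ.D * σ.Uᴴ) ≤ δ :=
    (fro_mul_le_of_norm_le_one' _ hUs).trans h1
  have h5 : fro (σ.U * (σ.Uᴴ * E * σ.U * σ.D - σ.D * (σ.Uᴴ * E * σ.U)) * σ.Uᴴ) ≤ 2 * δ :=
    ((fro_mul_le_of_norm_le_one' _ hUs).trans (fro_mul_le_of_norm_le_one hU _)).trans h3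
  rw [e]
  refine (fro_sub_le _ _).trans ?_
  rw [fro_conjTranspose]
  linarith [fro_add_le ((1 - σ.U * σ.Uᴴ) * E * σ.U * σ.D * σ.Uᴴ)
    (σ.U * (σ.Uᴴ * E * σ.U * σ.D - σ.D * (σ.Uᴴ * E * σ.U)) * σ.Uᴴ)]

theorem fro_commutator_abs_symm_le [DecidableEq a] [DecidableEq b] {E : Matrix a a ℂ}
    {G : Matrix b b ℂ} (hE : E.IsHermitian) (hG : G.IsHermitian) :
    fro (G * σ.symm.abs - σ.symm.abs * G) ≤ 4 * fro (E * K - K * G) := by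
  refine (σ.symm.fro_commutator_abs_le hG hE).trans_eq ?_
  rw [← fro_conjTranspose (E * K - K * G), fro_sub_comm]
  simp [Matrix.conjTranspose_mul, hE.eq, hG.eq]

end Schmidt

end Schmidt

/-! ### Layer-cake decomposition on a finite set -/

section LayerCake

variable {T : Type*} [Fintype T] [DecidableEq T]

/-- A nonnegative function on a finite type is a nonnegative combination of indicators of a chain of
sets; consequently `min (f s) (f t)` is the total weight of the sets containing both points. -/
theorem exists_layer_cake (f : T → ℝ) (hf : ∀ t, 0 ≤ f t) :
    ∃ w : Finset T → ℝ, (∀ S, 0 ≤ w S) ∧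
      ∀ s t, ∑ S, (if s ∈ S ∧ t ∈ S then w S else 0) = min (f s) (f t) := by
  induction h : (Finset.univ.filter fun t => f t ≠ 0).card using Nat.strong_induction_on generalizing f with
  | _ n ih =>
    set S₀ := Finset.univ.filter fun t => f t ≠ 0 with hS₀
    rcases S₀.eq_empty_or_nonempty with he | hne
    · have hf0 : ∀ t, f t = 0 := fun t => by
        by_contra hc
        have : t ∈ S₀ := by simp [hS₀, hc]
        simp [he] at this
      exact ⟨0, fun _ => le_rfl, fun s t => by simp [hf0]⟩
    · obtain ⟨t₀, ht₀, hmin⟩ := S₀.exists_min_image f hne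
      have hmem : ∀ t, t ∈ S₀ ↔ f t ≠ 0 := fun t => by simp [hS₀]
      have hm : 0 < f t₀ := lt_of_le_of_ne (hf t₀) (Ne.symm ((hmem t₀).1 ht₀))
      -- Peel off the lowest layer: `f` is its least nonzero value on its support plus `g`, and the
      -- support of `g` no longer contains `t₀`.
      let g : T → ℝ := fun t => if t ∈ S₀ then f t - f t₀ else 0
      have hg : ∀ t, 0 ≤ g t := fun t => by
        simp only [g]; split_ifs with h1
        · exact sub_nonneg.2 (hmin t h1)
        · exact le_rfl
      have hcard : (Finset.univ.filter fun t => g t ≠ 0).card < n := by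
        rw [← h]
        refine Finset.card_lt_card ⟨fun t ht => ?_, fun hss => ?_⟩
        · by_contra hc
          simp [g, hc] at ht
        · have := hss ht₀
          simp [g] at this
      obtain ⟨w, hw, hwg⟩ := ih _ hcard g hg rfl
      refine ⟨fun S => w S + if S = S₀ then f t₀ else 0, fun S => ?_, fun s t => ?_⟩
      · have := hw S; dsimp only; split_ifs <;> linarith
      · have : ∀ S : Finset T, (if s ∈ S ∧ t ∈ S then (w S + if S = S₀ then f t₀ else 0) else 0)
            = (if s ∈ S ∧ t ∈ S then w S else 0) +
              if S = S₀ then (if s ∈ S₀ ∧ t ∈ S₀ then f t₀ else 0) else 0 := fun S => by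
          by_cases h1 : S = S₀
          · rw [h1]; by_cases h2 : s ∈ S₀ ∧ t ∈ S₀ <;> simp [h2]
          · simp [h1]
        rw [Finset.sum_congr rfl fun S _ => this S, Finset.sum_add_distrib, hwg,
          Finset.sum_ite_eq' Finset.univ S₀, if_pos (Finset.mem_univ _)]
        by_cases hs : s ∈ S₀
        · by_cases ht : t ∈ S₀
          · simp only [g, hs, ht, if_true, and_self]
            rw [min_sub_sub_right, sub_add_cancel]
          · have : f t = 0 := by simpa [hmem] using ht
            simp [g, hs, ht, this, hf s, sub_nonneg.2 (hmin s hs)]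
        · have : f s = 0 := by simpa [hmem] using hs
          simp [g, hs, this, hf t, hg t]

/-- Exchanges the sum over layers with the sum over entries: averaging the `S × S` blocks of a
matrix amounts to weighting its entries by the kernel `min (f s) (f t)`. -/
theorem layer_cake_sum_mul {f : T → ℝ} {w : Finset T → ℝ}
    (hw : ∀ s t, ∑ S, (if s ∈ S ∧ t ∈ S then w S else 0) = min (f s) (f t)) (c : T → T → ℝ) :
    ∑ S, w S * ∑ s ∈ S, ∑ t ∈ S, c s t = ∑ s, ∑ t, min (f s) (f t) * c s t := by
  have h1 : ∀ S : Finset T, w S * ∑ s ∈ S, ∑ t ∈ S, c s t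
      = ∑ s, ∑ t, (if s ∈ S ∧ t ∈ S then w S else 0) * c s t := fun S => by
    rw [← Finset.sum_subset (Finset.subset_univ S), Finset.mul_sum]
    · refine Finset.sum_congr rfl fun s hs => ?_
      rw [← Finset.sum_subset (Finset.subset_univ S), Finset.mul_sum]
      · refine Finset.sum_congr rfl fun t ht => ?_
        rw [if_pos ⟨hs, ht⟩]
      · intro t _ ht; simp [ht]
    · intro s _ hs; simp [hs]
  rw [Finset.sum_congr rfl fun S _ => h1 S, Finset.sum_comm]
  refine Finset.sum_congr rfl fun s _ => ?_
  rw [Finset.sum_comm]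
  refine Finset.sum_congr rfl fun t _ => ?_
  rw [← Finset.sum_mul, hw]

theorem layer_cake_sum_mul_single {f : T → ℝ} {w : Finset T → ℝ}
    (hw : ∀ s t, ∑ S, (if s ∈ S ∧ t ∈ S then w S else 0) = min (f s) (f t)) (c : T → ℝ) :
    ∑ S, w S * ∑ s ∈ S, c s = ∑ s, f s * c s := by
  have := layer_cake_sum_mul hw (fun s t => if s = t then c s else 0)
  simpa using this

end LayerCake

/-! ### Selecting a good spectral cut -/

section Selection

variable {a b T : Type*} [Fintype a] [Fintype b] [Fintype T] [DecidableEq T]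

namespace Schmidt

variable {K : Matrix a b ℂ} (σ : Schmidt K T)

/-- The isometry onto the span of the left Schmidt vectors indexed by `S`. -/
def cut (S : Finset T) : Matrix a S ℂ := σ.U.submatrix id Subtype.val

theorem cut_isometry (S : Finset T) : (σ.cut S)ᴴ * σ.cut S = 1 := by
  have : (σ.cut S)ᴴ * σ.cut S = (σ.Uᴴ * σ.U).submatrix Subtype.val Subtype.val := by
    ext s t; simp [cut, Matrix.mul_apply]
  rw [this, σ.U_isometry]
  exact Matrix.submatrix_one _ Subtype.val_injective

theorem conj_cut_apply (S : Finset T) (E : Matrix a a ℂ) (s t : S) :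
    ((σ.cut S)ᴴ * (E * σ.cut S)) s t = (σ.Uᴴ * (E * σ.U)) s t := by
  simp [cut, Matrix.mul_apply]

theorem mul_cut_apply (S : Finset T) (E : Matrix a a ℂ) (i : a) (t : S) :
    (E * σ.cut S) i t = (E * σ.U) i t := by
  simp [cut, Matrix.mul_apply]

theorem fro_mul_cut_sq (S : Finset T) (E : Matrix a a ℂ) :
    fro (E * σ.cut S) ^ 2 = ∑ t ∈ S, ∑ i, ‖(E * σ.U) i t‖ ^ 2 := by
  rw [fro_sq, Finset.sum_comm, ← Finset.sum_coe_sort S]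
  simp only [mul_cut_apply]

theorem fro_conj_cut_sq (S : Finset T) (E : Matrix a a ℂ) :
    fro ((σ.cut S)ᴴ * (E * σ.cut S)) ^ 2 = ∑ s ∈ S, ∑ t ∈ S, ‖(σ.Uᴴ * (E * σ.U)) s t‖ ^ 2 := by
  rw [fro_sq, ← Finset.sum_coe_sort S]
  refine Finset.sum_congr rfl fun s _ => ?_
  rw [← Finset.sum_coe_sort S]
  simp only [conj_cut_apply]

theorem fro_D_sq : fro σ.D ^ 2 = fro K ^ 2 := by
  rw [← σ.sum_d_sq, fro_sq]
  refine Finset.sum_congr rfl fun s _ => ?_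
  rw [Finset.sum_eq_single s]
  · simp [D, sq_abs]
  · intro t _ h; simp [D, h.symm]
  · simp

theorem fro_D (hK : fro K = 1) : fro σ.D = 1 := by
  have := σ.fro_D_sq
  rw [hK] at this
  nlinarith [fro_nonneg σ.D]

theorem fro_mul_D_sq {m : Type*} [Fintype m] (X : Matrix m T ℂ) :
    fro (X * σ.D) ^ 2 = ∑ t, σ.d t ^ 2 * ∑ i, ‖X i t‖ ^ 2 := by
  rw [fro_sq, Finset.sum_comm]
  refine Finset.sum_congr rfl fun t _ => ?_
  rw [Finset.mul_sum]
  refine Finset.sum_congr rfl fun i _ => ?_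
  simp [D, Matrix.mul_diagonal, mul_pow, mul_comm]

/-- The left side is the compression of the commutator to the range of `U`; compressions do not
increase the Frobenius norm. -/
theorem fro_compress_commutator_le [DecidableEq a] (E : Matrix a a ℂ) :
    fro (σ.Uᴴ * (E * σ.U) * σ.D - σ.D * (σ.Uᴴ * (E * σ.U))) ≤ fro (E * σ.abs - σ.abs * E) := by
  have : σ.Uᴴ * (E * σ.U) * σ.D - σ.D * (σ.Uᴴ * (E * σ.U))
      = σ.Uᴴ * (E * σ.abs - σ.abs * E) * σ.U := by
    rw [Matrix.mul_sub, Matrix.sub_mul, ← Matrix.mul_assoc σ.Uᴴ σ.abs, σ.U_mul_abs,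
      Matrix.mul_assoc σ.Uᴴ (E * σ.abs), Matrix.mul_assoc E σ.abs, σ.abs_mul_U]
    simp only [Matrix.mul_assoc]
  rw [this]
  exact (fro_mul_le_of_norm_le_one' _ σ.norm_U_le).trans
    (fro_mul_le_of_norm_le_one (norm_conjTranspose_le_one σ.norm_U_le) _)

theorem fro_one_sub_mul_D_le [DecidableEq a] (E : Matrix a a ℂ) :
    fro ((1 - σ.U * σ.Uᴴ) * (E * σ.U * σ.D)) ≤ fro (E * σ.abs - σ.abs * E) := by
  have : (1 - σ.U * σ.Uᴴ) * (E * σ.U * σ.D)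
      = (1 - σ.U * σ.Uᴴ) * (E * σ.abs - σ.abs * E) * σ.U := by
    rw [Matrix.mul_sub, ← Matrix.mul_assoc _ σ.abs, σ.one_sub_mul_abs, Matrix.zero_mul, sub_zero,
      Matrix.mul_assoc _ σ.U, ← σ.abs_mul_U]
    simp only [Matrix.mul_assoc]
  rw [this]
  exact (fro_mul_le_of_norm_le_one' _ σ.norm_U_le).trans (fro_mul_le_of_norm_le_one
    (isStarProjection_one_sub_mul_conjTranspose σ.U_isometry).matrix_norm_le_one _)

theorem compress_norm_le [DecidableEq a] {E : Matrix a a ℂ} (hE : ‖E‖ ≤ 1) :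
    ‖σ.Uᴴ * (E * σ.U)‖ ≤ 1 :=
  norm_mul_le_one (norm_conjTranspose_le_one σ.norm_U_le) (norm_mul_le_one hE σ.norm_U_le)

/-- On average over the layers, the cut subspace is almost invariant under operators that almost
commute with `|K*|`. -/
theorem sum_weight_fro_sq_le [DecidableEq a] {w : Finset T → ℝ}
    (hw : ∀ s t, ∑ S, (if s ∈ S ∧ t ∈ S then w S else 0) = min (σ.d s ^ 2) (σ.d t ^ 2))
    (hK : fro K = 1) {E : Matrix a a ℂ} (hE : ‖E‖ ≤ 1) :
    ∑ S, w S * fro ((1 - σ.cut S * (σ.cut S)ᴴ) * (E * σ.cut S)) ^ 2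
      ≤ 3 * fro (E * σ.abs - σ.abs * E) := by
  set δ := fro (E * σ.abs - σ.abs * E)
  set E₀ := σ.Uᴴ * (E * σ.U) with hE₀
  -- By Pythagoras each defect is the norm of `E` on the cut minus the norm of its compression;
  -- averaging replaces these by the weights `d t²` and `min (d s²) (d t²)`.
  have h1 : ∑ S, w S * fro ((1 - σ.cut S * (σ.cut S)ᴴ) * (E * σ.cut S)) ^ 2
      = fro (E * σ.U * σ.D) ^ 2 - ∑ s, ∑ t, min (σ.d s ^ 2) (σ.d t ^ 2) * ‖E₀ s t‖ ^ 2 := by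
    rw [← layer_cake_sum_mul hw, σ.fro_mul_D_sq, ← layer_cake_sum_mul_single hw,
      ← Finset.sum_sub_distrib]
    refine Finset.sum_congr rfl fun S _ => ?_
    rw [← mul_sub, fro_one_sub_mul_sq (σ.cut_isometry S), fro_mul_cut_sq, fro_conj_cut_sq]
  have h2 : fro (E * σ.U * σ.D) ^ 2 = fro ((1 - σ.U * σ.Uᴴ) * (E * σ.U * σ.D)) ^ 2
      + fro (E₀ * σ.D) ^ 2 := by
    rw [fro_one_sub_mul_sq σ.U_isometry, hE₀]
    simp only [Matrix.mul_assoc]; ring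
  have h3 : fro ((1 - σ.U * σ.Uᴴ) * (E * σ.U * σ.D)) ≤ 1 := by
    rw [← σ.fro_D hK]
    exact (fro_mul_le_of_norm_le_one
      (isStarProjection_one_sub_mul_conjTranspose σ.U_isometry).matrix_norm_le_one _).trans
      (fro_mul_le_of_norm_le_one (norm_mul_le_one hE σ.norm_U_le) _)
  -- A quantity that is at most `1` and at most `δ` has square at most `δ`. The final constant `3`
  -- is this `1` plus the `2` from Cauchy–Schwarz below.
  have h4 : fro ((1 - σ.U * σ.Uᴴ) * (E * σ.U * σ.D)) ^ 2 ≤ δ := by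
    have := σ.fro_one_sub_mul_D_le E
    have h0 := fro_nonneg ((1 - σ.U * σ.Uᴴ) * (E * σ.U * σ.D))
    nlinarith
  have h5 : fro (E₀ * σ.D) ^ 2 - ∑ s, ∑ t, min (σ.d s ^ 2) (σ.d t ^ 2) * ‖E₀ s t‖ ^ 2
      ≤ ∑ s, ∑ t, ‖(E₀ * σ.D - σ.D * E₀) s t‖ * ‖(E₀ * σ.D + σ.D * E₀) s t‖ := by
    rw [fro_sq, ← Finset.sum_sub_distrib]
    refine Finset.sum_le_sum fun s _ => ?_
    rw [← Finset.sum_sub_distrib]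
    refine Finset.sum_le_sum fun t _ => ?_
    have hs := σ.d_nonneg s
    have ht := σ.d_nonneg t
    have e1 : (E₀ * σ.D - σ.D * E₀) s t = ((σ.d t - σ.d s : ℝ) : ℂ) * E₀ s t := by
      simp [D]; ring
    have e2 : (E₀ * σ.D + σ.D * E₀) s t = ((σ.d t + σ.d s : ℝ) : ℂ) * E₀ s t := by
      simp [D]; ring
    have e3 : (E₀ * σ.D) s t = (σ.d t : ℂ) * E₀ s t := by simp [D]; ring
    rw [e1, e2, e3, norm_mul, norm_mul, norm_mul, Complex.norm_real, Complex.norm_real,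
      Complex.norm_real, Real.norm_eq_abs, Real.norm_eq_abs, Real.norm_eq_abs, mul_pow, sq_abs,
      abs_of_nonneg (add_nonneg ht hs)]
    -- The difference is zero or `d t² - d s² = (d t - d s)(d t + d s)`. The first factor recovers
    -- an entry of the commutator, the second an entry of the anticommutator.
    have key : σ.d t ^ 2 - min (σ.d s ^ 2) (σ.d t ^ 2) ≤ |σ.d t - σ.d s| * (σ.d t + σ.d s) := by
      rcases le_total (σ.d t ^ 2) (σ.d s ^ 2) with h | h
      · rw [min_eq_right h]; simp only [sub_self]; positivity
      · rw [min_eq_left h]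
        nlinarith [le_abs_self (σ.d t - σ.d s)]
    nlinarith [mul_le_mul_of_nonneg_right key (sq_nonneg ‖E₀ s t‖)]
  have h6 : ∑ s, ∑ t, ‖(E₀ * σ.D - σ.D * E₀) s t‖ * ‖(E₀ * σ.D + σ.D * E₀) s t‖ ≤ δ * 2 := by
    refine (sum_norm_mul_norm_le _ _).trans ?_
    have hn := σ.compress_norm_le hE
    have : fro (E₀ * σ.D + σ.D * E₀) ≤ 2 := by
      refine (fro_add_le _ _).trans ?_
      have i1 := fro_mul_le_of_norm_le_one hn σ.D
      have i2 := fro_mul_le_of_norm_le_one' σ.D hn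
      rw [σ.fro_D hK] at i1 i2
      linarith
    exact mul_le_mul (σ.fro_compress_commutator_le E) this (fro_nonneg _) (fro_nonneg _)
  rw [h1, h2]
  linarith

/-- Averaging over the cuts weights `E₀ s t * F₀ t s` by `min (d s²) (d t²)`, whereas the true
expectation weights it by `d s * d t`. The weights differ by at most `|d t - d s| * d t`, so
Cauchy–Schwarz bounds the error by the norm of `[E₀, D]` times that of `D F₀`, which is at most `1`.
-/
theorem sum_weight_trace_sub_le [DecidableEq a] [DecidableEq b] {w : Finset T → ℝ}
    (hw : ∀ s t, ∑ S, (if s ∈ S ∧ t ∈ S then w S else 0) = min (σ.d s ^ 2) (σ.d t ^ 2))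
    (hK : fro K = 1) (E : Matrix a a ℂ) {F : Matrix b b ℂ} (hF : ‖F‖ ≤ 1) :
    |∑ S, w S * (((σ.cut S)ᴴ * (E * σ.cut S)) *
        ((σ.symm.cut S)ᴴ * (F * σ.symm.cut S))).trace.re - (Kᴴ * E * K * F).trace.re|
      ≤ fro (E * σ.abs - σ.abs * E) := by
  set δ := fro (E * σ.abs - σ.abs * E)
  set E₀ := σ.Uᴴ * (E * σ.U) with hE₀
  set F₀ := σ.symm.Uᴴ * (F * σ.symm.U) with hF₀
  have h1 : ∑ S, w S * (((σ.cut S)ᴴ * (E * σ.cut S)) *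
        ((σ.symm.cut S)ᴴ * (F * σ.symm.cut S))).trace.re
      = ∑ s, ∑ t, min (σ.d s ^ 2) (σ.d t ^ 2) * (E₀ s t * F₀ t s).re := by
    rw [← layer_cake_sum_mul hw]
    refine Finset.sum_congr rfl fun S _ => ?_
    rw [trace_mul_re, ← Finset.sum_coe_sort S]
    congr 1
    refine Finset.sum_congr rfl fun s _ => ?_
    rw [← Finset.sum_coe_sort S]
    simp only [conj_cut_apply, hE₀, hF₀]
  have h2 : (Kᴴ * E * K * F).trace.re = ∑ s, ∑ t, σ.d s * σ.d t * (E₀ s t * F₀ t s).re := by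
    have e1 : Kᴴ * E * K * F
        = (σ.U * σ.D * σ.Vᴴ)ᴴ * E * (σ.U * σ.D * σ.Vᴴ) * F :=
      congrArg (fun X => Xᴴ * E * X * F) σ.eq'
    have e2 : (Kᴴ * E * K * F).trace = (σ.D * E₀ * σ.D * F₀).trace := by
      rw [e1]
      simp only [Matrix.conjTranspose_mul, Matrix.conjTranspose_conjTranspose, σ.D_conjTranspose]
      rw [show σ.V * (σ.D * σ.Uᴴ) * E * (σ.U * σ.D * σ.Vᴴ) * F
        = σ.V * (σ.D * (σ.Uᴴ * (E * σ.U)) * σ.D * σ.Vᴴ * F) by simp only [Matrix.mul_assoc],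
        Matrix.trace_mul_comm, Matrix.mul_assoc, Matrix.mul_assoc]
      rfl
    rw [e2, trace_mul_re]
    refine Finset.sum_congr rfl fun s _ => Finset.sum_congr rfl fun t _ => ?_
    have : (σ.D * E₀ * σ.D) s t * F₀ t s = ((σ.d s * σ.d t : ℝ) : ℂ) * (E₀ s t * F₀ t s) := by
      simp [D]; ring
    rw [this, Complex.re_ofReal_mul]
  have hF₀n : ‖F₀‖ ≤ 1 := σ.symm.compress_norm_le hF
  have h3 : fro (σ.D * F₀) ≤ 1 := by
    rw [← σ.fro_D hK]; exact fro_mul_le_of_norm_le_one' _ hF₀n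
  rw [h1, h2, ← Finset.sum_sub_distrib]
  calc _ ≤ ∑ s, ∑ t, ‖(E₀ * σ.D - σ.D * E₀) s t‖ * ‖(F₀ᵀ * σ.D) s t‖ := by
        refine (Finset.abs_sum_le_sum_abs _ _).trans (Finset.sum_le_sum fun s _ => ?_)
        rw [← Finset.sum_sub_distrib]
        refine (Finset.abs_sum_le_sum_abs _ _).trans (Finset.sum_le_sum fun t _ => ?_)
        have hs := σ.d_nonneg s
        have ht := σ.d_nonneg t
        have e1 : (E₀ * σ.D - σ.D * E₀) s t = ((σ.d t - σ.d s : ℝ) : ℂ) * E₀ s t := by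
          simp [D]; ring
        have e2 : (F₀ᵀ * σ.D) s t = (σ.d t : ℂ) * F₀ t s := by simp [D]; ring
        rw [e1, e2, norm_mul, norm_mul, Complex.norm_real, Complex.norm_real, Real.norm_eq_abs,
          Real.norm_eq_abs, abs_of_nonneg ht, ← sub_mul, abs_mul]
        have k1 : |min (σ.d s ^ 2) (σ.d t ^ 2) - σ.d s * σ.d t| ≤ |σ.d t - σ.d s| * σ.d t := by
          rcases le_total (σ.d s) (σ.d t) with h | h
          · rw [min_eq_left (by gcongr), abs_of_nonneg (sub_nonneg.2 h), abs_le]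
            constructor <;> nlinarith [mul_nonneg hs ht]
          · rw [min_eq_right (by gcongr), abs_of_nonpos (sub_nonpos.2 h), abs_le]
            constructor <;> nlinarith [mul_nonneg hs ht]
        have k2 : |(E₀ s t * F₀ t s).re| ≤ ‖E₀ s t‖ * ‖F₀ t s‖ :=
          (Complex.abs_re_le_norm _).trans_eq (norm_mul _ _)
        calc _ ≤ |σ.d t - σ.d s| * σ.d t * (‖E₀ s t‖ * ‖F₀ t s‖) :=
              mul_le_mul k1 k2 (abs_nonneg _) (by positivity)
          _ = _ := by ring
    _ ≤ _ := by
        refine (sum_norm_mul_norm_le _ _).trans ?_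
        have : F₀ᵀ * σ.D = (σ.D * F₀)ᵀ := by
          rw [Matrix.transpose_mul σ.D F₀, D, Matrix.diagonal_transpose]
        rw [this, fro_transpose]
        have := σ.fro_compress_commutator_le E
        nlinarith [fro_nonneg (E₀ * σ.D - σ.D * E₀), fro_nonneg (σ.D * F₀)]

/-- Selection of a good spectral cut: some maximally entangled piece of the state is almost
invariant under all operators, and almost as good for a given bilinear functional. -/
theorem exists_good_cut [DecidableEq a] [DecidableEq b] {κ μ : Type*} [Fintype κ] [Fintype μ]
    (hK : fro K = 1) (E : κ → Matrix a a ℂ) (F : μ → Matrix b b ℂ)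
    (hE : ∀ k, ‖E k‖ ≤ 1) (hF : ∀ l, ‖F l‖ ≤ 1) {δ ε β : ℝ}
    (hcE : ∀ k, fro (E k * σ.abs - σ.abs * E k) ≤ δ)
    (hcF : ∀ l, fro (F l * σ.symm.abs - σ.symm.abs * F l) ≤ δ)
    (g : κ → μ → ℝ)
    (hg : ∀ S : Finset T, ∑ k, ∑ l, g k l * (((σ.cut S)ᴴ * (E k * σ.cut S)) *
      ((σ.symm.cut S)ᴴ * (F l * σ.symm.cut S))).trace.re ≤ β * S.card)
    (hε : β - ε ≤ ∑ k, ∑ l, g k l * (Kᴴ * E k * K * F l).trace.re) :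
    ∃ S : Finset T, S.Nonempty ∧
      (∀ k, fro ((1 - σ.cut S * (σ.cut S)ᴴ) * (E k * σ.cut S)) ^ 2 ≤
        ((3 * (Fintype.card κ + Fintype.card μ) + ∑ k, ∑ l, |g k l|) * δ + ε) * S.card) ∧
      (∀ l, fro ((1 - σ.symm.cut S * (σ.symm.cut S)ᴴ) * (F l * σ.symm.cut S)) ^ 2 ≤
        ((3 * (Fintype.card κ + Fintype.card μ) + ∑ k, ∑ l, |g k l|) * δ + ε) * S.card) ∧
      β * S.card - ∑ k, ∑ l, g k l * (((σ.cut S)ᴴ * (E k * σ.cut S)) *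
        ((σ.symm.cut S)ᴴ * (F l * σ.symm.cut S))).trace.re ≤
        ((3 * (Fintype.card κ + Fintype.card μ) + ∑ k, ∑ l, |g k l|) * δ + ε) * S.card := by
  obtain ⟨w, hw0, hw⟩ := exists_layer_cake (fun t => σ.d t ^ 2) (fun t => sq_nonneg _)
  set M := (3 * (Fintype.card κ + Fintype.card μ) + ∑ k, ∑ l, |g k l|) * δ + ε with hM
  let ΦE : κ → Finset T → ℝ := fun k S => fro ((1 - σ.cut S * (σ.cut S)ᴴ) * (E k * σ.cut S)) ^ 2
  let ΦF : μ → Finset T → ℝ := fun l S =>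
    fro ((1 - σ.symm.cut S * (σ.symm.cut S)ᴴ) * (F l * σ.symm.cut S)) ^ 2
  let τ : κ → μ → Finset T → ℝ := fun k l S => (((σ.cut S)ᴴ * (E k * σ.cut S)) *
        ((σ.symm.cut S)ᴴ * (F l * σ.symm.cut S))).trace.re
  -- The deficit of the bilinear functional on a cut. By `hg` it is nonnegative, as are the
  -- invariance defects, so a bound on the sum `Φ` bounds each term.
  let Ψ : Finset T → ℝ := fun S => β * S.card - ∑ k, ∑ l, g k l * τ k l S
  let Φ : Finset T → ℝ := fun S => ∑ k, ΦE k S + ∑ l, ΦF l S + Ψ S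
  have hE0 : ∀ k S, 0 ≤ ΦE k S := fun k S => sq_nonneg _
  have hF0 : ∀ l S, 0 ≤ ΦF l S := fun k S => sq_nonneg _
  have hΨ0 : ∀ S, 0 ≤ Ψ S := fun S => sub_nonneg.2 (hg S)
  -- The numbers `w S * S.card` form a probability distribution, because the squared Schmidt
  -- coefficients of a unit vector sum to `1`.
  have hcard : ∑ S : Finset T, w S * (S.card : ℝ) = 1 := by
    have := layer_cake_sum_mul_single hw (fun _ => 1)
    simp only [Finset.sum_const, nsmul_eq_mul, mul_one] at this
    rw [this, σ.sum_d_sq, hK, one_pow]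
  have htot : ∑ S, w S * Φ S ≤ ∑ S : Finset T, w S * (M * S.card) := by
    have e1 : ∑ S : Finset T, w S * (M * S.card) = M := by
      refine Eq.trans ?_ ((congrArg (M * ·) hcard).trans (mul_one M))
      simp only [Finset.mul_sum]
      exact Finset.sum_congr rfl fun S _ => by ring
    have e2 : ∑ S, w S * Φ S = ∑ k, ∑ S, w S * ΦE k S + ∑ l, ∑ S, w S * ΦF l S
        + (β - ∑ k, ∑ l, g k l * ∑ S, w S * τ k l S) := by
      simp only [Φ, Ψ, mul_add, mul_sub, Finset.sum_add_distrib, Finset.sum_sub_distrib,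
        Finset.mul_sum]
      congr 1
      · congr 1
        · exact Finset.sum_comm
        · exact Finset.sum_comm
      · congr 1
        · conv_rhs => rw [← mul_one β, ← hcard, Finset.mul_sum]
          refine Finset.sum_congr rfl fun S _ => ?_
          ring
        · rw [Finset.sum_comm]
          refine Finset.sum_congr rfl fun k _ => ?_
          rw [Finset.sum_comm]
          refine Finset.sum_congr rfl fun l _ => Finset.sum_congr rfl fun S _ => ?_
          ring
    have e3 : ∑ k, ∑ S, w S * ΦE k S ≤ Fintype.card κ * (3 * δ) := by
      refine (Finset.sum_le_card_nsmul _ _ (3 * δ) fun k _ => ?_).trans_eq (by simp)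
      exact (σ.sum_weight_fro_sq_le hw hK (hE k)).trans (by gcongr; exact hcE k)
    have e4 : ∑ l, ∑ S, w S * ΦF l S ≤ Fintype.card μ * (3 * δ) := by
      refine (Finset.sum_le_card_nsmul _ _ (3 * δ) fun l _ => ?_).trans_eq (by simp)
      exact (σ.symm.sum_weight_fro_sq_le hw (by rw [fro_conjTranspose, hK]) (hF l)).trans
        (by gcongr; exact hcF l)
    have e5 : β - ε - (∑ k, ∑ l, |g k l|) * δ ≤ ∑ k, ∑ l, g k l * ∑ S, w S * τ k l S := by
      refine (sub_le_sub_right hε _).trans ?_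
      rw [sub_le_iff_le_add, Finset.sum_mul, ← Finset.sum_add_distrib]
      refine Finset.sum_le_sum fun k _ => ?_
      rw [Finset.sum_mul, ← Finset.sum_add_distrib]
      refine Finset.sum_le_sum fun l _ => ?_
      have h := (σ.sum_weight_trace_sub_le hw hK (E k) (hF l)).trans (hcE k)
      have h' := mul_le_mul_of_nonneg_left h (abs_nonneg (g k l))
      rw [← abs_mul] at h'
      have := (abs_le.1 h').1
      simp only [τ]
      linarith
    rw [e1, e2, hM]
    linarith
  obtain ⟨S, hS, hΦ⟩ : ∃ S : Finset T, S.Nonempty ∧ Φ S ≤ M * S.card := by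
    by_contra! hc
    -- If every nonempty cut were bad, averaging would contradict `htot`. The empty set cannot
    -- interfere, since its bound `M * 0` is at most `Φ ∅`; strictness holds because some nonempty
    -- set has positive weight.
    have hlt : ∑ S : Finset T, w S * (M * S.card) < ∑ S, w S * Φ S := by
      apply Finset.sum_lt_sum
      · intro S _
        rcases S.eq_empty_or_nonempty with h | h
        · subst h
          have : 0 ≤ Φ ∅ := add_nonneg (add_nonneg (Finset.sum_nonneg fun k _ => hE0 k _)
            (Finset.sum_nonneg fun k _ => hF0 k _)) (hΨ0 _)
          simpa using mul_nonneg (hw0 ∅) this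
        · exact mul_le_mul_of_nonneg_left (hc S h).le (hw0 S)
      · by_contra! hcc
        have : ∀ S : Finset T, w S * (S.card : ℝ) = 0 := fun S => by
          rcases S.eq_empty_or_nonempty with h | h
          · simp [h]
          · rcases (hw0 S).eq_or_lt with h0 | h0
            · simp [← h0]
            · have := hcc S (Finset.mem_univ S)
              exact absurd (mul_lt_mul_of_pos_left (hc S h) h0) (not_lt.2 this)
        simp [this] at hcard
    exact absurd htot (not_le.2 hlt)
  have hsE : ∀ k, ΦE k S ≤ ∑ k, ΦE k S := fun k =>
    Finset.single_le_sum (f := fun k => ΦE k S) (fun k _ => hE0 k S) (Finset.mem_univ k)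
  have hsF : ∀ l, ΦF l S ≤ ∑ l, ΦF l S := fun l =>
    Finset.single_le_sum (f := fun l => ΦF l S) (fun l _ => hF0 l S) (Finset.mem_univ l)
  have n1 : 0 ≤ ∑ k, ΦE k S := Finset.sum_nonneg fun k _ => hE0 k S
  have n2 : 0 ≤ ∑ l, ΦF l S := Finset.sum_nonneg fun k _ => hF0 k S
  have n3 := hΨ0 S
  exact ⟨S, hS, fun k => by linarith [hsE k, show Φ S = _ from rfl],
    fun l => by linarith [hsF l, show Φ S = _ from rfl], by linarith [show Φ S = _ from rfl]⟩

end Schmidt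

end Selection

/-! ### Rounding approximate projections and measurements -/

section Rounding

variable {n : Type*} [Fintype n] [DecidableEq n]

/-- Spectral rounding of a Hermitian matrix to a projection; the projection is a right multiple
of the matrix. -/
theorem exists_projection_near {B : Matrix n n ℂ} (hB : B.IsHermitian) :
    ∃ Q X : Matrix n n ℂ, IsStarProjection Q ∧ Q = B * X ∧ fro (Q - B) ≤ 2 * fro (B * B - B) := by
  set e := hB.eigenvalues with he
  set W : Matrix n n ℂ := (↑hB.eigenvectorUnitary : Matrix n n ℂ) with hW
  have hWW : Wᴴ * W = 1 := Unitary.coe_star_mul_self hB.eigenvectorUnitary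
  have hspec : B = W * Matrix.diagonal (fun t => (e t : ℂ)) * Wᴴ := by
    have := hB.spectral_theorem
    rw [Unitary.conjStarAlgAut_apply] at this
    exact this
  have hWn : ‖W‖ ≤ 1 := norm_le_one_of_conjTranspose_mul_self hWW
  let f : (n → ℂ) → Matrix n n ℂ := fun v => W * Matrix.diagonal v * Wᴴ
  have hmul : ∀ u v : n → ℂ, f u * f v = f (fun t => u t * v t) := fun u v => by
    simp only [f]
    rw [show W * Matrix.diagonal u * Wᴴ * (W * Matrix.diagonal v * Wᴴ)
      = W * (Matrix.diagonal u * (Wᴴ * W) * Matrix.diagonal v) * Wᴴ by simp only [Matrix.mul_assoc],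
      hWW, Matrix.mul_one, Matrix.diagonal_mul_diagonal]
  have hsub : ∀ u v : n → ℂ, f u - f v = f (fun t => u t - v t) := fun u v => by
    simp only [f]
    rw [← Matrix.sub_mul, ← Matrix.mul_sub, Matrix.diagonal_sub]
  have hfro : ∀ v : n → ℂ, fro (f v) ^ 2 = ∑ t, ‖v t‖ ^ 2 := fun v => by
    have h1 : fro (f v) = fro (Matrix.diagonal v) := by
      apply le_antisymm
      · exact (fro_mul_le_of_norm_le_one' _ (norm_conjTranspose_le_one hWn)).trans
          (fro_mul_le_of_norm_le_one hWn _)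
      · have : Matrix.diagonal v = Wᴴ * f v * W := by
          simp only [f]
          rw [show Wᴴ * (W * Matrix.diagonal v * Wᴴ) * W = (Wᴴ * W) * Matrix.diagonal v * (Wᴴ * W) by
            simp only [Matrix.mul_assoc], hWW, Matrix.one_mul, Matrix.mul_one]
        rw [this]
        exact (fro_mul_le_of_norm_le_one' _ hWn).trans
          (fro_mul_le_of_norm_le_one (norm_conjTranspose_le_one hWn) _)
    rw [h1, fro_sq]
    refine Finset.sum_congr rfl fun s _ => ?_
    rw [Finset.sum_eq_single s (fun t _ h => by simp [h.symm]) (by simp)]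
    simp
  have hBf : B = f (fun t => (e t : ℂ)) := hspec
  -- Rounding at `1/2` gives the constant `2`: if `t ≥ 1/2` then `|1 - t| ≤ 2|t||1 - t|`, and if `t
  -- < 1/2` then `|t| ≤ 2|t||1 - t|`. The kept eigenvalues are invertible, so the projection is a
  -- multiple of `B`.
  let q : n → ℂ := fun t => if 1 / 2 ≤ e t then 1 else 0
  refine ⟨f q, f (fun t => if 1 / 2 ≤ e t then ((e t)⁻¹ : ℂ) else 0), ⟨?_, ?_⟩, ?_, ?_⟩
  · rw [IsIdempotentElem, hmul]
    congr 1; ext t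
    by_cases h : 1 / 2 ≤ e t <;> simp [q]
  · have hq : (Matrix.diagonal q)ᴴ = Matrix.diagonal q := by
      rw [Matrix.diagonal_conjTranspose]; congr 1; ext t
      by_cases h : 1 / 2 ≤ e t <;> simp [q]
    change (f q)ᴴ = f q
    simp only [f, Matrix.conjTranspose_mul, Matrix.conjTranspose_conjTranspose, hq, Matrix.mul_assoc]
  · rw [hBf, hmul]
    congr 1; ext t
    by_cases h : 1 / 2 ≤ e t
    · have : (e t : ℂ) ≠ 0 := by
        have : e t ≠ 0 := by linarith
        exact_mod_cast this
      simp only [q, h, if_true]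
      field_simp
    · simp only [q, h, if_false, mul_zero]
  · apply le_of_sq_le_sq _ (mul_nonneg zero_le_two (fro_nonneg _))
    rw [mul_pow, hBf, hmul, hsub, hsub, hfro, hfro, Finset.mul_sum]
    refine Finset.sum_le_sum fun t _ => ?_
    have h1 : (e t : ℂ) * e t - e t = ((e t * e t - e t : ℝ) : ℂ) := by push_cast; ring
    rw [h1, Complex.norm_real, Real.norm_eq_abs, sq_abs]
    by_cases h : 1 / 2 ≤ e t
    · have h2 : q t - e t = ((1 - e t : ℝ) : ℂ) := by simp only [q, if_pos h]; push_cast; ring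
      rw [h2, Complex.norm_real, Real.norm_eq_abs, sq_abs]
      have : 0 ≤ (1 - e t) ^ 2 * (4 * e t ^ 2 - 1) := mul_nonneg (sq_nonneg _) (by nlinarith)
      nlinarith
    · have h2 : q t - e t = ((- e t : ℝ) : ℂ) := by simp only [q, if_neg h]; push_cast; ring
      rw [h2, Complex.norm_real, Real.norm_eq_abs, sq_abs]
      rw [not_le] at h
      have : 0 ≤ (e t) ^ 2 * (4 * (1 - e t) ^ 2 - 1) := mul_nonneg (sq_nonneg _) (by nlinarith)
      nlinarith

/-- Spectral rounding of a Hermitian matrix to a self-adjoint unitary. -/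
theorem exists_observable_near {A : Matrix n n ℂ} (hA : A.IsHermitian) :
    ∃ Z : Matrix n n ℂ, Z.IsHermitian ∧ Z * Z = 1 ∧ fro (Z - A) ≤ fro (1 - A * A) := by
  have hB : ((1 / 2 : ℂ) • (1 + A)).IsHermitian := by
    rw [Matrix.IsHermitian, Matrix.conjTranspose_smul, Matrix.conjTranspose_add, hA.eq,
      Matrix.conjTranspose_one]
    simp
  obtain ⟨Q, X, hQ, -, hd⟩ := exists_projection_near hB
  refine ⟨(2 : ℂ) • Q - 1, ?_, ?_, ?_⟩
  · rw [Matrix.IsHermitian, Matrix.conjTranspose_sub, Matrix.conjTranspose_smul,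
      hQ.isHermitian.eq, Matrix.conjTranspose_one]
    simp
  · have h := hQ.isIdempotentElem.eq
    simp only [Matrix.mul_sub, Matrix.sub_mul, Matrix.smul_mul, Matrix.mul_smul, h, Matrix.one_mul,
      Matrix.mul_one]
    module
  · have e1 : (2 : ℂ) • Q - 1 - A = (2 : ℂ) • (Q - (1 / 2 : ℂ) • (1 + A)) := by module
    -- Passing between observables and projections costs `2`, rounding costs `2`, and this identity
    -- gains `1/4`; the resulting constant is `1`.
    have e2 : ((1 / 2 : ℂ) • (1 + A)) * ((1 / 2 : ℂ) • (1 + A)) - (1 / 2 : ℂ) • (1 + A)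
        = (- (1 / 4) : ℂ) • (1 - A * A) := by
      simp only [Matrix.mul_add, Matrix.add_mul, Matrix.smul_mul, Matrix.mul_smul, Matrix.one_mul,
        Matrix.mul_one]
      module
    rw [e2, fro_smul] at hd
    rw [e1, fro_smul]
    norm_num at hd ⊢
    linarith

/-- The constant in the rounding of approximate projective measurements. -/
def roundingConst : ℕ → ℝ
  | 0 => 0
  | k + 1 => roundingConst k + 2 + 14 * (k * (roundingConst k + 1))

theorem roundingConst_nonneg (k : ℕ) : 0 ≤ roundingConst k := by
  induction k with
  | zero => exact le_rfl
  | succ k ih => rw [roundingConst]; positivity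

/-- Approximate Gram–Schmidt. The next operator is compressed to the complement of the projections
already built, which moves it little because it is nearly orthogonal to them, and is then rounded.
The rounded projection is a right multiple of the compression, so it is exactly orthogonal to the
earlier ones. -/
theorem exists_orthogonal_projections_near {α : Type*} [DecidableEq α] (A : α → Matrix n n ℂ)
    (hA : ∀ a, (A a).IsHermitian) (hA1 : ∀ a, ‖A a‖ ≤ 1) {γ : ℝ}
    (hsq : ∀ a, fro (A a * A a - A a) ≤ γ) (hort : ∀ a b, a ≠ b → fro (A a * A b) ≤ γ)
    (s : Finset α) :
    ∃ Q : α → Matrix n n ℂ, (∀ a ∈ s, IsStarProjection (Q a)) ∧ IsStarProjection (∑ a ∈ s, Q a) ∧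
      (∀ a ∈ s, Q a * (1 - ∑ a ∈ s, Q a) = 0) ∧
      ∀ a ∈ s, fro (Q a - A a) ≤ roundingConst s.card * γ := by
  induction s using Finset.induction_on with
  | empty => exact ⟨fun _ => 0, by simp, by simp, by simp, by simp⟩
  | insert a s ha ih =>
    obtain ⟨Q, hQ, hq, hQq, hd⟩ := ih
    have hγ : 0 ≤ γ := (fro_nonneg _).trans (hsq a)
    set q := ∑ a ∈ s, Q a with hqdef
    set c := roundingConst s.card with hc
    have hc0 : 0 ≤ c := roundingConst_nonneg _
    set e := s.card * ((c + 1) * γ) with he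
    have hqA : fro (q * A a) ≤ e := by
      rw [hqdef, Finset.sum_mul]
      refine (fro_sum_le _ _).trans ?_
      refine (Finset.sum_le_card_nsmul _ _ ((c + 1) * γ) fun b hb => ?_).trans_eq (by simp [he])
      have : Q b * A a = (Q b - A b) * A a + A b * A a := by rw [Matrix.sub_mul]; abel
      rw [this]
      refine (fro_add_le _ _).trans ?_
      have h1 := (fro_mul_le_of_norm_le_one' (Q b - A b) (hA1 a)).trans (hd b hb)
      have h2 := hort b a (fun h => ha (h ▸ hb))
      linarith
    have hAq : fro (A a * q) ≤ e := by
      rw [← fro_conjTranspose, Matrix.conjTranspose_mul, hq.isHermitian.eq, (hA a).eq]; exact hqA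
    have hr := hq.one_sub
    set r := 1 - q with hrdef
    set B := r * A a * r with hB
    have hBh : B.IsHermitian := by
      have := Matrix.isHermitian_conjTranspose_mul_mul r (hA a)
      rwa [hr.isHermitian.eq] at this
    have hB1 : ‖B‖ ≤ 1 :=
      norm_mul_le_one (norm_mul_le_one hr.matrix_norm_le_one (hA1 a)) hr.matrix_norm_le_one
    have hBA : fro (B - A a) ≤ 2 * e := by
      have : B - A a = -(q * A a * r) - A a * q := by
        rw [hB, hrdef]; noncomm_ring
      rw [this]
      refine (fro_sub_le _ _).trans ?_
      rw [fro_neg]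
      linarith [(fro_mul_le_of_norm_le_one' (q * A a) hr.matrix_norm_le_one).trans hqA]
    have hBB : fro (B * B - B) ≤ γ + 6 * e := by
      have : B * B - B = (A a * A a - A a) + (B * (B - A a) + (B - A a) * A a) - (B - A a) := by
        noncomm_ring
      rw [this]
      have h1 := (fro_mul_le_of_norm_le_one hB1 (B - A a)).trans hBA
      have h2 := (fro_mul_le_of_norm_le_one' (B - A a) (hA1 a)).trans hBA
      linarith [fro_sub_le ((A a * A a - A a) + (B * (B - A a) + (B - A a) * A a)) (B - A a),
        fro_add_le (A a * A a - A a) (B * (B - A a) + (B - A a) * A a),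
        fro_add_le (B * (B - A a)) ((B - A a) * A a), hsq a]
    obtain ⟨P, X, hP, hPX, hPd⟩ := exists_projection_near hBh
    have hqr : q * r = 0 := hq.mul_one_sub_self
    have hqP : q * P = 0 := by
      rw [hPX, hB, ← Matrix.mul_assoc, ← Matrix.mul_assoc, ← Matrix.mul_assoc, hqr]; simp
    have hPq : P * q = 0 := by
      have := congrArg Matrix.conjTranspose hqP
      rwa [Matrix.conjTranspose_mul, hP.isHermitian.eq, hq.isHermitian.eq,
        Matrix.conjTranspose_zero] at this
    -- Rounding costs `2(γ + 6e)` and compressing `2e`, together `2γ + 14e` with `e = k(c + 1)γ`.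
    -- The recursion adds the old constant too, which keeps it valid for the earlier projections.
    have hPA : fro (P - A a) ≤ roundingConst (insert a s).card * γ := by
      have : P - A a = (P - B) + (B - A a) := by abel
      rw [this, Finset.card_insert_of_notMem ha, roundingConst]
      refine (fro_add_le _ _).trans ?_
      have : 0 ≤ c * γ := mul_nonneg hc0 hγ
      rw [← hc]
      simp only [he] at hPd hBB hBA
      nlinarith
    have hne : ∀ b ∈ s, b ≠ a := fun b hb h => ha (h ▸ hb)
    have hsum : ∑ b ∈ insert a s, Function.update Q a P b = P + q := by
      rw [Finset.sum_insert ha, Function.update_self]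
      congr 1
      exact Finset.sum_congr rfl fun b hb => Function.update_of_ne (hne b hb) _ _
    refine ⟨Function.update Q a P, ?_, ?_, ?_, ?_⟩
    · intro b hb
      rcases Finset.mem_insert.1 hb with rfl | hb
      · rwa [Function.update_self]
      · rw [Function.update_of_ne (hne b hb)]; exact hQ b hb
    · rw [hsum]; exact hP.add hq hPq
    · intro b hb
      rw [hsum]
      rcases Finset.mem_insert.1 hb with rfl | hb
      · rw [Function.update_self, Matrix.mul_sub, Matrix.mul_add, hPq, hP.isIdempotentElem.eq]; simp
      · rw [Function.update_of_ne (hne b hb)]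
        have h1 : Q b * q = Q b := by
          have := hQq b hb
          rw [hrdef, Matrix.mul_sub, Matrix.mul_one, sub_eq_zero] at this
          exact this.symm
        have h2 : Q b * P = 0 := by rw [← h1, Matrix.mul_assoc, hqP, Matrix.mul_zero]
        rw [Matrix.mul_sub, Matrix.mul_add, h1, h2]; simp
    · intro b hb
      rcases Finset.mem_insert.1 hb with rfl | hb
      · rwa [Function.update_self]
      · rw [Function.update_of_ne (hne b hb), Finset.card_insert_of_notMem ha, roundingConst]
        refine (hd b hb).trans ?_
        gcongr
        have : 0 ≤ (14 : ℝ) * (s.card * (c + 1)) := by positivity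
        linarith

/-- An approximate projective measurement is close to a projective measurement, with a
dimension-free constant. -/
theorem exists_pvm_near {α : Type*} [Fintype α] (A : α → Matrix n n ℂ)
    (hA : ∀ a, (A a).IsHermitian) (hA1 : ∀ a, ‖A a‖ ≤ 1) (hsum : ∑ a, A a = 1) {γ : ℝ}
    (hsq : ∀ a, fro (A a * A a - A a) ≤ γ) (hort : ∀ a b, a ≠ b → fro (A a * A b) ≤ γ) :
    ∃ Q : α → Matrix n n ℂ, (∀ a, IsStarProjection (Q a)) ∧ ∑ a, Q a = 1 ∧
      ∀ a, fro (Q a - A a) ≤ (Fintype.card α + 1) * roundingConst (Fintype.card α) * γ := by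
  classical
  obtain ⟨Q, hQ, hq, hQq, hd⟩ := exists_orthogonal_projections_near A hA hA1 hsq hort Finset.univ
  rcases isEmpty_or_nonempty α with h | ⟨⟨a₀⟩⟩
  · exact ⟨A, fun a => isEmptyElim a, hsum, fun a => isEmptyElim a⟩
  have hγ : 0 ≤ γ := (fro_nonneg _).trans (hsq a₀)
  set q := ∑ a, Q a with hqdef
  set c := roundingConst (Fintype.card α) with hc
  have hc0 : 0 ≤ c := roundingConst_nonneg _
  have h1q : fro (1 - q) ≤ Fintype.card α * (c * γ) := by
    rw [← hsum, hqdef, ← Finset.sum_sub_distrib]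
    refine (fro_sum_le _ _).trans ?_
    refine (Finset.sum_le_card_nsmul _ _ (c * γ) fun b hb => ?_).trans_eq (by simp)
    rw [fro_sub_comm]
    exact hd b hb
  -- The small remainder `1 - q` is added to a single projection, to which it is orthogonal, so that
  -- the family sums exactly to `1`.
  refine ⟨Function.update Q a₀ (Q a₀ + (1 - q)), fun a => ?_, ?_, fun a => ?_⟩
  · by_cases h : a = a₀
    · subst h
      rw [Function.update_self]
      exact (hQ a (Finset.mem_univ a)).add hq.one_sub (hQq a (Finset.mem_univ a))
    · rw [Function.update_of_ne h]; exact hQ a (Finset.mem_univ a)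
  · rw [Finset.sum_update_of_mem (Finset.mem_univ a₀)]
    have : Q a₀ + ∑ x ∈ Finset.univ \ {a₀}, Q x = q := by
      rw [Finset.sdiff_singleton_eq_erase, Finset.add_sum_erase _ _ (Finset.mem_univ _)]
    rw [add_right_comm, this]; abel
  · have hcγ := mul_nonneg hc0 hγ
    have hk : (0 : ℝ) ≤ Fintype.card α := Nat.cast_nonneg _
    have ha := hd a (Finset.mem_univ a)
    rw [Finset.card_univ] at ha
    by_cases h : a = a₀
    · subst h
      rw [Function.update_self, add_sub_right_comm]
      refine (fro_add_le _ _).trans ?_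
      linarith
    · rw [Function.update_of_ne h]
      nlinarith

/-- Compressing a projection by an isometry. -/
theorem fro_compress_mul_compress_le {m : Type*} [Fintype m] [DecidableEq m] {V : Matrix m n ℂ}
    (hV : Vᴴ * V = 1) {E F : Matrix m m ℂ} (hE1 : ‖E‖ ≤ 1) :
    fro ((Vᴴ * (E * V)) * (Vᴴ * (F * V)) - Vᴴ * (E * F * V)) ≤ fro ((1 - V * Vᴴ) * (F * V)) := by
  have hV1 := norm_le_one_of_conjTranspose_mul_self hV
  have : (Vᴴ * (E * V)) * (Vᴴ * (F * V)) - Vᴴ * (E * F * V)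
      = -((Vᴴ * E) * ((1 - V * Vᴴ) * (F * V))) := by
    simp only [Matrix.mul_sub, Matrix.sub_mul, Matrix.mul_assoc, Matrix.one_mul]; abel
  rw [this, fro_neg]
  exact fro_mul_le_of_norm_le_one (norm_mul_le_one (norm_conjTranspose_le_one hV1) hE1) _

/-- Separates the part of `E V` leaving the range of `V` from the rounding error inside it; this
yields the closeness statement for the new strategy. -/
theorem fro_mul_sub_mul_le {m : Type*} [Fintype m] [DecidableEq m] {V : Matrix m n ℂ}
    (hV : Vᴴ * V = 1) (E : Matrix m m ℂ) (Q : Matrix n n ℂ) :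
    fro (E * V - V * Q) ≤ fro ((1 - V * Vᴴ) * (E * V)) + fro (Q - Vᴴ * (E * V)) := by
  have hV1 := norm_le_one_of_conjTranspose_mul_self hV
  have : E * V - V * Q = (1 - V * Vᴴ) * (E * V) - V * (Q - Vᴴ * (E * V)) := by
    simp only [Matrix.mul_sub, Matrix.sub_mul, Matrix.mul_assoc, Matrix.one_mul]; abel
  rw [this]
  exact (fro_sub_le _ _).trans (by gcongr; exact fro_mul_le_of_norm_le_one hV1 _)

end Rounding

/-! ### Bipartite states as matrices; the maximally entangled state -/

section Expectation

variable {dA dB : ℕ}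

/-- The matrix of coordinates of a bipartite vector. -/
def stateMatrix (ψ : Fin dA × Fin dB → ℂ) : Matrix (Fin dA) (Fin dB) ℂ := Matrix.of fun s t => ψ (s, t)

theorem fro_stateMatrix {ψ : Fin dA × Fin dB → ℂ} (h : star ψ ⬝ᵥ ψ = 1) :
    fro (stateMatrix ψ) = 1 := by
  have h1 : fro (stateMatrix ψ) ^ 2 = 1 := by
    rw [fro_sq, ← Fintype.sum_prod_type']
    have h2 := congrArg Complex.re h
    rw [dotProduct, Complex.re_sum, Complex.one_re] at h2
    rw [← h2]
    refine Finset.sum_congr rfl fun p _ => ?_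
    rw [Pi.star_apply, Complex.star_def, mul_comm, Complex.mul_conj, Complex.normSq_eq_norm_sq]
    norm_cast
  nlinarith [fro_nonneg (stateMatrix ψ)]

/-- Bob's operator acts on the column index of the state matrix, hence by right multiplication with
the transpose. This is why `Fᵀ` is carried on Bob's side throughout. -/
theorem expectation_eq_trace (E : Matrix (Fin dA) (Fin dA) ℂ) (F : Matrix (Fin dB) (Fin dB) ℂ)
    (ψ : Fin dA × Fin dB → ℂ) :
    expectation E F ψ = ((stateMatrix ψ)ᴴ * E * stateMatrix ψ * Fᵀ).trace.re := by
  rw [expectation]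
  congr 1
  simp only [dotProduct, Matrix.mulVec, Matrix.trace, Matrix.diag, Matrix.mul_apply, stateMatrix,
    Matrix.of_apply, Matrix.conjTranspose_apply, Matrix.transpose_apply, Fintype.sum_prod_type,
    Pi.star_apply, Matrix.kroneckerMap_apply, Finset.mul_sum, Finset.sum_mul]
  rw [Finset.sum_comm]
  refine Finset.sum_congr rfl fun t _ => ?_
  rw [Finset.sum_congr rfl fun s _ => Finset.sum_comm, Finset.sum_comm]
  refine Finset.sum_congr rfl fun t' _ => ?_
  rw [Finset.sum_comm]
  refine Finset.sum_congr rfl fun s' _ => Finset.sum_congr rfl fun s _ => ?_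
  ring

theorem expectation_sum_left {ι : Type*} (s : Finset ι) (E : ι → Matrix (Fin dA) (Fin dA) ℂ)
    (F : Matrix (Fin dB) (Fin dB) ℂ) (ψ : Fin dA × Fin dB → ℂ) :
    expectation (∑ i ∈ s, E i) F ψ = ∑ i ∈ s, expectation (E i) F ψ := by
  simp only [expectation_eq_trace, Matrix.mul_sum, Matrix.sum_mul, Matrix.trace_sum, Complex.re_sum]

theorem expectation_sum_right {ι : Type*} (s : Finset ι) (E : Matrix (Fin dA) (Fin dA) ℂ)
    (F : ι → Matrix (Fin dB) (Fin dB) ℂ) (ψ : Fin dA × Fin dB → ℂ) :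
    expectation E (∑ i ∈ s, F i) ψ = ∑ i ∈ s, expectation E (F i) ψ := by
  simp only [expectation_eq_trace, Matrix.transpose_sum, Matrix.mul_sum, Matrix.trace_sum,
    Complex.re_sum]

theorem expectation_one_one {ψ : Fin dA × Fin dB → ℂ} (h : star ψ ⬝ᵥ ψ = 1) :
    expectation 1 1 ψ = 1 := by
  rw [expectation, Matrix.one_kronecker_one, Matrix.one_mulVec, h, Complex.one_re]

theorem expectation_nonneg {E : Matrix (Fin dA) (Fin dA) ℂ} {F : Matrix (Fin dB) (Fin dB) ℂ}
    (hE : E.PosSemidef) (hF : F.PosSemidef) (ψ : Fin dA × Fin dB → ℂ) : 0 ≤ expectation E F ψ :=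
  (hE.kronecker hF).re_dotProduct_nonneg ψ

/-- The standard maximally entangled state. -/
def maxEntangledState (r : ℕ) : Fin r × Fin r → ℂ :=
  fun p => if p.1 = p.2 then ((Real.sqrt r)⁻¹ : ℝ) else 0

theorem stateMatrix_maxEntangledState (r : ℕ) :
    stateMatrix (maxEntangledState r) = (((Real.sqrt r)⁻¹ : ℝ) : ℂ) • 1 := by
  ext s t
  simp [stateMatrix, maxEntangledState, Matrix.one_apply]

theorem inv_sqrt_mul_self (r : ℕ) :
    (((Real.sqrt r)⁻¹ : ℝ) : ℂ) * (((Real.sqrt r)⁻¹ : ℝ) : ℂ) = 1 / r := by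
  rw [← Complex.ofReal_mul, ← mul_inv, Real.mul_self_sqrt (Nat.cast_nonneg r)]
  simp

theorem maxEntangledState_isMaximallyEntangled (r : ℕ) :
    IsMaximallyEntangled (maxEntangledState r) := by
  have h := inv_sqrt_mul_self r
  constructor <;> ext s t
  · by_cases hst : s = t
    · subst hst
      simpa [reducedDensityA, maxEntangledState, apply_ite] using h
    · have : ∀ u, ¬ (s = u ∧ t = u) := fun u hu => hst (hu.1.trans hu.2.symm)
      simp only [reducedDensityA, maxEntangledState, Matrix.of_apply, Matrix.smul_apply,
        Matrix.one_apply_ne hst, smul_zero]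
      refine Finset.sum_eq_zero fun u _ => ?_
      by_cases h1 : s = u
      · have h2 : t ≠ u := fun h2 => this u ⟨h1, h2⟩
        simp [h2]
      · simp [h1]
  · by_cases hst : s = t
    · subst hst
      simpa [reducedDensityB, maxEntangledState, apply_ite] using h
    · have : ∀ u, ¬ (u = s ∧ u = t) := fun u hu => hst (hu.1.symm.trans hu.2)
      simp only [reducedDensityB, maxEntangledState, Matrix.of_apply, Matrix.smul_apply,
        Matrix.one_apply_ne hst, smul_zero]
      refine Finset.sum_eq_zero fun u _ => ?_
      by_cases h1 : u = s
      · have h2 : u ≠ t := fun h2 => this u ⟨h1, h2⟩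
        simp [h2]
      · simp [h1]

theorem maxEntangledState_unit {r : ℕ} (hr : 0 < r) :
    star (maxEntangledState r) ⬝ᵥ maxEntangledState r = 1 := by
  have h := inv_sqrt_mul_self r
  have hr' : (r : ℂ) ≠ 0 := by exact_mod_cast hr.ne'
  simp only [dotProduct, Fintype.sum_prod_type, Pi.star_apply, maxEntangledState]
  have : ∀ s t : Fin r, star (if s = t then (((Real.sqrt r)⁻¹ : ℝ) : ℂ) else 0) *
      (if s = t then (((Real.sqrt r)⁻¹ : ℝ) : ℂ) else 0) = if s = t then 1 / (r : ℂ) else 0 := by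
    intro s t
    by_cases hst : s = t
    · simpa [hst] using h
    · simp [hst]
  rw [Finset.sum_congr rfl fun s _ => Finset.sum_congr rfl fun t _ => this s t]
  simp [hr']

theorem expectation_maxEntangledState {r : ℕ} (E F : Matrix (Fin r) (Fin r) ℂ) :
    expectation E F (maxEntangledState r) = (E * Fᵀ).trace.re / r := by
  have h := inv_sqrt_mul_self r
  rw [expectation_eq_trace, stateMatrix_maxEntangledState, Matrix.conjTranspose_smul,
    Matrix.conjTranspose_one, Complex.star_def, Complex.conj_ofReal]
  simp only [Matrix.smul_mul, Matrix.mul_smul, Matrix.one_mul, Matrix.mul_one, smul_smul,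
    Matrix.trace_smul, h]
  rw [smul_eq_mul, show (1 / (r : ℂ)) = ((1 / r : ℝ) : ℂ) by push_cast; rfl, Complex.re_ofReal_mul]
  ring

end Expectation

/-! ### Losing probability of a strategy -/

section GameValue

variable {I : Type u} {J : Type v} [Fintype I] [Fintype J] {A : I → Type w} {B : J → Type x}
  (G : NonlocalGame A B)

/-- The weight of a losing pair of question-answer pairs. -/
def NonlocalGame.lossWeight (k : Σ i, A i) (l : Σ j, B j) : ℝ :=
  G.η k.1 l.1 * if G.V k.1 l.1 k.2 l.2 = true then 0 else 1

theorem NonlocalGame.lossWeight_nonneg (k : Σ i, A i) (l : Σ j, B j) : 0 ≤ G.lossWeight k l := by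
  unfold NonlocalGame.lossWeight
  have := G.η_nonneg k.1 l.1
  split_ifs <;> simp [this]

variable [∀ i, Fintype (A i)] [∀ j, Fintype (B j)] {dA dB : ℕ}

theorem NonlocalGame.one_sub_value (S : QStrategy A B dA dB) :
    1 - G.value S = ∑ k : Σ i, A i, ∑ l : Σ j, B j,
      G.lossWeight k l * expectation (S.E k.1 k.2) (S.F l.1 l.2) S.ψ := by
  have h1 : ∀ i j, ∑ a, ∑ b, expectation (S.E i a) (S.F j b) S.ψ = 1 := fun i j => by
    simp only [← expectation_sum_right, ← expectation_sum_left, S.E_sum, S.F_sum,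
      expectation_one_one S.ψ_unit]
  rw [Fintype.sum_sigma, NonlocalGame.value]
  simp only [Fintype.sum_sigma, NonlocalGame.lossWeight]
  have h2 : ∀ i, ∑ a, ∑ j, ∑ b, (G.η i j * if G.V i j a b = true then 0 else 1) *
      expectation (S.E i a) (S.F j b) S.ψ = ∑ j, ∑ a, ∑ b, (G.η i j *
        if G.V i j a b = true then 0 else 1) * expectation (S.E i a) (S.F j b) S.ψ :=
    fun i => Finset.sum_comm
  rw [Finset.sum_congr rfl fun i _ => h2 i]
  refine (congrArg (· - _) G.η_sum.symm).trans ?_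
  rw [← Finset.sum_sub_distrib]
  refine Finset.sum_congr rfl fun i _ => ?_
  rw [← Finset.sum_sub_distrib]
  refine Finset.sum_congr rfl fun j _ => ?_
  refine (congrArg (· - _) ((mul_one _).symm.trans (congrArg (G.η i j * ·) (h1 i j).symm))).trans ?_
  rw [← mul_sub, ← Finset.sum_sub_distrib, Finset.mul_sum]
  refine Finset.sum_congr rfl fun a _ => ?_
  rw [← Finset.sum_sub_distrib, Finset.mul_sum]
  refine Finset.sum_congr rfl fun b _ => ?_
  split_ifs <;> simp

theorem NonlocalGame.value_le_one (S : QStrategy A B dA dB) : G.value S ≤ 1 := by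
  have := G.one_sub_value S
  have h : 0 ≤ 1 - G.value S := by
    rw [this]
    exact Finset.sum_nonneg fun k _ => Finset.sum_nonneg fun l _ =>
      mul_nonneg (G.lossWeight_nonneg k l) (expectation_nonneg (S.E_pos _ _) (S.F_pos _ _) _)
  linarith

theorem NonlocalGame.value_nonneg (S : QStrategy A B dA dB) : 0 ≤ G.value S :=
  Finset.sum_nonneg fun i _ => Finset.sum_nonneg fun j _ => mul_nonneg (G.η_nonneg i j) <|
    Finset.sum_nonneg fun a _ => Finset.sum_nonneg fun b _ =>
      mul_nonneg (by split_ifs <;> simp) (expectation_nonneg (S.E_pos _ _) (S.F_pos _ _) _)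

theorem NonlocalGame.quantumValue_le_one : G.quantumValue ≤ 1 :=
  Real.sSup_le (by rintro _ ⟨dA, dB, S, rfl⟩; exact G.value_le_one S) zero_le_one

/-- All terms of the losing probability are nonnegative, so losing events at one question pair
already contribute at most the whole loss. -/
theorem NonlocalGame.loss_pair_le (S : QStrategy A B dA dB) (i : I) (j : J)
    (P : Finset (A i × B j)) (hP : ∀ p ∈ P, G.V i j p.1 p.2 = false) :
    G.η i j * ∑ p ∈ P, expectation (S.E i p.1) (S.F j p.2) S.ψ ≤ 1 - G.value S := by
  classical
  rw [G.one_sub_value S, ← Fintype.sum_prod_type', Finset.mul_sum]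
  let f : A i × B j ↪ (Σ i, A i) × (Σ j, B j) :=
    ⟨fun p => (⟨i, p.1⟩, ⟨j, p.2⟩), fun p q h => by
      simp only [Prod.mk.injEq, Sigma.mk.injEq, heq_eq_eq, true_and] at h
      exact Prod.ext h.1 h.2⟩
  have h1 : ∑ p ∈ P, G.η i j * expectation (S.E i p.1) (S.F j p.2) S.ψ
      = ∑ q ∈ P.map f, G.lossWeight q.1 q.2 *
        expectation (S.E q.1.1 q.1.2) (S.F q.2.1 q.2.2) S.ψ := by
    rw [Finset.sum_map]
    refine Finset.sum_congr rfl fun p hp => ?_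
    change _ = (G.η i j * if G.V i j p.1 p.2 = true then 0 else 1) * _
    rw [hP p hp, if_neg (by simp), mul_one]
    rfl
  rw [h1]
  exact Finset.sum_le_sum_of_subset_of_nonneg (Finset.subset_univ _) fun q _ _ =>
    mul_nonneg (G.lossWeight_nonneg _ _) (expectation_nonneg (S.E_pos _ _) (S.F_pos _ _) _)

end GameValue

/-! ### Algebra of projective measurements -/

section Projections

variable {n α : Type*} [Fintype n] [Fintype α]

theorem trace_mul_conj_projections {m p : Type*} [Fintype m] [Fintype p]
    {V : Matrix m n ℂ} {W : Matrix p n ℂ} {E : Matrix m m ℂ} {F : Matrix p p ℂ}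
    (hE : IsStarProjection E) (hF : IsStarProjection F) :
    ((Vᴴ * (E * V)) * (Wᴴ * (F * W))).trace.re = fro ((E * V) * (F * W)ᴴ) ^ 2 := by
  have e1 : Vᴴ * (E * V) = (E * V)ᴴ * (E * V) := by
    rw [Matrix.conjTranspose_mul, hE.isHermitian.eq, Matrix.mul_assoc, ← Matrix.mul_assoc E,
      hE.isIdempotentElem.eq]
  have e2 : Wᴴ * (F * W) = (F * W)ᴴ * (F * W) := by
    rw [Matrix.conjTranspose_mul, hF.isHermitian.eq, Matrix.mul_assoc, ← Matrix.mul_assoc F,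
      hF.isIdempotentElem.eq]
  rw [e1, e2, fro_sq_eq_trace', Matrix.conjTranspose_mul (E * V), Matrix.conjTranspose_conjTranspose,
    Matrix.mul_assoc, Matrix.trace_mul_comm]
  simp only [Matrix.mul_assoc]

/-- The trace is the squared norm of `(E V)(F W)*`, and the product of the compressions is a
compression of that matrix. A small losing probability therefore makes the operator product itself
small. -/
theorem fro_mul_conj_projections_sq_le {m p : Type*} [Fintype m] [Fintype p] [DecidableEq m]
    [DecidableEq n] [DecidableEq p] {V : Matrix m n ℂ} {W : Matrix p n ℂ} {E : Matrix m m ℂ} {F : Matrix p p ℂ}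
    (hE : IsStarProjection E) (hF : IsStarProjection F) (hV : Vᴴ * V = 1) (hW : Wᴴ * W = 1) :
    fro ((Vᴴ * (E * V)) * (Wᴴ * (F * W))) ^ 2 ≤
      ((Vᴴ * (E * V)) * (Wᴴ * (F * W))).trace.re := by
  rw [trace_mul_conj_projections hE hF]
  have hV1 := norm_le_one_of_conjTranspose_mul_self hV
  have hW1 := norm_le_one_of_conjTranspose_mul_self hW
  have e : (Vᴴ * (E * V)) * (Wᴴ * (F * W)) = Vᴴ * ((E * V) * (F * W)ᴴ) * W := by
    rw [Matrix.conjTranspose_mul, hF.isHermitian.eq]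
    simp only [Matrix.mul_assoc]
  rw [e]
  exact pow_le_pow_left₀ (fro_nonneg _) ((fro_mul_le_of_norm_le_one' _ hW1).trans
    (fro_mul_le_of_norm_le_one (norm_conjTranspose_le_one hV1) _)) 2

/-- The projections of a projective measurement are mutually orthogonal. -/
theorem mul_eq_zero_of_projective [DecidableEq n] {E : α → Matrix n n ℂ} (hE : ∀ a, IsStarProjection (E a))
    (hsum : ∑ a, E a = 1) {a b : α} (hab : a ≠ b) : E a * E b = 0 := by
  classical
  have h1 : ∀ c, fro (E c * E b) ^ 2 = (E b * E c * E b).trace.re := fun c => by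
    rw [fro_sq_of_isStarProjection (hE c), (hE b).isHermitian.eq]
  -- The term `c = b` alone exhausts this sum of squares, so every other term vanishes.
  have h2 : ∑ c, fro (E c * E b) ^ 2 = fro (E b * E b) ^ 2 := by
    rw [h1 b, Finset.sum_congr rfl fun c _ => h1 c, ← Complex.re_sum, ← Matrix.trace_sum,
      ← Finset.sum_mul, ← Finset.mul_sum, hsum, Matrix.mul_one, (hE b).isIdempotentElem.eq,
      (hE b).isIdempotentElem.eq]
  rw [← Finset.add_sum_erase _ _ (Finset.mem_univ b), add_eq_left] at h2
  have h3 := (Finset.sum_eq_zero_iff_of_nonneg (fun c _ => sq_nonneg _)).1 h2 a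
    (Finset.mem_erase.2 ⟨hab, Finset.mem_univ a⟩)
  exact fro_eq_zero (by simpa using h3)

theorem sum_mul_sum_of_projective [DecidableEq n] [DecidableEq α] {E : α → Matrix n n ℂ}
    (hE : ∀ a, IsStarProjection (E a)) (hsum : ∑ a, E a = 1) (s t : Finset α) :
    (∑ a ∈ s, E a) * (∑ a ∈ t, E a) = ∑ a ∈ s ∩ t, E a := by
  have h : ∀ a b, E a * E b = if a = b then E a else 0 := fun a b => by
    split_ifs with hab
    · rw [← hab, (hE a).isIdempotentElem.eq]
    · exact mul_eq_zero_of_projective hE hsum hab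
  rw [Finset.sum_mul_sum]
  simp only [h, Finset.sum_ite_eq, Finset.sum_ite_mem]

theorem isStarProjection_sum_of_projective [DecidableEq n] {E : α → Matrix n n ℂ}
    (hE : ∀ a, IsStarProjection (E a)) (hsum : ∑ a, E a = 1) (s : Finset α) :
    IsStarProjection (∑ a ∈ s, E a) := by
  classical
  refine ⟨?_, ?_⟩
  · rw [IsIdempotentElem, sum_mul_sum_of_projective hE hsum, Finset.inter_self]
  · rw [IsSelfAdjoint, star_sum]
    exact Finset.sum_congr rfl fun a _ => (hE a).isSelfAdjoint

theorem IsStarProjection.transpose {P : Matrix n n ℂ} (hP : IsStarProjection P) :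
    IsStarProjection Pᵀ where
  isIdempotentElem := by rw [IsIdempotentElem, ← Matrix.transpose_mul, hP.isIdempotentElem.eq]
  isSelfAdjoint := hP.isHermitian.transpose

theorem IsStarProjection.submatrix {m : Type*} [Fintype m] {P : Matrix n n ℂ} (hP : IsStarProjection P)
    (e : m ≃ n) : IsStarProjection (P.submatrix e e) where
  isIdempotentElem := by rw [IsIdempotentElem, Matrix.submatrix_mul_equiv, hP.isIdempotentElem.eq]
  isSelfAdjoint := hP.isHermitian.submatrix e

theorem IsStarProjection.posSemidef {P : Matrix n n ℂ} (hP : IsStarProjection P) :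
    P.PosSemidef := by
  have h := Matrix.posSemidef_conjTranspose_mul_self P
  rwa [hP.isHermitian.eq, hP.isIdempotentElem.eq] at h

/-- For projections, the Frobenius distance between `E K` and `K Fᵀ` is the probability that the
outcomes of `E` and `F` differ. -/
theorem fro_sub_sq_eq_expectation {dA dB : ℕ} {E : Matrix (Fin dA) (Fin dA) ℂ}
    {F : Matrix (Fin dB) (Fin dB) ℂ} (hE : IsStarProjection E) (hF : IsStarProjection F)
    (ψ : Fin dA × Fin dB → ℂ) :
    fro (E * stateMatrix ψ - stateMatrix ψ * Fᵀ) ^ 2 =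
      expectation E (1 - F) ψ + expectation (1 - E) F ψ := by
  have hF' := hF.transpose
  rw [expectation_eq_trace, expectation_eq_trace, fro_sq_eq_trace]
  set K := stateMatrix ψ
  have e1 : (E * K - K * Fᵀ)ᴴ * (E * K - K * Fᵀ)
      = Kᴴ * E * K - Kᴴ * E * K * Fᵀ - Fᵀ * (Kᴴ * E * K) + Fᵀ * (Kᴴ * K * Fᵀ) := by
    rw [Matrix.conjTranspose_sub, Matrix.conjTranspose_mul, Matrix.conjTranspose_mul,
      hE.isHermitian.eq, hF'.isHermitian.eq]
    have h1 : Kᴴ * E * (E * K) = Kᴴ * E * K := by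
      rw [Matrix.mul_assoc, ← Matrix.mul_assoc E, hE.isIdempotentElem.eq, Matrix.mul_assoc]
    rw [Matrix.sub_mul, Matrix.mul_sub, Matrix.mul_sub, h1]
    simp only [Matrix.mul_assoc]
    abel
  have e2 : (Fᵀ * (Kᴴ * K * Fᵀ)).trace = (Kᴴ * K * Fᵀ).trace := by
    rw [Matrix.trace_mul_comm, Matrix.mul_assoc, hF'.isIdempotentElem.eq]
  rw [e1]
  simp only [Matrix.trace_add, Matrix.trace_sub, Complex.add_re, Complex.sub_re, e2,
    Matrix.transpose_sub, Matrix.transpose_one, Matrix.mul_sub, Matrix.sub_mul, Matrix.mul_one]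
  rw [Matrix.trace_mul_comm Fᵀ]
  ring

end Projections

/-! ### Transfer to coordinates `Fin r` and conjugation on Bob's side -/

section Reindexing

variable {d r : ℕ} {S : Type*}

theorem submatrix_isometry [DecidableEq S] {V : Matrix (Fin d) S ℂ} (hV : Vᴴ * V = 1) (e : Fin r ≃ S) :
    (V.submatrix id e)ᴴ * V.submatrix id e = 1 := by
  have : (V.submatrix id e)ᴴ * V.submatrix id e = (Vᴴ * V).submatrix e e := by
    ext s t; simp [Matrix.mul_apply]
  rw [this, hV, Matrix.submatrix_one_equiv]

theorem conj_isometry [DecidableEq S] {V : Matrix (Fin d) S ℂ} (hV : Vᴴ * V = 1) : (Vᴴᵀ)ᴴ * Vᴴᵀ = 1 := by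
  have h1 : (Vᴴᵀ)ᴴ = Vᵀ := by ext i j; simp
  rw [h1, ← Matrix.transpose_mul, hV, Matrix.transpose_one]

theorem littleFrobenius_submatrix_le [Fintype S] {V : Matrix (Fin d) S ℂ} {E : Matrix (Fin d) (Fin d) ℂ}
    {Q : Matrix S S ℂ} (e : Fin r ≃ S) {c : ℝ} (hr : 0 < r)
    (h : fro (E * V - V * Q) ≤ c * Real.sqrt r) :
    littleFrobenius (E * V.submatrix id e - V.submatrix id e * Q.submatrix e e) ≤ c := by
  have h1 : E * V.submatrix id e - V.submatrix id e * Q.submatrix e e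
      = (E * V - V * Q).submatrix (Equiv.refl _).symm e.symm.symm := by
    rw [Matrix.submatrix_mul_equiv]
    ext s t; simp [Matrix.mul_apply]
  have hr' : 0 < Real.sqrt r := Real.sqrt_pos.2 (by exact_mod_cast hr)
  rw [littleFrobenius_eq, h1, fro_reindex, div_le_iff₀ hr']
  exact h

/-- Bob's cut is constructed for `Fᵀ`. Returning to `F` conjugates the isometry entrywise, which
leaves the Frobenius norm unchanged. -/
theorem littleFrobenius_conj_submatrix_le [Fintype S] {V : Matrix (Fin d) S ℂ} {F : Matrix (Fin d) (Fin d) ℂ}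
    {R : Matrix S S ℂ} (hF : F.IsHermitian) (hR : R.IsHermitian) (e : Fin r ≃ S) {c : ℝ}
    (hr : 0 < r) (h : fro (Fᵀ * V - V * R) ≤ c * Real.sqrt r) :
    littleFrobenius (F * Vᴴᵀ.submatrix id e - Vᴴᵀ.submatrix id e * Rᵀ.submatrix e e) ≤ c := by
  apply littleFrobenius_submatrix_le e hr
  have h1 : F * Vᴴᵀ - Vᴴᵀ * Rᵀ = ((Fᵀ * V - V * R)ᴴ)ᵀ := by
    rw [Matrix.conjTranspose_sub, Matrix.conjTranspose_mul, Matrix.conjTranspose_mul, hR.eq,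
      hF.transpose.eq, Matrix.transpose_sub, Matrix.transpose_mul, Matrix.transpose_mul,
      Matrix.transpose_transpose]
  rwa [h1, fro_transpose, fro_conjTranspose]

theorem trace_submatrix_mul [Fintype S] (e : Fin r ≃ S) (Q R : Matrix S S ℂ) :
    (Q.submatrix e e * (Rᵀ.submatrix e e)ᵀ).trace = (Q * R).trace := by
  rw [Matrix.transpose_submatrix, Matrix.transpose_transpose, Matrix.submatrix_mul_equiv]
  simp only [Matrix.trace, Matrix.diag, Matrix.submatrix_apply]
  exact Equiv.sum_comp e (fun i => (Q * R) i i)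

end Reindexing

/-! ### Rounding a projective strategy for a nonlocal game -/

section GameRounding

variable {I : Type u} {J : Type v} [Fintype I] [Fintype J] {A : I → Type w} {B : J → Type x}
  [∀ i, Fintype (A i)] [∀ j, Fintype (B j)]

/-- A projective measurement compressed to an almost invariant subspace is close to a projective
measurement of the subspace. -/
theorem exists_pvm_near_compression {α m n : Type*} [Fintype α] [Fintype m] [DecidableEq m]
    [Fintype n] [DecidableEq n] {E : α → Matrix m m ℂ} (hE : ∀ a, IsStarProjection (E a))
    (hsum : ∑ a, E a = 1) {V : Matrix m n ℂ} (hV : Vᴴ * V = 1) {γ : ℝ}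
    (hγ : ∀ a, fro ((1 - V * Vᴴ) * (E a * V)) ≤ γ) :
    ∃ Q : α → Matrix n n ℂ, (∀ a, IsStarProjection (Q a)) ∧ ∑ a, Q a = 1 ∧
      ∀ a, fro (Q a - Vᴴ * (E a * V)) ≤
        (Fintype.card α + 1) * roundingConst (Fintype.card α) * γ := by
  classical
  have hV1 := norm_le_one_of_conjTranspose_mul_self hV
  refine exists_pvm_near (fun a => Vᴴ * (E a * V)) (fun a => ?_) (fun a => ?_) ?_ (fun a => ?_)
    (fun a b hab => ?_)
  · have := Matrix.isHermitian_conjTranspose_mul_mul V (hE a).isHermitian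
    rwa [Matrix.mul_assoc] at this
  · exact norm_mul_le_one (norm_conjTranspose_le_one hV1)
      (norm_mul_le_one (hE a).matrix_norm_le_one hV1)
  · rw [← Matrix.mul_sum, ← Matrix.sum_mul, hsum, Matrix.one_mul, hV]
  · have := fro_compress_mul_compress_le hV (F := E a) (hE a).matrix_norm_le_one
    rw [(hE a).isIdempotentElem.eq] at this
    exact this.trans (hγ a)
  · have := fro_compress_mul_compress_le hV (F := E b) (hE a).matrix_norm_le_one
    rw [mul_eq_zero_of_projective hE hsum hab, Matrix.zero_mul, Matrix.mul_zero, sub_zero] at this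
    exact this.trans (hγ b)

/-- For projections `tr(QR) = ‖QR‖²`, so rounding errors enter the loss quadratically: `(‖XY‖ + 2d)²
≤ 2‖XY‖² + 8d²`. Hence the value is lost at the rate `M`, although the operators move by `√M`. -/
theorem trace_mul_projections_le {m p n : Type*} [Fintype m] [Fintype p] [Fintype n]
    [DecidableEq m] [DecidableEq p] [DecidableEq n] {V : Matrix m n ℂ} {W : Matrix p n ℂ}
    {E : Matrix m m ℂ} {F : Matrix p p ℂ} (hE : IsStarProjection E) (hF : IsStarProjection F)
    (hV : Vᴴ * V = 1) (hW : Wᴴ * W = 1) {Q R : Matrix n n ℂ} (hQ : IsStarProjection Q)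
    (hR : IsStarProjection R) {d : ℝ} (hQd : fro (Q - Vᴴ * (E * V)) ≤ d)
    (hRd : fro (R - Wᴴ * (F * W)) ≤ d) :
    (Q * R).trace.re ≤ 2 * ((Vᴴ * (E * V)) * (Wᴴ * (F * W))).trace.re + 8 * d ^ 2 := by
  have h0 := fro_mul_conj_projections_sq_le hE hF hV hW
  have hV1 := norm_le_one_of_conjTranspose_mul_self hV
  have hX1 : ‖Vᴴ * (E * V)‖ ≤ 1 := norm_mul_le_one (norm_conjTranspose_le_one hV1)
    (norm_mul_le_one hE.matrix_norm_le_one hV1)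
  generalize Vᴴ * (E * V) = X at *
  generalize Wᴴ * (F * W) = Y at *
  have h1 : (Q * R).trace.re = fro (Q * R) ^ 2 := by
    rw [fro_sq_of_isStarProjection hQ, hR.isHermitian.eq, Matrix.mul_assoc,
      Matrix.trace_mul_comm R, Matrix.mul_assoc, hR.isIdempotentElem.eq]
  have h2 : fro (Q * R) ≤ fro (X * Y) + 2 * d := by
    have e1 : Q * R = X * Y + ((Q - X) * R + X * (R - Y)) := by
      rw [Matrix.sub_mul, Matrix.mul_sub]; abel
    rw [e1]
    have i1 := (fro_mul_le_of_norm_le_one' (Q - X) hR.matrix_norm_le_one).trans hQd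
    have i2 := (fro_mul_le_of_norm_le_one hX1 (R - Y)).trans hRd
    linarith [fro_add_le (X * Y) ((Q - X) * R + X * (R - Y)), fro_add_le ((Q - X) * R) (X * (R - Y))]
  have h4 := pow_le_pow_left₀ (fro_nonneg _) h2 2
  rw [h1]
  nlinarith [sq_nonneg (fro (X * Y) - 2 * d)]

set_option maxHeartbeats 800000 in
/-- Rounding of a projective strategy whose operators almost commute with the absolute values of
its state to a strategy with a maximally entangled state. -/
theorem NonlocalGame.exists_maxEntangled_near (G : NonlocalGame A B) :
    ∃ C : ℝ, 0 < C ∧ ∀ (dA dB : ℕ) (S : QStrategy A B dA dB), S.IsProjective →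
      ∀ (T : Finset (Fin dB)) (σ : Schmidt (stateMatrix S.ψ) T) (δ : ℝ),
      (∀ i a, fro (S.E i a * σ.abs - σ.abs * S.E i a) ≤ δ) →
      (∀ j b, fro ((S.F j b)ᵀ * σ.symm.abs - σ.symm.abs * (S.F j b)ᵀ) ≤ δ) →
      ∀ M : ℝ, δ ≤ M → 1 - G.value S ≤ M →
      ∃ (r : ℕ) (S' : QStrategy A B r r), S'.IsProjective ∧ IsMaximallyEntangled S'.ψ ∧
        1 - C * M ≤ G.value S' ∧ S.IsCloseOnSupport S' (C * Real.sqrt M) := by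
  classical
  set C₁ : ℝ := 3 * (Fintype.card (Σ i, A i) + Fintype.card (Σ j, B j)) +
    ∑ k : Σ i, A i, ∑ l : Σ j, B j, |-G.lossWeight k l| + 1 with hC₁
  have hC₁pos : 0 < C₁ := by positivity
  set N : ℝ := ∑ k : Σ i, A i, ∑ l : Σ j, B j, G.lossWeight k l with hN
  have hN0 : 0 ≤ N := Finset.sum_nonneg fun k _ => Finset.sum_nonneg fun l _ =>
    G.lossWeight_nonneg k l
  let cA : I → ℝ := fun i => (Fintype.card (A i) + 1) * roundingConst (Fintype.card (A i))
  let cB : J → ℝ := fun j => (Fintype.card (B j) + 1) * roundingConst (Fintype.card (B j))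
  have hcA : ∀ i, 0 ≤ cA i := fun i => mul_nonneg (by positivity) (roundingConst_nonneg _)
  have hcB : ∀ i, 0 ≤ cB i := fun i => mul_nonneg (by positivity) (roundingConst_nonneg _)
  set c : ℝ := ∑ i, cA i + ∑ j, cB j with hc
  have hcA' : ∀ i, cA i ≤ c := fun i => by
    have h1 := Finset.single_le_sum (f := cA) (fun i _ => hcA i) (Finset.mem_univ i)
    have h2 : 0 ≤ ∑ j, cB j := Finset.sum_nonneg fun j _ => hcB j
    linarith
  have hcB' : ∀ i, cB i ≤ c := fun i => by
    have h1 := Finset.single_le_sum (f := cB) (fun i _ => hcB i) (Finset.mem_univ i)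
    have h2 : 0 ≤ ∑ j, cA j := Finset.sum_nonneg fun j _ => hcA j
    linarith
  have hc0 : 0 ≤ c := add_nonneg (Finset.sum_nonneg fun i _ => hcA i)
    (Finset.sum_nonneg fun j _ => hcB j)
  set C : ℝ := (2 + 8 * c ^ 2 * N) * C₁ + (1 + c) * Real.sqrt C₁ with hC
  refine ⟨C, by positivity, ?_⟩
  intro dA dB S hS T σ δ hδE hδF M hδM hεM
  have hM0 : 0 ≤ M := le_trans (by linarith [G.value_le_one S]) hεM
  -- The functional is minus the loss, with optimum `β = 0`; on each cut the loss is nonnegative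
  -- because it is a weighted sum of squared norms.
  obtain ⟨P, hPne, hPE, hPF, hPv⟩ := σ.exists_good_cut (κ := Σ i, A i) (μ := Σ j, B j)
    (fro_stateMatrix S.ψ_unit) (fun k => S.E k.1 k.2)
    (fun l => (S.F l.1 l.2)ᵀ) (fun k => (hS.1 _ _).matrix_norm_le_one)
    (fun l => (hS.2 _ _).transpose.matrix_norm_le_one) (δ := δ) (ε := 1 - G.value S) (β := 0)
    (fun k => hδE _ _) (fun l => hδF _ _) (fun k l => - G.lossWeight k l)
    (fun P => by
      rw [zero_mul]
      refine Finset.sum_nonpos fun k _ => Finset.sum_nonpos fun l _ => ?_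
      rw [trace_mul_conj_projections (hS.1 _ _) (hS.2 _ _).transpose]
      have := mul_nonneg (G.lossWeight_nonneg k l) (sq_nonneg (fro ((S.E k.1 k.2 * σ.cut P) *
        ((S.F l.1 l.2)ᵀ * σ.symm.cut P)ᴴ)))
      linarith)
    (by
      rw [G.one_sub_value S]
      simp only [neg_mul, Finset.sum_neg_distrib, expectation_eq_trace, zero_sub]
      exact le_rfl)
  set M' := (3 * ((Fintype.card (Σ i, A i) : ℝ) + Fintype.card (Σ j, B j)) +
    ∑ k : Σ i, A i, ∑ l : Σ j, B j, |-G.lossWeight k l|) * δ + (1 - G.value S) with hM'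
  have hM'le : M' ≤ C₁ * M := by
    have h0 : 0 ≤ 3 * ((Fintype.card (Σ i, A i) : ℝ) + Fintype.card (Σ j, B j)) +
      ∑ k : Σ i, A i, ∑ l : Σ j, B j, |-G.lossWeight k l| := by positivity
    have := mul_le_mul_of_nonneg_left hδM h0
    rw [hM', hC₁, add_mul _ 1 M]
    linarith
  set L := C₁ * M with hL
  have hL0 : 0 ≤ L := by positivity
  set r := P.card with hr
  have hrpos : 0 < r := Finset.card_pos.2 hPne
  -- The norm `fro` is unnormalised, so on an `r`-dimensional cut the defects scale with `√r`; this
  -- factor disappears in `littleFrobenius`.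
  set γ := Real.sqrt (L * r) with hγ
  have hγ2 : γ ^ 2 = L * r := Real.sq_sqrt (by positivity)
  have hγ0 : 0 ≤ γ := Real.sqrt_nonneg _
  have hPE' : ∀ i a, fro ((1 - σ.cut P * (σ.cut P)ᴴ) * (S.E i a * σ.cut P)) ≤ γ := fun i a =>
    Real.le_sqrt_of_sq_le ((hPE ⟨i, a⟩).trans (by gcongr))
  have hPF' : ∀ j b, fro ((1 - σ.symm.cut P * (σ.symm.cut P)ᴴ) *
      ((S.F j b)ᵀ * σ.symm.cut P)) ≤ γ := fun j b =>
    Real.le_sqrt_of_sq_le ((hPF ⟨j, b⟩).trans (by gcongr))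
  have hVA := σ.cut_isometry P
  have hVB := σ.symm.cut_isometry P
  choose Q hQ hQsum hQd using fun i =>
    exists_pvm_near_compression (fun a => hS.1 i a) (S.E_sum i) hVA (hPE' i)
  choose R hR hRsum hRd using fun j =>
    exists_pvm_near_compression (E := fun b => (S.F j b)ᵀ) (fun b => (hS.2 j b).transpose)
      (by rw [← Matrix.transpose_sum, S.F_sum, Matrix.transpose_one]) hVB (hPF' j)
  have hQd' : ∀ i a, fro (Q i a - (σ.cut P)ᴴ * (S.E i a * σ.cut P)) ≤ c * γ := fun i a =>
    (hQd i a).trans (mul_le_mul_of_nonneg_right (hcA' i) hγ0)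
  have hRd' : ∀ j b, fro (R j b - (σ.symm.cut P)ᴴ * ((S.F j b)ᵀ * σ.symm.cut P)) ≤ c * γ :=
    fun j b => (hRd j b).trans (mul_le_mul_of_nonneg_right (hcB' j) hγ0)
  let e : Fin r ≃ P := P.equivFin.symm
  let S' : QStrategy A B r r :=
    { E := fun i a => (Q i a).submatrix e e
      F := fun j b => (R j b)ᵀ.submatrix e e
      E_pos := fun i a => ((hQ i a).submatrix e).posSemidef
      F_pos := fun j b => ((hR j b).transpose.submatrix e).posSemidef
      E_sum := fun i => by
        have := congrArg (fun X => X.submatrix e e) (hQsum i)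
        simp only [Matrix.submatrix_one_equiv] at this
        rw [← this]
        ext s t; simp [Matrix.sum_apply]
      F_sum := fun j => by
        have := congrArg (fun X => Xᵀ.submatrix e e) (hRsum j)
        simp only [Matrix.transpose_one, Matrix.submatrix_one_equiv] at this
        rw [← this]
        ext s t; simp [Matrix.sum_apply]
      ψ := maxEntangledState r
      ψ_unit := maxEntangledState_unit hrpos }
  have hsqrt : γ = Real.sqrt C₁ * Real.sqrt M * Real.sqrt r := by
    rw [hγ, hL, Real.sqrt_mul (by positivity), Real.sqrt_mul hC₁pos.le]
  have hclose : (γ + c * γ) ≤ C * Real.sqrt M * Real.sqrt r := by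
    rw [hsqrt]
    have h1 : (0 : ℝ) ≤ (2 + 8 * c ^ 2 * N) * C₁ := by positivity
    have h2 : 0 ≤ Real.sqrt M * Real.sqrt r := by positivity
    rw [hC]
    nlinarith [mul_nonneg h1 h2]
  refine ⟨r, S', ⟨fun i a => (hQ i a).submatrix e, fun j b => (hR j b).transpose.submatrix e⟩,
    maxEntangledState_isMaximallyEntangled r, ?_, ?_⟩
  · have hrr : (0 : ℝ) < r := by exact_mod_cast hrpos
    set τ : (Σ i, A i) → (Σ j, B j) → ℝ := fun k l =>
      (((σ.cut P)ᴴ * (S.E k.1 k.2 * σ.cut P)) *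
        ((σ.symm.cut P)ᴴ * ((S.F l.1 l.2)ᵀ * σ.symm.cut P))).trace.re with hτ
    have hloss : ∑ k, ∑ l, G.lossWeight k l * τ k l ≤ L * r := by
      have : ∑ k, ∑ l, G.lossWeight k l * τ k l ≤ M' * r := by
        simpa [hτ] using hPv
      exact this.trans (by gcongr)
    have hterm : ∀ (k : Σ i, A i) (l : Σ j, B j), (Q k.1 k.2 * R l.1 l.2).trace.re ≤
        2 * τ k l + 8 * c ^ 2 * (L * r) := by
      intro k l
      have h := trace_mul_projections_le (hS.1 k.1 k.2) (hS.2 l.1 l.2).transpose hVA hVB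
        (hQ k.1 k.2) (hR l.1 l.2) (hQd' k.1 k.2) (hRd' l.1 l.2)
      rw [mul_pow, hγ2, ← mul_assoc] at h
      exact h
    have hval : 1 - G.value S' = (∑ k : Σ i, A i, ∑ l : Σ j, B j,
        G.lossWeight k l * (Q k.1 k.2 * R l.1 l.2).trace.re) / r := by
      rw [G.one_sub_value S', Finset.sum_div]
      refine Finset.sum_congr rfl fun k _ => ?_
      rw [Finset.sum_div]
      refine Finset.sum_congr rfl fun l _ => ?_
      simp only [S']
      rw [expectation_maxEntangledState, trace_submatrix_mul, mul_div_assoc]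
    have hsum : ∑ k : Σ i, A i, ∑ l : Σ j, B j,
        G.lossWeight k l * (Q k.1 k.2 * R l.1 l.2).trace.re
        ≤ 2 * (L * r) + N * (8 * c ^ 2 * (L * r)) := by
      calc _ ≤ ∑ k : Σ i, A i, ∑ l : Σ j, B j,
            (2 * (G.lossWeight k l * τ k l) + G.lossWeight k l * (8 * c ^ 2 * (L * r))) := by
            refine Finset.sum_le_sum fun k _ => Finset.sum_le_sum fun l _ => ?_
            have := mul_le_mul_of_nonneg_left (hterm k l) (G.lossWeight_nonneg k l)
            linarith
        _ = 2 * (∑ k, ∑ l, G.lossWeight k l * τ k l) + N * (8 * c ^ 2 * (L * r)) := by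
            simp only [Finset.sum_add_distrib, ← Finset.mul_sum, hN, Finset.sum_mul]
        _ ≤ _ := by gcongr
    have : 1 - G.value S' ≤ (2 + 8 * c ^ 2 * N) * C₁ * M := by
      rw [hval, div_le_iff₀ hrr]
      refine hsum.trans_eq ?_
      rw [hL]; ring
    have h5 : 0 ≤ (1 + c) * Real.sqrt C₁ * M := by positivity
    rw [hC]
    linarith
  · refine ⟨(σ.cut P).submatrix id e, (σ.symm.cut P)ᴴᵀ.submatrix id e, submatrix_isometry hVA e,
      submatrix_isometry (conj_isometry hVB) e, fun i a => ?_, fun j b => ?_⟩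
    · apply littleFrobenius_submatrix_le e hrpos
      refine le_trans ?_ hclose
      exact (fro_mul_sub_mul_le hVA _ _).trans (add_le_add (hPE' i a) (hQd' i a))
    · apply littleFrobenius_conj_submatrix_le (hS.2 j b).isHermitian (hR j b).isHermitian e hrpos
      refine le_trans ?_ hclose
      exact (fro_mul_sub_mul_le hVB _ _).trans (add_le_add (hPF' j b) (hRd' j b))

/-- If answers in `s` for question `i` force answers in `t` for question `j` and vice versa, then
in a good strategy the corresponding projections almost agree on the state. -/
theorem NonlocalGame.fro_sub_sq_le (G : NonlocalGame A B) {dA dB : ℕ} (S : QStrategy A B dA dB)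
    (hS : S.IsProjective) (i : I) (j : J) (hη : 0 < G.η i j) (s : Finset (A i)) (t : Finset (B j))
    (hst : ∀ a b, ¬ (a ∈ s ↔ b ∈ t) → G.V i j a b = false) :
    fro ((∑ a ∈ s, S.E i a) * stateMatrix S.ψ - stateMatrix S.ψ * (∑ b ∈ t, S.F j b)ᵀ) ^ 2
      ≤ (1 - G.value S) / G.η i j := by
  classical
  have hE := isStarProjection_sum_of_projective (hS.1 i) (S.E_sum i) s
  have hF := isStarProjection_sum_of_projective (hS.2 j) (S.F_sum j) t
  rw [fro_sub_sq_eq_expectation hE hF, le_div_iff₀ hη, mul_comm]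
  have e1 : 1 - ∑ b ∈ t, S.F j b = ∑ b ∈ tᶜ, S.F j b := by
    rw [← S.F_sum j, ← Finset.sum_add_sum_compl t, add_sub_cancel_left]
  have e2 : 1 - ∑ a ∈ s, S.E i a = ∑ a ∈ sᶜ, S.E i a := by
    rw [← S.E_sum i, ← Finset.sum_add_sum_compl s, add_sub_cancel_left]
  have hdisj : Disjoint (s ×ˢ tᶜ) (sᶜ ×ˢ t) := by
    rw [Finset.disjoint_left]
    rintro ⟨a, b⟩ h1 h2
    simp only [Finset.mem_product, Finset.mem_compl] at h1 h2
    exact h2.1 h1.1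
  -- The two disjoint losing events are that only Alice's answer, or only Bob's, lies in its
  -- distinguished set.
  have := G.loss_pair_le S i j ((s ×ˢ tᶜ) ∪ (sᶜ ×ˢ t)) (fun p hp => hst _ _ (by
    simp only [Finset.mem_union, Finset.mem_product, Finset.mem_compl] at hp
    tauto))
  rw [Finset.sum_union hdisj, Finset.sum_product, Finset.sum_product] at this
  rw [e1, e2]
  simp only [expectation_sum_left]
  simp only [expectation_sum_right]
  exact this

end GameRounding

/-! ### Synchronous and BCS games -/

section PerfectGames

theorem rpow_le_rpow_of_le_one {x y p q : ℝ} (hx : 0 ≤ x) (hx1 : x ≤ 1) (hxy : x ≤ y) (hq : 0 ≤ q)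
    (hqp : q ≤ p) : x ^ p ≤ y ^ q :=
  (Real.rpow_le_rpow_of_exponent_ge' hx hx1 hq hqp).trans (Real.rpow_le_rpow hx hxy hq)

theorem sqrt_mul_sqrt_eq {c x : ℝ} (hc : 0 ≤ c) (hx : 0 ≤ x) :
    Real.sqrt (c * Real.sqrt x) = Real.sqrt c * x ^ (1 / 4 : ℝ) := by
  rw [Real.sqrt_mul hc, Real.sqrt_eq_rpow (Real.sqrt x), Real.sqrt_eq_rpow x, ← Real.rpow_mul hx]
  norm_num

theorem QStrategy.IsCloseOnSupport.mono {I : Type u} {J : Type v} {A : I → Type w} {B : J → Type x}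
    [∀ i, Fintype (A i)] [∀ j, Fintype (B j)] {dA dB r : ℕ} {S : QStrategy A B dA dB}
    {S' : QStrategy A B r r} {δ δ' : ℝ} (h : S.IsCloseOnSupport S' δ) (hδ : δ ≤ δ') :
    S.IsCloseOnSupport S' δ' := by
  obtain ⟨VA, VB, h1, h2, h3, h4⟩ := h
  exact ⟨VA, VB, h1, h2, fun i a => (h3 i a).trans hδ, fun j b => (h4 j b).trans hδ⟩

/-- Reduces a game to commutator bounds of order `√(1 - value)`. The true loss lies in `[0, 1]` and
is at most `ε`, so its square root is at most `ε ^ p` for all `0 ≤ p ≤ 1/2`, including when `ε > 1`.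
-/
theorem NonlocalGame.exists_rounding {I : Type u} {J : Type v} [Fintype I] [Fintype J]
    {A : I → Type w} {B : J → Type x} [∀ i, Fintype (A i)] [∀ j, Fintype (B j)]
    (G : NonlocalGame A B) {c : ℝ} (hc : 0 ≤ c) :
    ∃ C : ℝ, 0 < C ∧ ∀ (dA dB : ℕ) (S : QStrategy A B dA dB), S.IsProjective →
      (∀ (T : Finset (Fin dB)) (σ : Schmidt (stateMatrix S.ψ) T),
        (∀ i a, fro (S.E i a * σ.abs - σ.abs * S.E i a) ≤ c * Real.sqrt (1 - G.value S)) ∧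
        (∀ j b, fro ((S.F j b)ᵀ * σ.symm.abs - σ.symm.abs * (S.F j b)ᵀ) ≤
          c * Real.sqrt (1 - G.value S))) →
      ∃ (r : ℕ) (S' : QStrategy A B r r), S'.IsProjective ∧ IsMaximallyEntangled S'.ψ ∧
        ∀ ε p : ℝ, G.IsPerfectUpTo ε S → 0 ≤ p → p ≤ 1 / 2 →
          G.IsOptimalUpTo (C * ε ^ p) S' ∧ S.IsCloseOnSupport S' (C * ε ^ (p / 2)) := by
  obtain ⟨C₀, hC₀, h⟩ := G.exists_maxEntangled_near
  refine ⟨C₀ * (1 + c) + C₀ * Real.sqrt (1 + c), by positivity, fun dA dB S hS hcomm => ?_⟩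
  obtain ⟨T, ⟨σ⟩⟩ := exists_schmidt (stateMatrix S.ψ)
  set x := 1 - G.value S with hx
  have hx0 : 0 ≤ x := sub_nonneg.2 (G.value_le_one S)
  have hx1 : x ≤ 1 := by linarith [G.value_nonneg S]
  have hxs : x ≤ Real.sqrt x := Real.le_sqrt_of_sq_le (by nlinarith)
  have hs0 := Real.sqrt_nonneg x
  -- The bound `M = (1 + c)√x` must dominate both the commutators `c√x` and the loss `x`, and `x ≤
  -- √x`.
  obtain ⟨r, S', hS', hme, hval, hclose⟩ := h dA dB S hS T σ _ (hcomm T σ).1 (hcomm T σ).2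
    ((1 + c) * Real.sqrt x) (by nlinarith) (by nlinarith [mul_nonneg hc hs0])
  refine ⟨r, S', hS', hme, fun ε p hε hp hp2 => ?_⟩
  have hxε : x ≤ ε := by unfold NonlocalGame.IsPerfectUpTo at hε; linarith
  have hε0 : 0 ≤ ε := hx0.trans hxε
  constructor
  · have h1 : Real.sqrt x ≤ ε ^ p := by
      rw [Real.sqrt_eq_rpow]; exact rpow_le_rpow_of_le_one hx0 hx1 hxε hp hp2
    have h2 : C₀ * ((1 + c) * Real.sqrt x) ≤
        (C₀ * (1 + c) + C₀ * Real.sqrt (1 + c)) * ε ^ p := by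
      have : 0 ≤ C₀ * Real.sqrt (1 + c) * ε ^ p := by positivity
      have h3 := mul_le_mul_of_nonneg_left h1 (by positivity : 0 ≤ C₀ * (1 + c))
      linarith
    have := G.quantumValue_le_one
    unfold NonlocalGame.IsOptimalUpTo
    linarith
  · refine hclose.mono ?_
    rw [sqrt_mul_sqrt_eq (by positivity) hx0]
    have h1 : x ^ (1 / 4 : ℝ) ≤ ε ^ (p / 2) :=
      rpow_le_rpow_of_le_one hx0 hx1 hxε (by positivity) (by linarith)
    have : 0 ≤ C₀ * (1 + c) * ε ^ (p / 2) := by positivity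
    have h3 := mul_le_mul_of_nonneg_left h1 (by positivity : 0 ≤ C₀ * Real.sqrt (1 + c))
    linarith

theorem four_mul_le_of_sq_le {y x η c : ℝ} (h : y ^ 2 ≤ x / η)
    (hc : 4 * (Real.sqrt η)⁻¹ ≤ c) (hη : 0 ≤ η) : 4 * y ≤ c * Real.sqrt x := by
  have h1 : y ≤ Real.sqrt x / Real.sqrt η := by
    rw [← Real.sqrt_div' _ hη]; exact Real.le_sqrt_of_sq_le h
  have h2 := mul_le_mul_of_nonneg_right hc (Real.sqrt_nonneg x)
  rw [div_eq_mul_inv] at h1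
  linarith

/-- Rounding for synchronous games. -/
theorem NonlocalGame.IsSynchronous.exists_rounding {I : Type u} {A : Type w} [Fintype I] [Fintype A]
    {G : NonlocalGame (fun _ : I => A) (fun _ : I => A)} (hG : G.IsSynchronous)
    (hη : ∀ i, 0 < G.η i i) :
    ∃ C : ℝ, 0 < C ∧ ∀ (dA dB : ℕ) (S : QStrategy (fun _ : I => A) (fun _ : I => A) dA dB),
      S.IsProjective →
      ∃ (r : ℕ) (S' : QStrategy (fun _ : I => A) (fun _ : I => A) r r),
        S'.IsProjective ∧ IsMaximallyEntangled S'.ψ ∧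
        ∀ ε p : ℝ, G.IsPerfectUpTo ε S → 0 ≤ p → p ≤ 1 / 2 →
          G.IsOptimalUpTo (C * ε ^ p) S' ∧ S.IsCloseOnSupport S' (C * ε ^ (p / 2)) := by
  classical
  set c : ℝ := ∑ i, 4 * (Real.sqrt (G.η i i))⁻¹ with hc
  have hci : ∀ i, 4 * (Real.sqrt (G.η i i))⁻¹ ≤ c := fun i =>
    Finset.single_le_sum (f := fun i => 4 * (Real.sqrt (G.η i i))⁻¹) (fun i _ => by positivity)
      (Finset.mem_univ i)
  obtain ⟨C, hC, h⟩ := G.exists_rounding (c := c) (Finset.sum_nonneg fun i _ => by positivity)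
  refine ⟨C, hC, fun dA dB S hS => h dA dB S hS fun T σ => ?_⟩
  have key : ∀ i a, 4 * fro (S.E i a * stateMatrix S.ψ - stateMatrix S.ψ * (S.F i a)ᵀ) ≤
      c * Real.sqrt (1 - G.value S) := fun i a => by
    have := G.fro_sub_sq_le S hS i i (hη i) {a} {a} (fun x y hxy => hG i x y (fun e => hxy (by
      simp [e])))
    rw [Finset.sum_singleton, Finset.sum_singleton] at this
    exact four_mul_le_of_sq_le this (hci i) (hη i).le
  exact ⟨fun i a => (σ.fro_commutator_abs_le (hS.1 i a).isHermitian
      (hS.2 i a).transpose.isHermitian).trans (key i a),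
    fun i a => (σ.fro_commutator_abs_symm_le (hS.1 i a).isHermitian
      (hS.2 i a).transpose.isHermitian).trans (key i a)⟩

theorem fro_commutator_mul_le {n : Type*} [Fintype n] [DecidableEq n] {X Y : Matrix n n ℂ}
    (hX : ‖X‖ ≤ 1) (hY : ‖Y‖ ≤ 1) (H : Matrix n n ℂ) :
    fro (X * Y * H - H * (X * Y)) ≤ fro (X * H - H * X) + fro (Y * H - H * Y) := by
  have : X * Y * H - H * (X * Y) = (X * H - H * X) * Y + X * (Y * H - H * Y) := by noncomm_ring
  rw [this]
  exact (fro_add_le _ _).trans (add_le_add (fro_mul_le_of_norm_le_one' _ hY)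
    (fro_mul_le_of_norm_le_one hX _))

/-- The projection onto an assignment is the product of the projections onto its values, so it
almost commutes with whatever these almost commute with. -/
theorem fro_commutator_assignment_le {ι β n : Type*} [Fintype ι] [DecidableEq ι]
    [DecidableEq β] [Fintype n] [DecidableEq n] {p : (ι → β) → Prop} [Fintype {φ // p φ}]
    {E : {φ : ι → β // p φ} → Matrix n n ℂ}
    (hE : ∀ a, IsStarProjection (E a)) (hsum : ∑ a, E a = 1) (H : Matrix n n ℂ) {δ : ℝ}
    (hδ : ∀ k b, fro ((∑ φ with φ.1 k = b, E φ) * H - H * ∑ φ with φ.1 k = b, E φ) ≤ δ)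
    (φ : {φ : ι → β // p φ}) : fro (E φ * H - H * E φ) ≤ Fintype.card ι * δ := by
  classical
  have key : ∀ s : Finset ι, fro ((∑ χ with ∀ k ∈ s, χ.1 k = φ.1 k, E χ) * H -
      H * ∑ χ with ∀ k ∈ s, χ.1 k = φ.1 k, E χ) ≤ s.card * δ := by
    intro s
    induction s using Finset.induction_on with
    | empty => simp [hsum, fro_zero]
    | insert k s hk ih =>
      have e : ∑ χ with ∀ l ∈ insert k s, χ.1 l = φ.1 l, E χ =
          (∑ χ with χ.1 k = φ.1 k, E χ) * ∑ χ with ∀ l ∈ s, χ.1 l = φ.1 l, E χ := by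
        rw [sum_mul_sum_of_projective hE hsum, ← Finset.filter_and]
        refine Finset.sum_congr (Finset.filter_congr fun χ _ => ?_) fun _ _ => rfl
        rw [Finset.forall_mem_insert]
      rw [e, Finset.card_insert_of_notMem hk]
      refine (fro_commutator_mul_le (isStarProjection_sum_of_projective hE hsum _).matrix_norm_le_one
        (isStarProjection_sum_of_projective hE hsum _).matrix_norm_le_one H).trans ?_
      have := hδ k (φ.1 k)
      push_cast
      linarith
  have h := key Finset.univ
  have e : (Finset.univ.filter fun χ : {φ : ι → β // p φ} => ∀ k ∈ Finset.univ, χ.1 k = φ.1 k)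
      = {φ} := by
    ext χ
    simp only [Finset.mem_filter, Finset.mem_univ, true_and, Finset.mem_singleton, forall_true_left]
    exact ⟨fun h => Subtype.ext (funext h), fun h k => by rw [h]⟩
  rw [e, Finset.sum_singleton, Finset.card_univ] at h
  exact h

/-- Rounding for binary constraint system games. -/
theorem BinaryConstraintSystem.exists_rounding {m n : ℕ} (B : BinaryConstraintSystem m n)
    (η : Fin m → Fin n → ℝ) (η_nonneg : ∀ i j, 0 ≤ η i j) (η_sum : ∑ i, ∑ j, η i j = 1)
    (hη : ∀ i, ∀ j ∈ B.K i, 0 < η i j) (hK : ∀ j, ∃ i, j ∈ B.K i) :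
    ∃ C : ℝ, 0 < C ∧ ∀ (dA dB : ℕ) (S : QStrategy B.Answer (fun _ : Fin n => ℤˣ) dA dB),
      S.IsProjective →
      ∃ (r : ℕ) (S' : QStrategy B.Answer (fun _ : Fin n => ℤˣ) r r),
        S'.IsProjective ∧ IsMaximallyEntangled S'.ψ ∧
        ∀ ε p : ℝ, (B.game η η_nonneg η_sum).IsPerfectUpTo ε S → 0 ≤ p → p ≤ 1 / 2 →
          (B.game η η_nonneg η_sum).IsOptimalUpTo (C * ε ^ p) S' ∧
            S.IsCloseOnSupport S' (C * ε ^ (p / 2)) := by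
  classical
  set G := B.game η η_nonneg η_sum with hGdef
  set c : ℝ := ∑ i, ∑ j, 4 * (Real.sqrt (η i j))⁻¹ with hc
  have hc0 : 0 ≤ c := Finset.sum_nonneg fun i _ => Finset.sum_nonneg fun j _ => by positivity
  have hci : ∀ i j, 4 * (Real.sqrt (η i j))⁻¹ ≤ c := fun i j =>
    (Finset.single_le_sum (f := fun j => 4 * (Real.sqrt (η i j))⁻¹) (fun j _ => by positivity)
      (Finset.mem_univ j)).trans
    (Finset.single_le_sum (f := fun i => ∑ j, 4 * (Real.sqrt (η i j))⁻¹)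
      (fun i _ => Finset.sum_nonneg fun j _ => by positivity) (Finset.mem_univ i))
  -- An assignment projection is a product of at most `n` marginal projections, each costing `c`;
  -- the extra `1` covers Bob's projections when `n` is replaced by `n + 1`.
  obtain ⟨C, hC, h⟩ := G.exists_rounding (c := (n + 1) * c) (by positivity)
  refine ⟨C, hC, fun dA dB S hS => h dA dB S hS fun T σ => ?_⟩
  set y := Real.sqrt (1 - G.value S) with hy
  have hy0 : 0 ≤ y := Real.sqrt_nonneg _
  have hcy : 0 ≤ c * y := mul_nonneg hc0 hy0
  have hherm : ∀ i (k : B.K i) (b : ℤˣ), (∑ φ with φ.1 k = b, S.E i φ).IsHermitian := fun i k b =>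
    (isStarProjection_sum_of_projective (hS.1 i) (S.E_sum i) _).isHermitian
  have key : ∀ i (k : B.K i) (b : ℤˣ), 4 * fro ((∑ φ with φ.1 k = b, S.E i φ) *
      stateMatrix S.ψ - stateMatrix S.ψ * (S.F k b)ᵀ) ≤ c * y := fun i k b => by
    -- Alice's marginal event that variable `k` has value `b` is compared with Bob's answer `b`; if
    -- exactly one occurs, the players lose.
    have := G.fro_sub_sq_le S hS i k (hη i k k.2) (Finset.univ.filter fun φ => φ.1 k = b) {b}
      (fun φ b' hxy => by
        simp only [hGdef, BinaryConstraintSystem.game, decide_eq_false_iff_not]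
        intro hV
        have := hV k.2
        simp only [Finset.mem_filter, Finset.mem_univ, true_and, Finset.mem_singleton] at hxy
        exact hxy (by rw [← this]))
    rw [Finset.sum_singleton] at this
    exact four_mul_le_of_sq_le this (hci i k) (η_nonneg i k)
  constructor
  · intro i φ
    refine (fro_commutator_assignment_le (hS.1 i) (S.E_sum i) σ.abs (δ := c * y) (fun k b => ?_)
      φ).trans ?_
    · exact (σ.fro_commutator_abs_le (hherm i k b) (hS.2 k b).transpose.isHermitian).trans (key i k b)
    · have : (Fintype.card (B.K i) : ℝ) ≤ n := by
        rw [Fintype.card_coe]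
        exact_mod_cast (Finset.card_le_univ (B.K i)).trans_eq (Fintype.card_fin n)
      have := mul_le_mul_of_nonneg_right this hcy
      linarith
  · intro j b
    obtain ⟨i, hi⟩ := hK j
    refine ((σ.fro_commutator_abs_symm_le (hherm i ⟨j, hi⟩ b)
      (hS.2 j b).transpose.isHermitian).trans (key i ⟨j, hi⟩ b)).trans ?_
    have : 0 ≤ (n : ℝ) * (c * y) := by positivity
    linarith

end PerfectGames

/-! ### Anticommuting matrices -/

section Clifford

/-- Doubling: the swap of two copies of the space anticommutes with every `γ k ⊕ -γ k`. All matrices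
stay symmetric, so the transpose on Bob's side is harmless. -/
theorem exists_clifford_fin (N : ℕ) : ∃ (S : Type) (_ : Fintype S) (_ : DecidableEq S)
    (_ : Nonempty S) (γ : Fin N → Matrix S S ℂ), (∀ k, (γ k).IsHermitian) ∧ (∀ k, (γ k)ᵀ = γ k) ∧
      (∀ k, γ k * γ k = 1) ∧ ∀ k l, k ≠ l → γ k * γ l = -(γ l * γ k) := by
  induction N with
  | zero => exact ⟨Unit, inferInstance, inferInstance, inferInstance, fun k => k.elim0,
      fun k => k.elim0, fun k => k.elim0, fun k => k.elim0, fun k => k.elim0⟩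
  | succ N ih =>
    obtain ⟨S, _, _, _, γ, h1, h2, h3, h4⟩ := ih
    refine ⟨S ⊕ S, inferInstance, inferInstance, inferInstance,
      Fin.cases (Matrix.fromBlocks 0 1 1 0) (fun k => Matrix.fromBlocks (γ k) 0 0 (-γ k)),
      fun k => ?_, fun k => ?_, fun k => ?_, fun k l hkl => ?_⟩
    · refine Fin.cases ?_ (fun k => ?_) k
      · simp [Matrix.IsHermitian, Matrix.fromBlocks_conjTranspose]
      · simp [Matrix.IsHermitian, Matrix.fromBlocks_conjTranspose, (h1 k).eq]
    · refine Fin.cases ?_ (fun k => ?_) k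
      · simp [Matrix.fromBlocks_transpose]
      · simp [Matrix.fromBlocks_transpose, h2 k]
    · refine Fin.cases ?_ (fun k => ?_) k
      · simp [Matrix.fromBlocks_multiply]
      · simp [Matrix.fromBlocks_multiply, h3 k]
    · revert hkl
      refine Fin.cases ?_ (fun k => ?_) k <;> refine Fin.cases ?_ (fun l => ?_) l <;> intro hkl
      · exact absurd rfl hkl
      · simp [Matrix.fromBlocks_multiply, Matrix.fromBlocks_neg]
      · simp [Matrix.fromBlocks_multiply, Matrix.fromBlocks_neg]
      · have := h4 k l (fun h => hkl (by rw [h]))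
        simp [Matrix.fromBlocks_multiply, Matrix.fromBlocks_neg, this]

/-- Anticommuting real symmetric self-adjoint unitaries, indexed by any finite type. -/
theorem exists_clifford (ι : Type*) [Fintype ι] : ∃ (r : ℕ) (_ : 0 < r)
    (γ : ι → Matrix (Fin r) (Fin r) ℂ), (∀ k, (γ k).IsHermitian) ∧ (∀ k, (γ k)ᵀ = γ k) ∧
      (∀ k, γ k * γ k = 1) ∧ ∀ k l, k ≠ l → γ k * γ l = -(γ l * γ k) := by
  obtain ⟨S, _, _, _, γ, h1, h2, h3, h4⟩ := exists_clifford_fin (Fintype.card ι)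
  let e : Fin (Fintype.card S) ≃ S := (Fintype.equivFin S).symm
  let f : ι ≃ Fin (Fintype.card ι) := Fintype.equivFin ι
  refine ⟨Fintype.card S, Fintype.card_pos, fun k => (γ (f k)).submatrix e e,
    fun k => (h1 _).submatrix e, fun k => ?_, fun k => ?_, fun k l hkl => ?_⟩
  · rw [Matrix.transpose_submatrix, h2]
  · rw [Matrix.submatrix_mul_equiv, h3, Matrix.submatrix_one_equiv]
  · rw [Matrix.submatrix_mul_equiv, Matrix.submatrix_mul_equiv, h4 _ _ (f.injective.ne hkl)]
    rfl

end Clifford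

/-! ### Tsirelson's theorem -/

section Tsirelson

variable {m n : ℕ} (G : XORGame m n)

theorem XORGame.abs_cost (i : Fin m) (j : Fin n) : |G.cost i j| = G.prob i j := by
  rw [XORGame.cost, abs_mul, abs_pow, abs_neg, abs_one, one_pow, one_mul,
    abs_of_nonneg (G.prob_nonneg i j)]

theorem XORGame.sum_abs_cost : ∑ i, ∑ j, |G.cost i j| = 1 := by
  simp only [G.abs_cost, G.prob_sum]

theorem XORGame.abs_bias_le_one {dA dB : ℕ} (S : XORStrategy m n dA dB) : |G.bias S| ≤ 1 := by
  rw [XORGame.bias, ← G.sum_abs_cost]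
  refine (Finset.abs_sum_le_sum_abs _ _).trans (Finset.sum_le_sum fun i _ => ?_)
  refine (Finset.abs_sum_le_sum_abs _ _).trans (Finset.sum_le_sum fun j _ => ?_)
  rw [abs_mul]
  refine mul_le_of_le_one_right (abs_nonneg _) ?_
  have hY := norm_le_one_of_sq_eq_one (S.Y_selfAdjoint i) (S.Y_sq i)
  have hX : ‖(S.X j)ᵀ‖ ≤ 1 := norm_le_one_of_sq_eq_one (S.X_selfAdjoint j).transpose
    (by rw [← Matrix.transpose_mul, S.X_sq, Matrix.transpose_one])
  rw [expectation_eq_trace, Matrix.mul_assoc, Matrix.mul_assoc]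
  refine (abs_trace_mul_le _ _).trans ?_
  rw [fro_conjTranspose, fro_stateMatrix S.ψ_unit, one_mul, ← fro_stateMatrix S.ψ_unit]
  exact (fro_mul_le_of_norm_le_one hY _).trans (fro_mul_le_of_norm_le_one' _ hX)

theorem XORGame.bias_le_optimalBias {dA dB : ℕ} (S : XORStrategy m n dA dB) :
    G.bias S ≤ G.optimalBias := by
  refine le_csSup ⟨1, ?_⟩ ⟨dA, dB, S, rfl⟩
  rintro _ ⟨dA, dB, S, rfl⟩
  exact (abs_le.1 (G.abs_bias_le_one S)).2

theorem XORGame.optimalBias_le_one : G.optimalBias ≤ 1 :=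
  Real.sSup_le (by rintro _ ⟨dA, dB, S, rfl⟩; exact (abs_le.1 (G.abs_bias_le_one S)).2) zero_le_one

/-- Adding the double sum to its transpose cancels all cross terms by anticommutation. Unit vectors
thus become self-adjoint unitaries. -/
theorem clifford_sum_mul_self {ι : Type*} [Fintype ι] {r : ℕ} {γ : ι → Matrix (Fin r) (Fin r) ℂ}
    (h3 : ∀ k, γ k * γ k = 1) (h4 : ∀ k l, k ≠ l → γ k * γ l = -(γ l * γ k)) (y : ι → ℝ) :
    (∑ k, (y k : ℂ) • γ k) * (∑ k, (y k : ℂ) • γ k) = ((∑ k, y k ^ 2 : ℝ) : ℂ) • 1 := by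
  classical
  have e1 : (∑ k, (y k : ℂ) • γ k) * (∑ k, (y k : ℂ) • γ k)
      = ∑ k, ∑ l, ((y k : ℂ) * y l) • (γ k * γ l) := by
    rw [Finset.sum_mul_sum]
    refine Finset.sum_congr rfl fun k _ => Finset.sum_congr rfl fun l _ => ?_
    rw [Matrix.smul_mul, Matrix.mul_smul, smul_smul]
  have e2 : ∑ k, ∑ l, ((y k : ℂ) * y l) • (γ k * γ l)
      = ∑ k, ∑ l, ((y k : ℂ) * y l) • (γ l * γ k) := by
    rw [Finset.sum_comm]
    exact Finset.sum_congr rfl fun k _ => Finset.sum_congr rfl fun l _ => by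
      rw [mul_comm (y l : ℂ)]
  have e3 : (2 : ℂ) • ∑ k, ∑ l, ((y k : ℂ) * y l) • (γ k * γ l)
      = (2 : ℂ) • (((∑ k, y k ^ 2 : ℝ) : ℂ) • (1 : Matrix (Fin r) (Fin r) ℂ)) := by
    rw [two_smul]
    nth_rw 2 [e2]
    rw [← Finset.sum_add_distrib, Complex.ofReal_sum, Finset.sum_smul, Finset.smul_sum]
    refine Finset.sum_congr rfl fun k _ => ?_
    rw [← Finset.sum_add_distrib, Finset.sum_eq_single k]
    · rw [h3, two_smul]; push_cast; rw [sq]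
    · intro l _ hlk
      rw [h4 k l hlk.symm, smul_neg, neg_add_cancel]
    · simp
  rw [e1]
  exact smul_right_injective _ (two_ne_zero : (2 : ℂ) ≠ 0) e3

theorem clifford_trace {ι : Type*} [Fintype ι] {r : ℕ} {γ : ι → Matrix (Fin r) (Fin r) ℂ}
    (h3 : ∀ k, γ k * γ k = 1) (h4 : ∀ k l, k ≠ l → γ k * γ l = -(γ l * γ k)) (y x : ι → ℝ) :
    ((∑ k, (y k : ℂ) • γ k) * (∑ k, (x k : ℂ) • γ k)).trace = ((r * ∑ k, y k * x k : ℝ) : ℂ) := by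
  classical
  have ht : ∀ k l, (γ k * γ l).trace = if k = l then (r : ℂ) else 0 := by
    intro k l
    split_ifs with h
    · rw [h, h3]; simp
    · have h5 := congrArg Matrix.trace (h4 k l h)
      rw [Matrix.trace_neg, Matrix.trace_mul_comm (γ l)] at h5
      exact self_eq_neg.1 h5
  rw [Finset.sum_mul_sum, Matrix.trace_sum]
  simp only [Matrix.smul_mul, Matrix.mul_smul, smul_smul, Matrix.trace_sum, Matrix.trace_smul, ht,
    smul_eq_mul, mul_ite, mul_zero, Finset.sum_ite_eq, Finset.mem_univ, if_true]
  push_cast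
  rw [Finset.mul_sum]
  exact Finset.sum_congr rfl fun k _ => by ring

theorem clifford_isHermitian {ι : Type*} [Fintype ι] {r : ℕ} {γ : ι → Matrix (Fin r) (Fin r) ℂ}
    (h1 : ∀ k, (γ k).IsHermitian) (y : ι → ℝ) : (∑ k, (y k : ℂ) • γ k).IsHermitian := by
  rw [Matrix.IsHermitian, Matrix.conjTranspose_sum]
  refine Finset.sum_congr rfl fun k _ => ?_
  rw [Matrix.conjTranspose_smul, (h1 k).eq, Complex.star_def, Complex.conj_ofReal]

/-- Tsirelson's theorem for unit vectors. -/
theorem XORGame.sum_unit_le_optimalBias {ι : Type*} [Fintype ι] (y : Fin m → ι → ℝ)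
    (x : Fin n → ι → ℝ) (hy : ∀ i, ∑ k, y i k ^ 2 = 1) (hx : ∀ j, ∑ k, x j k ^ 2 = 1) :
    ∑ i, ∑ j, G.cost i j * ∑ k, y i k * x j k ≤ G.optimalBias := by
  obtain ⟨r, hr, γ, h1, h2, h3, h4⟩ := exists_clifford ι
  let S : XORStrategy m n r r :=
    { Y := fun i => ∑ k, (y i k : ℂ) • γ k
      X := fun j => ∑ k, (x j k : ℂ) • γ k
      Y_selfAdjoint := fun i => clifford_isHermitian h1 _
      X_selfAdjoint := fun j => clifford_isHermitian h1 _
      Y_sq := fun i => by rw [clifford_sum_mul_self h3 h4, hy]; simp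
      X_sq := fun j => by rw [clifford_sum_mul_self h3 h4, hx]; simp
      ψ := maxEntangledState r
      ψ_unit := maxEntangledState_unit hr }
  refine le_of_eq_of_le ?_ (G.bias_le_optimalBias S)
  refine Finset.sum_congr rfl fun i _ => Finset.sum_congr rfl fun j _ => ?_
  have ht : (∑ k, (x j k : ℂ) • γ k)ᵀ = ∑ k, (x j k : ℂ) • γ k := by
    rw [Matrix.transpose_sum]
    exact Finset.sum_congr rfl fun k _ => by rw [Matrix.transpose_smul, h2]
  have hr' : (r : ℝ) ≠ 0 := by exact_mod_cast hr.ne'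
  simp only [S]
  rw [expectation_maxEntangledState, ht, clifford_trace h3 h4, Complex.ofReal_re,
    mul_div_cancel_left₀ _ hr']

/-- `β` bounds the value of every vector configuration of the bilinear game `g`. -/
def BoundsVectors {I J : Type} [Fintype I] [Fintype J] (g : I → J → ℝ) (β : ℝ) : Prop :=
  ∀ (V : Type) [NormedAddCommGroup V] [InnerProductSpace ℝ V] [FiniteDimensional ℝ V]
    (y : I → V) (x : J → V), (∀ i, ‖y i‖ ≤ 1) → (∀ j, ‖x j‖ ≤ 1) →
    ∑ i, ∑ j, g i j * inner ℝ (y i) (x j) ≤ β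

theorem BoundsVectors.swap {I J : Type} [Fintype I] [Fintype J] {g : I → J → ℝ} {β : ℝ}
    (h : BoundsVectors g β) : BoundsVectors (fun j i => g i j) β := by
  intro V _ _ _ y x hy hx
  refine le_of_eq_of_le ?_ (h V x y hx hy)
  rw [Finset.sum_comm]
  simp only [real_inner_comm]

/-- Tsirelson's theorem. -/
theorem XORGame.boundsVectors : BoundsVectors G.cost G.optimalBias := by
  intro V _ _ _ y x hy hx
  let b := stdOrthonormalBasis ℝ V
  have hn : ∀ v : V, ∑ k, (inner ℝ (b k) v) ^ 2 = ‖v‖ ^ 2 := fun v => by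
    rw [← b.sum_sq_norm_inner_right v]
    simp [sq_abs]
  -- Vectors in the unit ball are padded to unit vectors. Alice and Bob use different extra
  -- coordinates, so no inner product changes.
  have h := G.sum_unit_le_optimalBias (ι := Fin (Module.finrank ℝ V) ⊕ Bool)
    (fun i => Sum.elim (fun k => inner ℝ (b k) (y i))
      (fun t => if t = true then Real.sqrt (1 - ‖y i‖ ^ 2) else 0))
    (fun j => Sum.elim (fun k => inner ℝ (b k) (x j))
      (fun t => if t = true then 0 else Real.sqrt (1 - ‖x j‖ ^ 2)))
    (fun i => by
      have : 0 ≤ 1 - ‖y i‖ ^ 2 := by nlinarith [hy i, norm_nonneg (y i)]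
      simp [hn, Real.sq_sqrt this])
    (fun j => by
      have : 0 ≤ 1 - ‖x j‖ ^ 2 := by nlinarith [hx j, norm_nonneg (x j)]
      simp [hn, Real.sq_sqrt this])
  refine le_of_eq_of_le ?_ h
  refine Finset.sum_congr rfl fun i _ => Finset.sum_congr rfl fun j _ => ?_
  rw [← b.sum_inner_mul_inner (y i) (x j)]
  simp [real_inner_comm]

end Tsirelson

/-! ### Rigidity of near-optimal vector configurations -/

section NearOptimalVectors

variable {I J : Type} [Fintype I] [Fintype J] {g : I → J → ℝ} {β : ℝ} {V : Type}
  [NormedAddCommGroup V] [InnerProductSpace ℝ V] [FiniteDimensional ℝ V]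

/-- Replacing `y i` by the best response `w / ‖w‖` raises the value by exactly the left side, and
the new value is still at most `β`. -/
theorem BoundsVectors.norm_sub_inner_le (hβ : BoundsVectors g β) {y : I → V} {x : J → V}
    (hy : ∀ i, ‖y i‖ ≤ 1) (hx : ∀ j, ‖x j‖ ≤ 1) (i : I) :
    ‖∑ j, g i j • x j‖ - inner ℝ (y i) (∑ j, g i j • x j) ≤
      β - ∑ i, ∑ j, g i j * inner ℝ (y i) (x j) := by
  classical
  set w := ∑ j, g i j • x j with hw
  have hin : ∀ z : I → V, ∑ j, g i j * inner ℝ (z i) (x j) = inner ℝ (z i) w := fun z => by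
    rw [hw, inner_sum]
    exact Finset.sum_congr rfl fun j _ => by rw [inner_smul_right]
  let y' : I → V := Function.update y i (‖w‖⁻¹ • w)
  have hy' : ∀ k, ‖y' k‖ ≤ 1 := fun k => by
    by_cases h : k = i
    · subst h
      simp only [y', Function.update_self, norm_smul, norm_inv, norm_norm]
      exact inv_mul_le_one_of_le₀ le_rfl (norm_nonneg _)
    · simp only [y', Function.update_of_ne h]; exact hy k
  have h := hβ V y' x hy' hx
  rw [← Finset.add_sum_erase _ _ (Finset.mem_univ i)] at h ⊢
  have e1 : ∑ k ∈ Finset.univ.erase i, ∑ j, g k j * inner ℝ (y' k) (x j)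
      = ∑ k ∈ Finset.univ.erase i, ∑ j, g k j * inner ℝ (y k) (x j) :=
    Finset.sum_congr rfl fun k hk => by
      simp only [y', Function.update_of_ne (Finset.ne_of_mem_erase hk)]
  have e2 : inner ℝ (y' i) w = ‖w‖ := by
    simp only [y', Function.update_self, real_inner_smul_left, real_inner_self_eq_norm_sq]
    rcases eq_or_ne ‖w‖ 0 with h0 | h0
    · simp [h0]
    · field_simp
  rw [e1, hin, e2] at h
  rw [hin]
  linarith

/-- If `w` were tiny, `y i` would be nearly idle and could be turned into a new orthogonal
direction, towards which `x j` is tilted by `s`. The gain is `|g i j| s`; the cost is at most `‖w‖`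
for giving up `y i` and `1 - c ≤ s²` for shortening `x j`. -/
theorem BoundsVectors.le_norm_sum (hβ : BoundsVectors g β) (hg : ∑ i, ∑ j, |g i j| ≤ 1)
    {y : I → V} {x : J → V} (hy : ∀ i, ‖y i‖ ≤ 1) (hx : ∀ j, ‖x j‖ ≤ 1) (i : I) (j : J) :
    g i j ^ 2 / 4 ≤ ‖∑ j, g i j • x j‖ + (β - ∑ i, ∑ j, g i j * inner ℝ (y i) (x j)) := by
  classical
  have hgij : |g i j| ≤ 1 :=
    ((Finset.single_le_sum (f := fun j => |g i j|) (fun j _ => abs_nonneg _)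
      (Finset.mem_univ j)).trans (Finset.single_le_sum (f := fun i => ∑ j, |g i j|)
      (fun i _ => Finset.sum_nonneg fun j _ => abs_nonneg _) (Finset.mem_univ i))).trans hg
  set w := ∑ j, g i j • x j with hw
  -- This choice maximises `|g i j| s - s²`, with maximum `g i j ^ 2 / 4`.
  set s := |g i j| / 2 with hs
  have hs0 : 0 ≤ s := by positivity
  have hs1 : s ^ 2 ≤ 1 := by nlinarith
  set c := Real.sqrt (1 - s ^ 2) with hc
  have hc2 : c ^ 2 = 1 - s ^ 2 := Real.sq_sqrt (by linarith)
  have hc0 : 0 ≤ c := Real.sqrt_nonneg _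
  have hc1 : c ≤ 1 := by nlinarith
  have hcs : 1 - c ≤ s ^ 2 := by nlinarith
  obtain ⟨τ, hτ, hτg⟩ : ∃ τ : ℝ, |τ| ≤ 1 ∧ g i j * τ = |g i j| := by
    rcases le_total 0 (g i j) with h | h
    · exact ⟨1, by simp, by rw [mul_one, abs_of_nonneg h]⟩
    · exact ⟨-1, by simp, by rw [abs_of_nonpos h]; ring⟩
  let y' : I → WithLp 2 (V × ℝ) := fun k =>
    if k = i then WithLp.toLp 2 (0, τ) else WithLp.toLp 2 (y k, 0)
  let x' : J → WithLp 2 (V × ℝ) := fun l =>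
    if l = j then WithLp.toLp 2 (c • x j, s) else WithLp.toLp 2 (x l, 0)
  have hnorm : ∀ (v : V) (t : ℝ), ‖v‖ ^ 2 + t ^ 2 ≤ 1 → ‖WithLp.toLp 2 (v, t)‖ ≤ 1 := by
    intro v t h
    rw [← sq_le_one_iff₀ (norm_nonneg _), WithLp.prod_norm_sq_eq_of_L2]
    simpa [sq_abs] using h
  have hy' : ∀ k, ‖y' k‖ ≤ 1 := fun k => by
    simp only [y']
    split_ifs
    · apply hnorm; nlinarith [abs_le.1 hτ, norm_zero (E := V)]
    · apply hnorm; nlinarith [hy k, norm_nonneg (y k)]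
  have hx' : ∀ l, ‖x' l‖ ≤ 1 := fun l => by
    simp only [x']
    split_ifs
    · apply hnorm
      rw [norm_smul, mul_pow, Real.norm_eq_abs, sq_abs, hc2]
      have : ‖x j‖ ^ 2 ≤ 1 := by nlinarith [hx j, norm_nonneg (x j)]
      nlinarith
    · apply hnorm; nlinarith [hx l, norm_nonneg (x l)]
  have h := hβ (WithLp 2 (V × ℝ)) y' x' hy' hx'
  have hterm : ∀ k l, (if k = i then 0 else g k l * inner ℝ (y k) (x l))
      - (if l = j then (1 - c) * |g k l| else 0) + (if k = i then if l = j then |g i j| * s else 0 else 0)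
      ≤ g k l * inner ℝ (y' k) (x' l) := by
    intro k l
    by_cases hk : k = i
    · subst hk
      by_cases hl : l = j
      · subst hl
        simp only [y', x', if_true, WithLp.prod_inner_apply, inner_zero_left, zero_add]
        have : inner ℝ τ s = τ * s := by simp [mul_comm]
        rw [this, ← mul_assoc, hτg]
        nlinarith [mul_nonneg (sub_nonneg.2 hc1) (abs_nonneg (g k l))]
      · simp [y', x', hl, WithLp.prod_inner_apply]
    · by_cases hl : l = j
      · subst hl
        simp only [y', x', hk, if_true, if_false, WithLp.prod_inner_apply, inner_zero_left, add_zero,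
          inner_smul_right]
        have h1 : |inner ℝ (y k) (x l)| ≤ 1 :=
          (abs_real_inner_le_norm _ _).trans (mul_le_one₀ (hy k) (norm_nonneg _) (hx l))
        have h2 : g k l * inner ℝ (y k) (x l) ≤ |g k l| := by
          refine (le_abs_self _).trans ?_
          rw [abs_mul]
          exact mul_le_of_le_one_right (abs_nonneg _) h1
        nlinarith [mul_le_mul_of_nonneg_left h2 (sub_nonneg.2 hc1)]
      · simp [y', x', hk, hl, WithLp.prod_inner_apply]
  have hsum := (Finset.sum_le_sum fun k _ => Finset.sum_le_sum fun l _ => hterm k l).trans h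
  simp only [Finset.sum_add_distrib, Finset.sum_sub_distrib] at hsum
  have s1 : ∑ k, ∑ l, (if k = i then 0 else g k l * inner ℝ (y k) (x l))
      = ∑ k, ∑ l, g k l * inner ℝ (y k) (x l) - inner ℝ (y i) w := by
    have : inner ℝ (y i) w = ∑ l, g i l * inner ℝ (y i) (x l) := by
      rw [hw, inner_sum]
      exact Finset.sum_congr rfl fun j _ => by rw [inner_smul_right]
    rw [this, ← Finset.add_sum_erase _ _ (Finset.mem_univ i),
      ← Finset.add_sum_erase (a := i) Finset.univ (fun k => ∑ l, g k l * inner ℝ (y k) (x l))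
        (Finset.mem_univ i)]
    simp only [if_true, Finset.sum_const_zero, zero_add, add_sub_cancel_left]
    exact Finset.sum_congr rfl fun k hk => by simp [Finset.ne_of_mem_erase hk]
  have s2 : ∑ k, ∑ l, (if l = j then (1 - c) * |g k l| else 0) ≤ 1 - c := by
    calc _ ≤ ∑ k, ∑ l, (1 - c) * |g k l| := by
          refine Finset.sum_le_sum fun k _ => Finset.sum_le_sum fun l _ => ?_
          have := mul_nonneg (sub_nonneg.2 hc1) (abs_nonneg (g k l))
          split_ifs <;> linarith
      _ = (1 - c) * ∑ k, ∑ l, |g k l| := by simp only [Finset.mul_sum]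
      _ ≤ _ := mul_le_of_le_one_right (sub_nonneg.2 hc1) hg
  have s3 : ∑ k, ∑ l, (if k = i then if l = j then |g i j| * s else 0 else 0) = |g i j| * s := by
    rw [Finset.sum_eq_single i (fun k _ hk => by simp [hk]) (by simp)]
    simp
  rw [s1, s3] at hsum
  have h5 : inner ℝ (y i) w ≤ ‖w‖ := (real_inner_le_norm _ _).trans
    (mul_le_of_le_one_left (norm_nonneg _) (hy i))
  have h6 : |g i j| * s = g i j ^ 2 / 2 := by rw [hs, ← sq_abs (g i j)]; ring
  have h7 : s ^ 2 = g i j ^ 2 / 4 := by rw [hs, ← sq_abs (g i j)]; ring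
  linarith

/-- In a near-optimal vector configuration every vector on one side is close to a linear
combination of the vectors on the other side. -/
theorem BoundsVectors.exists_combination (hβ : BoundsVectors g β) (hg : ∑ i, ∑ j, |g i j| ≤ 1)
    {y : I → V} {x : J → V} (hy : ∀ i, ‖y i‖ ≤ 1) (hx : ∀ j, ‖x j‖ ≤ 1) (i : I) (j : J)
    (hij : g i j ≠ 0) :
    ∃ h : J → ℝ, ‖y i - ∑ j, h j • x j‖ ^ 2 ≤
      16 / g i j ^ 2 * (β - ∑ i, ∑ j, g i j * inner ℝ (y i) (x j)) := by
  set ε := β - ∑ i, ∑ j, g i j * inner ℝ (y i) (x j) with hε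
  have hε0 : 0 ≤ ε := sub_nonneg.2 (hβ V y x hy hx)
  have hpos : 0 < g i j ^ 2 := by positivity
  -- For small `ε` one has `‖w‖ ≥ g i j ^ 2 / 8`, and `w / ‖w‖` is within squared distance `2ε /
  -- ‖w‖` of `y i`. For large `ε` the bound exceeds `1`, and the zero combination suffices.
  rcases le_or_gt ε (g i j ^ 2 / 8) with hle | hgt
  · have h1 := hβ.norm_sub_inner_le hy hx i
    have h2 := hβ.le_norm_sum hg hy hx i j
    rw [← hε] at h1 h2
    set w := ∑ j, g i j • x j with hw
    have hw8 : g i j ^ 2 / 8 ≤ ‖w‖ := by linarith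
    have hw0 : 0 < ‖w‖ := by linarith
    refine ⟨fun j => ‖w‖⁻¹ * g i j, ?_⟩
    have e : ∑ j, (‖w‖⁻¹ * g i j) • x j = ‖w‖⁻¹ • w := by
      rw [hw, Finset.smul_sum]; simp only [smul_smul]
    have e2 : ‖(‖w‖⁻¹ • w)‖ = 1 := by
      rw [norm_smul, norm_inv, norm_norm, inv_mul_cancel₀ hw0.ne']
    rw [e, norm_sub_sq_real, e2, inner_smul_right]
    have h3 : ‖y i‖ ^ 2 ≤ 1 := by nlinarith [hy i, norm_nonneg (y i)]
    have h4 : 1 - ‖w‖⁻¹ * inner ℝ (y i) w ≤ ‖w‖⁻¹ * ε := by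
      have := mul_le_mul_of_nonneg_left h1 (inv_nonneg.2 hw0.le)
      rwa [mul_sub, inv_mul_cancel₀ hw0.ne'] at this
    have h5 : ‖w‖⁻¹ * ε ≤ 8 / g i j ^ 2 * ε := by
      refine mul_le_mul_of_nonneg_right ?_ hε0
      rw [inv_le_comm₀ hw0 (by positivity), inv_div]
      exact hw8
    have h6 : 16 / g i j ^ 2 * ε = 2 * (8 / g i j ^ 2 * ε) := by ring
    rw [h6]
    linarith
  · refine ⟨0, ?_⟩
    have h3 : ‖y i‖ ^ 2 ≤ 1 := by nlinarith [hy i, norm_nonneg (y i)]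
    have h4 : 1 ≤ 16 / g i j ^ 2 * ε := by
      rw [div_mul_eq_mul_div, le_div_iff₀ hpos]
      linarith
    simpa using h3.trans h4

end NearOptimalVectors

/-! ### Rounding for XOR games -/

section XORRounding

/-- A complex matrix as a vector of a real inner product space. -/
def matrixVec {a b : Type} (M : Matrix a b ℂ) : PiLp 2 (fun _ : a × b => ℂ) :=
  WithLp.toLp 2 fun q => M q.1 q.2

theorem norm_matrixVec {a b : Type} [Fintype a] [Fintype b] (M : Matrix a b ℂ) :
    ‖matrixVec M‖ = fro M := rfl

theorem inner_matrixVec {a b : Type} [Fintype a] [Fintype b] (M N : Matrix a b ℂ) :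
    inner ℝ (matrixVec M) (matrixVec N) = (Mᴴ * N).trace.re := by
  rw [PiLp.inner_apply, trace_mul_re, Finset.sum_comm, ← Fintype.sum_prod_type']
  refine Finset.sum_congr rfl fun q _ => ?_
  simp [matrixVec, Complex.inner]
  ring

theorem matrixVec_sub_sum {a b J : Type} [Fintype J] (M : Matrix a b ℂ) (h : J → ℝ)
    (N : J → Matrix a b ℂ) : matrixVec M - ∑ j, h j • matrixVec (N j) =
      matrixVec (M - ∑ j, (h j : ℂ) • N j) := by
  ext q
  simp [matrixVec, Matrix.sum_apply]

/-- Contractions on an `r`-dimensional space, scaled by `1/√r`, are vectors of norm at most `1`.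
Compressed observables on a cut therefore cannot beat the optimal bias, which is what the selection
of a cut requires. -/
theorem BoundsVectors.matrix {I J : Type} [Fintype I] [Fintype J] {g : I → J → ℝ} {β : ℝ}
    (hβ : BoundsVectors g β) {S : Type} [Fintype S] [DecidableEq S]
    (X : I → Matrix S S ℂ) (Y : J → Matrix S S ℂ) (hXh : ∀ i, (X i).IsHermitian)
    (hX : ∀ i, ‖X i‖ ≤ 1) (hY : ∀ j, ‖Y j‖ ≤ 1) :
    ∑ i, ∑ j, g i j * (X i * Y j).trace.re ≤ β * Fintype.card S := by
  rcases isEmpty_or_nonempty S with hS | hS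
  · simp [Matrix.trace]
  have hc : (0 : ℝ) < Fintype.card S := by exact_mod_cast Fintype.card_pos
  set t := (Real.sqrt (Fintype.card S))⁻¹ with ht
  have ht0 : 0 ≤ t := by positivity
  have htc : t * t = (Fintype.card S : ℝ)⁻¹ := by
    rw [ht, ← mul_inv, Real.mul_self_sqrt hc.le]
  have hn : ∀ Z : Matrix S S ℂ, ‖Z‖ ≤ 1 → ‖t • matrixVec Z‖ ≤ 1 := fun Z hZ => by
    rw [norm_smul, Real.norm_eq_abs, abs_of_nonneg ht0, norm_matrixVec, ht]
    exact inv_mul_le_one_of_le₀ (fro_le_sqrt_card hZ) (Real.sqrt_nonneg _)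
  have h := hβ _ (fun i => t • matrixVec (X i)) (fun j => t • matrixVec (Y j))
    (fun i => hn _ (hX i)) (fun j => hn _ (hY j))
  have e : ∑ i, ∑ j, g i j * inner ℝ (t • matrixVec (X i)) (t • matrixVec (Y j))
      = (∑ i, ∑ j, g i j * (X i * Y j).trace.re) * (Fintype.card S : ℝ)⁻¹ := by
    rw [Finset.sum_mul]
    refine Finset.sum_congr rfl fun i _ => ?_
    rw [Finset.sum_mul]
    refine Finset.sum_congr rfl fun j _ => ?_
    rw [real_inner_smul_left, real_inner_smul_right, inner_matrixVec, (hXh i).eq, ← htc]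
    ring
  rw [e, mul_inv_le_iff₀ hc] at h
  exact h

theorem BoundsVectors.exists_matrix_combination {I J a b : Type} [Fintype I] [Fintype J] [Fintype a]
    [Fintype b] {g : I → J → ℝ} {β : ℝ} (hβ : BoundsVectors g β) (hg : ∑ i, ∑ j, |g i j| ≤ 1)
    {Y : I → Matrix a b ℂ} {X : J → Matrix a b ℂ} (hY : ∀ i, fro (Y i) ≤ 1)
    (hX : ∀ j, fro (X j) ≤ 1) (i : I) (j : J) (hij : g i j ≠ 0) :
    ∃ h : J → ℝ, fro (Y i - ∑ j, (h j : ℂ) • X j) ^ 2 ≤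
      16 / g i j ^ 2 * (β - ∑ i, ∑ j, g i j * ((Y i)ᴴ * X j).trace.re) := by
  obtain ⟨h, hh⟩ := hβ.exists_combination hg (y := fun i => matrixVec (Y i))
    (x := fun j => matrixVec (X j)) hY hX i j hij
  refine ⟨h, ?_⟩
  simp only [matrixVec_sub_sum, norm_matrixVec, inner_matrixVec] at hh
  exact hh

variable {m n : ℕ}

theorem sum_smul_isHermitian {J a : Type} [Fintype J] (h : J → ℝ)
    {X : J → Matrix a a ℂ} (hX : ∀ j, (X j).IsHermitian) :
    (∑ j, (h j : ℂ) • X j).IsHermitian := by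
  rw [Matrix.IsHermitian, Matrix.conjTranspose_sum]
  refine Finset.sum_congr rfl fun k _ => ?_
  rw [Matrix.conjTranspose_smul, (hX k).eq, Complex.star_def, Complex.conj_ofReal]

theorem XORStrategy.norm_Y_le {dA dB : ℕ} (S : XORStrategy m n dA dB) (i : Fin m) : ‖S.Y i‖ ≤ 1 :=
  norm_le_one_of_sq_eq_one (S.Y_selfAdjoint i) (S.Y_sq i)

theorem XORStrategy.X_transpose_sq {dA dB : ℕ} (S : XORStrategy m n dA dB) (j : Fin n) :
    (S.X j)ᵀ * (S.X j)ᵀ = 1 := by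
  rw [← Matrix.transpose_mul, S.X_sq, Matrix.transpose_one]

theorem XORStrategy.norm_X_transpose_le {dA dB : ℕ} (S : XORStrategy m n dA dB) (j : Fin n) :
    ‖(S.X j)ᵀ‖ ≤ 1 :=
  norm_le_one_of_sq_eq_one (S.X_selfAdjoint j).transpose (S.X_transpose_sq j)

theorem XORGame.bias_eq {dA dB : ℕ} (G : XORGame m n) (S : XORStrategy m n dA dB) :
    G.bias S = ∑ i, ∑ j, G.cost i j *
      ((S.Y i * stateMatrix S.ψ)ᴴ * (stateMatrix S.ψ * (S.X j)ᵀ)).trace.re := by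
  refine Finset.sum_congr rfl fun i _ => Finset.sum_congr rfl fun j _ => ?_
  rw [expectation_eq_trace, Matrix.conjTranspose_mul, (S.Y_selfAdjoint i).eq]
  simp only [Matrix.mul_assoc]

theorem XORGame.bias_eq' {dA dB : ℕ} (G : XORGame m n) (S : XORStrategy m n dA dB) :
    G.bias S = ∑ j, ∑ i, G.cost i j *
      ((stateMatrix S.ψ * (S.X j)ᵀ)ᴴ * (S.Y i * stateMatrix S.ψ)).trace.re := by
  rw [G.bias_eq, Finset.sum_comm]
  refine Finset.sum_congr rfl fun j _ => Finset.sum_congr rfl fun i _ => ?_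
  rw [← inner_matrixVec, ← inner_matrixVec, real_inner_comm]

/-- In a near-optimal strategy for an XOR game all observables almost commute with the absolute
values of the state. -/
theorem XORGame.fro_commutator_le (G : XORGame m n) {dA dB : ℕ} (S : XORStrategy m n dA dB)
    {T : Type} [Fintype T] [DecidableEq T] (σ : Schmidt (stateMatrix S.ψ) T) (i : Fin m) (j : Fin n)
    (hij : 0 < G.prob i j) :
    fro (S.Y i * σ.abs - σ.abs * S.Y i) ≤
        16 / G.prob i j * Real.sqrt (G.optimalBias - G.bias S) ∧
      fro ((S.X j)ᵀ * σ.symm.abs - σ.symm.abs * (S.X j)ᵀ) ≤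
        16 / G.prob i j * Real.sqrt (G.optimalBias - G.bias S) := by
  have hK1 : fro (stateMatrix S.ψ) = 1 := fro_stateMatrix S.ψ_unit
  have hy1 : ∀ i, fro (S.Y i * stateMatrix S.ψ) ≤ 1 := fun i => by
    rw [← hK1]; exact fro_mul_le_of_norm_le_one (S.norm_Y_le i) _
  have hx1 : ∀ j, fro (stateMatrix S.ψ * (S.X j)ᵀ) ≤ 1 := fun j => by
    rw [← hK1]; exact fro_mul_le_of_norm_le_one' _ (S.norm_X_transpose_le j)
  have hcost : G.cost i j ≠ 0 := by
    rw [← abs_pos, G.abs_cost]; exact hij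
  have hsq : G.cost i j ^ 2 = G.prob i j ^ 2 := by rw [← sq_abs, G.abs_cost]
  have hε0 : 0 ≤ G.optimalBias - G.bias S := sub_nonneg.2 (G.bias_le_optimalBias S)
  have key : ∀ f : ℝ, 0 ≤ f → f ^ 2 ≤ 16 / G.cost i j ^ 2 * (G.optimalBias - G.bias S) →
      4 * f ≤ 16 / G.prob i j * Real.sqrt (G.optimalBias - G.bias S) := fun f hf h => by
    have h1 : f ≤ 4 / G.prob i j * Real.sqrt (G.optimalBias - G.bias S) := by
      refine le_of_sq_le_sq (h.trans_eq ?_) (by positivity)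
      rw [mul_pow, Real.sq_sqrt hε0, div_pow, hsq]; norm_num
    calc 4 * f ≤ 4 * (4 / G.prob i j * Real.sqrt (G.optimalBias - G.bias S)) := by gcongr
      _ = _ := by ring
  constructor
  · obtain ⟨h, hh⟩ := G.boundsVectors.exists_matrix_combination G.sum_abs_cost.le hy1 hx1 i j hcost
    rw [← G.bias_eq S] at hh
    -- The combination of the vectors `K (X j)ᵀ` is `K G` with `G = ∑ h j (X j)ᵀ`, and `G` is
    -- Hermitian because the coefficients are real.
    simp only [← Matrix.mul_smul, ← Matrix.mul_sum] at hh
    exact (σ.fro_commutator_abs_le (S.Y_selfAdjoint i)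
      (sum_smul_isHermitian h fun j => (S.X_selfAdjoint j).transpose)).trans
      (key _ (fro_nonneg _) hh)
  · obtain ⟨h, hh⟩ := G.boundsVectors.swap.exists_matrix_combination
      (by rw [Finset.sum_comm]; exact G.sum_abs_cost.le) hx1 hy1 j i hcost
    rw [← G.bias_eq' S, fro_sub_comm] at hh
    simp only [← Matrix.smul_mul, ← Matrix.sum_mul] at hh
    exact (σ.fro_commutator_abs_symm_le (sum_smul_isHermitian h S.Y_selfAdjoint)
      (S.X_selfAdjoint j).transpose).trans (key _ (fro_nonneg _) hh)

/-- A self-adjoint unitary compressed to an almost invariant subspace is close to a self-adjoint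
unitary of the subspace. -/
theorem exists_observable_near_compression {a s : Type*} [Fintype a] [DecidableEq a]
    [Fintype s] [DecidableEq s] {Y : Matrix a a ℂ} (hY : Y.IsHermitian) (hY2 : Y * Y = 1)
    {V : Matrix a s ℂ} (hV : Vᴴ * V = 1) :
    ∃ Z : Matrix s s ℂ, Z.IsHermitian ∧ Z * Z = 1 ∧
      fro (Z - Vᴴ * (Y * V)) ≤ fro ((1 - V * Vᴴ) * (Y * V)) := by
  have hh : (Vᴴ * (Y * V)).IsHermitian := by
    have := Matrix.isHermitian_conjTranspose_mul_mul V hY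
    rwa [Matrix.mul_assoc] at this
  obtain ⟨Z, h1, h2, h3⟩ := exists_observable_near hh
  refine ⟨Z, h1, h2, h3.trans ?_⟩
  have := fro_compress_mul_compress_le hV (F := Y) (norm_le_one_of_sq_eq_one hY hY2)
  rwa [hY2, Matrix.one_mul, hV, fro_sub_comm] at this

/-- Rounding for XOR games. -/
theorem XORGame.exists_maxEntangled_near (G : XORGame m n) (hrow : ∀ i, ∃ j, 0 < G.prob i j)
    (hcol : ∀ j, ∃ i, 0 < G.prob i j) :
    ∃ C : ℝ, 0 < C ∧ ∀ (dA dB : ℕ) (S : XORStrategy m n dA dB),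
      ∃ (r : ℕ) (S' : XORStrategy m n r r), IsMaximallyEntangled S'.ψ ∧
        G.optimalBias - G.bias S' ≤ C * Real.sqrt (G.optimalBias - G.bias S) +
          C * (G.optimalBias - G.bias S) ^ (1 / 4 : ℝ) ∧
        S.IsCloseOnSupport S' (C * (G.optimalBias - G.bias S) ^ (1 / 4 : ℝ)) := by
  classical
  set c : ℝ := ∑ i, ∑ j, 16 / G.prob i j with hc
  have hterm : ∀ i j, 0 ≤ 16 / G.prob i j := fun i j => div_nonneg (by norm_num) (G.prob_nonneg i j)
  have hc0 : 0 ≤ c := Finset.sum_nonneg fun i _ => Finset.sum_nonneg fun j _ => hterm i j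
  have hci : ∀ i j, 16 / G.prob i j ≤ c := fun i j =>
    (Finset.single_le_sum (f := fun j => 16 / G.prob i j) (fun j _ => hterm i j)
      (Finset.mem_univ j)).trans
    (Finset.single_le_sum (f := fun i => ∑ j, 16 / G.prob i j)
      (fun i _ => Finset.sum_nonneg fun j _ => hterm i j) (Finset.mem_univ i))
  set C₁ : ℝ := (3 * ((m : ℝ) + n) + 1) * c + 2 with hC₁
  have hC₁pos : 0 < C₁ := by positivity
  refine ⟨C₁ + 2 * Real.sqrt C₁, by positivity, fun dA dB S => ?_⟩
  obtain ⟨T, ⟨σ⟩⟩ := exists_schmidt (stateMatrix S.ψ)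
  set ε := G.optimalBias - G.bias S with hε
  have hε0 : 0 ≤ ε := sub_nonneg.2 (G.bias_le_optimalBias S)
  -- Absorbs the linear term of the selection bound into `√ε`; it accounts for the summand `2` in
  -- `C₁`.
  have hε2 : ε ≤ 2 * Real.sqrt ε := by
    have h1 : ε ≤ 4 := by linarith [G.optimalBias_le_one, (abs_le.1 (G.abs_bias_le_one S)).1]
    have h2 : Real.sqrt ε ≤ 2 := by
      rw [Real.sqrt_le_left (by norm_num)]; linarith
    nlinarith [Real.mul_self_sqrt hε0, Real.sqrt_nonneg ε]
  have hδY : ∀ i, fro (S.Y i * σ.abs - σ.abs * S.Y i) ≤ c * Real.sqrt ε := fun i => by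
    obtain ⟨j, hj⟩ := hrow i
    exact (G.fro_commutator_le S σ i j hj).1.trans (by gcongr; exact hci i j)
  have hδX : ∀ j, fro ((S.X j)ᵀ * σ.symm.abs - σ.symm.abs * (S.X j)ᵀ) ≤ c * Real.sqrt ε := fun j => by
    obtain ⟨i, hi⟩ := hcol j
    exact (G.fro_commutator_le S σ i j hi).2.trans (by gcongr; exact hci i j)
  obtain ⟨P, hPne, hPE, hPF, hPv⟩ := σ.exists_good_cut (κ := Fin m) (μ := Fin n)
    (fro_stateMatrix S.ψ_unit) S.Y (fun j => (S.X j)ᵀ) S.norm_Y_le S.norm_X_transpose_le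
    (ε := ε) (β := G.optimalBias) hδY hδX G.cost
    (fun P => by
      have := G.boundsVectors.matrix (fun i => (σ.cut P)ᴴ * (S.Y i * σ.cut P))
        (fun j => (σ.symm.cut P)ᴴ * ((S.X j)ᵀ * σ.symm.cut P)) (fun i => by
          have := Matrix.isHermitian_conjTranspose_mul_mul (σ.cut P) (S.Y_selfAdjoint i)
          rwa [Matrix.mul_assoc] at this)
        (fun i => norm_mul_le_one (norm_conjTranspose_le_one
          (norm_le_one_of_conjTranspose_mul_self (σ.cut_isometry P))) (norm_mul_le_one
          (S.norm_Y_le i) (norm_le_one_of_conjTranspose_mul_self (σ.cut_isometry P))))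
        (fun j => norm_mul_le_one (norm_conjTranspose_le_one
          (norm_le_one_of_conjTranspose_mul_self (σ.symm.cut_isometry P))) (norm_mul_le_one
          (S.norm_X_transpose_le j) (norm_le_one_of_conjTranspose_mul_self
          (σ.symm.cut_isometry P))))
      rwa [Fintype.card_coe] at this)
    (by
      rw [hε, sub_sub_cancel]
      simp only [XORGame.bias, expectation_eq_trace]
      exact le_rfl)
  rw [G.sum_abs_cost, Fintype.card_fin, Fintype.card_fin] at hPE hPF hPv
  set M' := (3 * ((m : ℝ) + n) + 1) * (c * Real.sqrt ε) + ε with hM'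
  set L := C₁ * Real.sqrt ε with hL
  have hM'L : M' ≤ L := by rw [hM', hL, hC₁]; linarith
  have hL0 : 0 ≤ L := by positivity
  set r := P.card with hr
  have hrpos : 0 < r := Finset.card_pos.2 hPne
  have hrr : (0 : ℝ) < r := by exact_mod_cast hrpos
  set γ := Real.sqrt (L * r) with hγ
  have hγ0 : 0 ≤ γ := Real.sqrt_nonneg _
  have hγr : γ = Real.sqrt C₁ * ε ^ (1 / 4 : ℝ) * Real.sqrt r := by
    rw [hγ, Real.sqrt_mul hL0, hL, sqrt_mul_sqrt_eq hC₁pos.le hε0]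
  have hPE' : ∀ i, fro ((1 - σ.cut P * (σ.cut P)ᴴ) * (S.Y i * σ.cut P)) ≤ γ := fun i =>
    Real.le_sqrt_of_sq_le ((hPE i).trans (by gcongr))
  have hPF' : ∀ j, fro ((1 - σ.symm.cut P * (σ.symm.cut P)ᴴ) *
      ((S.X j)ᵀ * σ.symm.cut P)) ≤ γ := fun j =>
    Real.le_sqrt_of_sq_le ((hPF j).trans (by gcongr))
  have hVA := σ.cut_isometry P
  have hVB := σ.symm.cut_isometry P
  choose Q hQ hQ2 hQd using fun i =>
    exists_observable_near_compression (S.Y_selfAdjoint i) (S.Y_sq i) hVA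
  choose R hR hR2 hRd using fun j =>
    exists_observable_near_compression (S.X_selfAdjoint j).transpose (S.X_transpose_sq j) hVB
  let e : Fin r ≃ P := P.equivFin.symm
  let S' : XORStrategy m n r r :=
    { Y := fun i => (Q i).submatrix e e
      X := fun j => (R j)ᵀ.submatrix e e
      Y_selfAdjoint := fun i => (hQ i).submatrix e
      X_selfAdjoint := fun j => (hR j).transpose.submatrix e
      Y_sq := fun i => by rw [Matrix.submatrix_mul_equiv, hQ2, Matrix.submatrix_one_equiv]
      X_sq := fun j => by
        rw [Matrix.submatrix_mul_equiv, ← Matrix.transpose_mul, hR2, Matrix.transpose_one,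
          Matrix.submatrix_one_equiv]
      ψ := maxEntangledState r
      ψ_unit := maxEntangledState_unit hrpos }
  have hclose : γ + γ ≤ (C₁ + 2 * Real.sqrt C₁) * ε ^ (1 / 4 : ℝ) * Real.sqrt r := by
    rw [hγr]
    have : 0 ≤ C₁ * (ε ^ (1 / 4 : ℝ) * Real.sqrt r) := by positivity
    linarith
  refine ⟨r, S', maxEntangledState_isMaximallyEntangled r, ?_, ?_⟩
  · set τ : Fin m → Fin n → ℝ := fun i j => (((σ.cut P)ᴴ * (S.Y i * σ.cut P)) *
        ((σ.symm.cut P)ᴴ * ((S.X j)ᵀ * σ.symm.cut P))).trace.re with hτ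
    -- Costs have signs, so rounding errors enter linearly through Cauchy–Schwarz. After division by
    -- `r` this leaves a bias error of order `ε ^ (1/4)`.
    have hQR : ∀ i j, |τ i j - (Q i * R j).trace.re| ≤ 2 * γ * Real.sqrt r := fun i j => by
      have hX1 : ‖(σ.cut P)ᴴ * (S.Y i * σ.cut P)‖ ≤ 1 := norm_mul_le_one
        (norm_conjTranspose_le_one (norm_le_one_of_conjTranspose_mul_self hVA))
        (norm_mul_le_one (S.norm_Y_le i) (norm_le_one_of_conjTranspose_mul_self hVA))
      have hQd' := (hQd i).trans (hPE' i)
      have hRd' := (hRd j).trans (hPF' j)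
      have hR1 := norm_le_one_of_sq_eq_one (hR j) (hR2 j)
      simp only [hτ]
      generalize (σ.cut P)ᴴ * (S.Y i * σ.cut P) = X at *
      generalize (σ.symm.cut P)ᴴ * ((S.X j)ᵀ * σ.symm.cut P) = Y at *
      have e1 : Q i * R j = X * Y + (Q i - X) * R j + X * (R j - Y) := by
        rw [Matrix.sub_mul, Matrix.mul_sub]; abel
      rw [e1, Matrix.trace_add, Matrix.trace_add, Complex.add_re, Complex.add_re]
      have i1 : |((Q i - X) * R j).trace.re| ≤ γ * Real.sqrt r := by
        refine (abs_trace_mul_le _ _).trans (mul_le_mul hQd' ?_ (fro_nonneg _) hγ0)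
        simpa using fro_le_sqrt_card hR1
      have i2 : |(X * (R j - Y)).trace.re| ≤ γ * Real.sqrt r := by
        rw [mul_comm γ]
        refine (abs_trace_mul_le _ _).trans (mul_le_mul ?_ hRd' (fro_nonneg _) (Real.sqrt_nonneg _))
        simpa using fro_le_sqrt_card hX1
      rw [abs_le] at i1 i2 ⊢
      constructor <;> linarith [i1.1, i1.2, i2.1, i2.2]
    have hbias : G.bias S' = (∑ i, ∑ j, G.cost i j * (Q i * R j).trace.re) / r := by
      rw [XORGame.bias, Finset.sum_div]
      refine Finset.sum_congr rfl fun i _ => ?_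
      rw [Finset.sum_div]
      refine Finset.sum_congr rfl fun j _ => ?_
      simp only [S']
      rw [expectation_maxEntangledState, trace_submatrix_mul, mul_div_assoc]
    have hdiff : ∑ i, ∑ j, G.cost i j * τ i j - ∑ i, ∑ j, G.cost i j * (Q i * R j).trace.re
        ≤ 2 * γ * Real.sqrt r := by
      rw [← one_mul (2 * γ * Real.sqrt r), ← G.sum_abs_cost, Finset.sum_mul,
        ← Finset.sum_sub_distrib]
      refine Finset.sum_le_sum fun i _ => ?_
      rw [Finset.sum_mul, ← Finset.sum_sub_distrib]
      refine Finset.sum_le_sum fun j _ => ?_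
      rw [← mul_sub]
      refine (le_abs_self _).trans ?_
      rw [abs_mul]
      exact mul_le_mul_of_nonneg_left (hQR i j) (abs_nonneg _)
    have hγrr : γ * Real.sqrt r = Real.sqrt C₁ * ε ^ (1 / 4 : ℝ) * r := by
      rw [hγr, mul_assoc, Real.mul_self_sqrt hrr.le]
    have h1 : G.optimalBias * r - L * r - 2 * (Real.sqrt C₁ * ε ^ (1 / 4 : ℝ) * r) ≤
        ∑ i, ∑ j, G.cost i j * (Q i * R j).trace.re := by
      have h2 := mul_le_mul_of_nonneg_right hM'L hrr.le
      rw [mul_assoc, hγrr] at hdiff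
      linarith
    have h3 : G.optimalBias - L - 2 * (Real.sqrt C₁ * ε ^ (1 / 4 : ℝ)) ≤ G.bias S' := by
      rw [hbias, le_div_iff₀ hrr]
      linarith
    have h4 : 0 ≤ 2 * Real.sqrt C₁ * Real.sqrt ε := by positivity
    have h5 : 0 ≤ C₁ * ε ^ (1 / 4 : ℝ) := by positivity
    rw [hL] at h3
    linarith
  · refine ⟨(σ.cut P).submatrix id e, (σ.symm.cut P)ᴴᵀ.submatrix id e, submatrix_isometry hVA e,
      submatrix_isometry (conj_isometry hVB) e, fun i => ?_, fun j => ?_⟩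
    · apply littleFrobenius_submatrix_le e hrpos
      refine le_trans ?_ hclose
      exact (fro_mul_sub_mul_le hVA _ _).trans (add_le_add (hPE' i) ((hQd i).trans (hPE' i)))
    · apply littleFrobenius_conj_submatrix_le (S.X_selfAdjoint j) (hR j) e hrpos
      refine le_trans ?_ hclose
      exact (fro_mul_sub_mul_le hVB _ _).trans (add_le_add (hPF' j) ((hRd j).trans (hPF' j)))

/-- The bias deficit can be as large as `2`, so it is halved before exponents are lowered. -/
theorem rpow_le_two_mul_rpow {x y p : ℝ} (hx : 0 ≤ x) (hx2 : x ≤ 2) (hxy : x ≤ y)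
    (hp : 1 / 8 ≤ p) (hp1 : p ≤ 1) : x ^ p ≤ 2 * y ^ (1 / 8 : ℝ) := by
  have h1 : x ^ p = 2 ^ p * (x / 2) ^ p := by
    rw [← Real.mul_rpow (by norm_num) (by positivity)]; congr 1; ring
  have h2 : (x / 2) ^ p ≤ y ^ (1 / 8 : ℝ) :=
    rpow_le_rpow_of_le_one (by positivity) (by linarith) (by linarith) (by norm_num) hp
  have h3 : (2 : ℝ) ^ p ≤ 2 := by
    simpa using Real.rpow_le_rpow_of_exponent_le (by norm_num : (1 : ℝ) ≤ 2) hp1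
  rw [h1]
  exact mul_le_mul h3 h2 (by positivity) (by norm_num)

theorem XORGame.exists_rounding (G : XORGame m n) (hrow : ∀ i, ∃ j, 0 < G.prob i j)
    (hcol : ∀ j, ∃ i, 0 < G.prob i j) :
    ∃ C : ℝ, 0 < C ∧ ∀ (ε : ℝ), 0 ≤ ε → ∀ (dA dB : ℕ) (S : XORStrategy m n dA dB),
      G.IsOptimalUpTo ε S → ∃ (r : ℕ) (S' : XORStrategy m n r r),
        IsMaximallyEntangled S'.ψ ∧ G.IsOptimalUpTo (C * ε ^ (1 / 8 : ℝ)) S' ∧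
        S.IsCloseOnSupport S' (C * ε ^ (1 / 8 : ℝ)) := by
  obtain ⟨C, hC, h⟩ := G.exists_maxEntangled_near hrow hcol
  refine ⟨4 * C, by positivity, fun ε hε dA dB S hS => ?_⟩
  obtain ⟨r, S', hme, hbias, VA, VB, h1, h2, h3, h4⟩ := h dA dB S
  set x := G.optimalBias - G.bias S with hx
  have hx0 : 0 ≤ x := sub_nonneg.2 (G.bias_le_optimalBias S)
  have hx2 : x ≤ 2 := by linarith [G.optimalBias_le_one, (abs_le.1 (G.abs_bias_le_one S)).1]
  have hxε : x ≤ ε := by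
    unfold XORGame.IsOptimalUpTo at hS
    linarith [(abs_le.1 hS).1]
  have k1 : Real.sqrt x ≤ 2 * ε ^ (1 / 8 : ℝ) := by
    rw [Real.sqrt_eq_rpow]
    exact rpow_le_two_mul_rpow hx0 hx2 hxε (by norm_num) (by norm_num)
  have k2 : x ^ (1 / 4 : ℝ) ≤ 2 * ε ^ (1 / 8 : ℝ) :=
    rpow_le_two_mul_rpow hx0 hx2 hxε (by norm_num) (by norm_num)
  have k1' := mul_le_mul_of_nonneg_left k1 hC.le
  have k2' := mul_le_mul_of_nonneg_left k2 hC.le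
  have k3 : 0 ≤ C * ε ^ (1 / 8 : ℝ) := by positivity
  have k4 : C * x ^ (1 / 4 : ℝ) ≤ 4 * C * ε ^ (1 / 8 : ℝ) := by linarith
  refine ⟨r, S', hme, ?_, VA, VB, h1, h2, fun i => (h3 i).trans k4, fun j => (h4 j).trans k4⟩
  have := G.bias_le_optimalBias S'
  rw [XORGame.IsOptimalUpTo, abs_le]
  constructor <;> linarith

end XORRounding

end

theorem corollary1p3 :
    -- synchronous games
    (∀ {I : Type u} {A : Type w} [Fintype I] [Fintype A]
        (G : NonlocalGame (fun _ : I => A) (fun _ : I => A)),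
        G.IsSynchronous → (∀ i, 0 < G.η i i) →
        ∃ C : ℝ, 0 < C ∧ ∀ (ε : ℝ), 0 ≤ ε → ∀ (d : ℕ)
          (S : QStrategy (fun _ : I => A) (fun _ : I => A) d d),
          S.IsSynchronous → G.IsPerfectUpTo ε S →
          ∃ (r : ℕ) (S' : QStrategy (fun _ : I => A) (fun _ : I => A) r r),
            S'.IsProjective ∧ IsMaximallyEntangled S'.ψ ∧
            G.IsOptimalUpTo (C * ε ^ (1 / 4 : ℝ)) S' ∧
            S.IsCloseOnSupport S' (C * ε ^ (1 / 8 : ℝ))) ∧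
    -- binary constraint system games
    (∀ {m n : ℕ} (B : BinaryConstraintSystem m n) (η : Fin m → Fin n → ℝ)
        (η_nonneg : ∀ i j, 0 ≤ η i j) (η_sum : ∑ i, ∑ j, η i j = 1),
        (∀ i, ∀ j ∈ B.K i, 0 < η i j) → (∀ j, ∃ i, j ∈ B.K i) →
        ∃ C : ℝ, 0 < C ∧ ∀ (ε : ℝ), 0 ≤ ε → ∀ (dA dB : ℕ)
          (S : QStrategy B.Answer (fun _ : Fin n => ℤˣ) dA dB),
          S.IsProjective → (B.game η η_nonneg η_sum).IsPerfectUpTo ε S →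
          ∃ (r : ℕ) (S' : QStrategy B.Answer (fun _ : Fin n => ℤˣ) r r),
            S'.IsProjective ∧ IsMaximallyEntangled S'.ψ ∧
            (B.game η η_nonneg η_sum).IsOptimalUpTo (C * ε ^ (1 / 2 : ℝ)) S' ∧
            S.IsCloseOnSupport S' (C * ε ^ (1 / 4 : ℝ))) ∧
    -- XOR games
    (∀ {m n : ℕ} (G : XORGame m n),
        (∀ i, ∃ j, 0 < G.prob i j) → (∀ j, ∃ i, 0 < G.prob i j) →
        ∃ C : ℝ, 0 < C ∧ ∀ (ε : ℝ), 0 ≤ ε → ∀ (dA dB : ℕ) (S : XORStrategy m n dA dB),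
          G.IsOptimalUpTo ε S →
          ∃ (r : ℕ) (S' : XORStrategy m n r r),
            IsMaximallyEntangled S'.ψ ∧
            G.IsOptimalUpTo (C * ε ^ (1 / 8 : ℝ)) S' ∧
            S.IsCloseOnSupport S' (C * ε ^ (1 / 8 : ℝ))) := by
  refine ⟨fun G hG hη => ?_, fun B η η_nonneg η_sum hη hK => ?_, fun G hrow hcol =>
    G.exists_rounding hrow hcol⟩
  · obtain ⟨C, hC, h⟩ := hG.exists_rounding hη
    refine ⟨C, hC, fun ε _ d S hS hp => ?_⟩
    obtain ⟨r, S', h1, h2, h3⟩ := h d d S hS.1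
    -- The rounding is available for every exponent up to `1/2`; here `p = 1/4` gives the required
    -- rates, and `p = 1/2` serves for BCS games.
    obtain ⟨h4, h5⟩ := h3 ε (1 / 4) hp (by norm_num) (by norm_num)
    rw [show (1 / 4 / 2 : ℝ) = 1 / 8 by norm_num] at h5
    exact ⟨r, S', h1, h2, h4, h5⟩
  · obtain ⟨C, hC, h⟩ := B.exists_rounding η η_nonneg η_sum hη hK
    refine ⟨C, hC, fun ε _ dA dB S hS hp => ?_⟩
    obtain ⟨r, S', h1, h2, h3⟩ := h dA dB S hS
    obtain ⟨h4, h5⟩ := h3 ε (1 / 2) hp (by norm_num) (by norm_num)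
    rw [show (1 / 2 / 2 : ℝ) = 1 / 4 by norm_num] at h5
    exact ⟨r, S', h1, h2, h4, h5⟩
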